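/- **Setting.** Let $n\ge 3$. The digraph algebra $A(G)\subseteq M_N(\mathbb{C})$ of a transitive reflexive digraph $G$ on $N$ vertices is the span of the matrix units $e_{ij}$ for which $G$ has an edge from $v_j$ to $v_i$. Let $D_{2n}$ be the digraph on $2n$ vertices with a loop at each vertex and $2n$ further edges, between cyclically successive vertices, with alternating orientations. A finite direct sum of $2n$-cycle algebras is a digraph algebra $A(G)$ whose reduced digraph $G_r$ (obtained by identifying vertices that are joined by edges in both directions) is a disjoint union of finitely many copies of $D_{2n}$. Its homology $H_1A(G)$ is the first integral simplicial homology group of the complex whose simplices are the complete subdigraphs of $G_r$. A homomorphism $A\to A'$ is *star-extendible* if it is the restriction of a star-algebra homomorphism $C^*(A)\to C^*(A')$ of the generated C*-algebras. A star-extendible embedding $i:A(D_{2n})\to A$ has *multiplicity one* if each $i(e_{jj})$ has rank one, and is *proper* if the projections $i(e_{jj})$ are pairwise inequivalent in $A\cap A^*$; such an $i$ induces a map of reduced digraphs and hence a homomorphism $i_*:H_1A(D_{2n})\to H_1A$. A star-extendible injective homomorphism $\phi:A_1\to A_2$ between finite direct sums of $2n$-cycle algebras is *rigid* if, for each proper multiplicity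 one embedding $\eta:A(D_{2n})\to A_1$, the map $\phi\circ\eta$ is a direct sum $i_1\oplus\dots\oplus i_N$ of proper multiplicity one embeddings. The induced map $H_1\phi:H_1A_1\to H_1A_2$ is the homomorphism with $H_1\phi\circ\eta_*=\sum_r (i_r)_*$ for all such $\eta$ and all such decompositions. For a tower $A_1\subseteq A_2\subseteq\cdots$ of finite direct sums of $2n$-cycle algebras with rigid inclusions $\alpha_k:A_k\to A_{k+1}$, let $\mathcal{A}_0$ be its algebraic limit and $\mathcal{A}$ the norm-closed limit, that is, the closure of the union of the $A_k$, star-extendibly embedded in a C*-algebra. Put $H_1\mathcal{A}:=H_1\mathcal{A}_0:=\varinjlim(H_1A_k,H_1\alpha_k)$. **Corollary 3.4.** The abelian group $H_1\mathcal{A}$ is well defined and is an invariant for star-extendible isomorphism. That is: 1. for each rigid embedding $\phi:A_1\to A_2$ between finite direct sums of $2n$-cycle algebras there is exactly one homomorphism $H_1\phi:H_1A_1\to H_1A_2$ as above; 2. if two such towers have the same norm-closed limit $\mathcal{A}$, then their limit homology groups are isomorphic; 3. if $\mathcal{A}$ and $\mathcal{A}'$ are the norm-closed limits of two such towers (for the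 same $n$) and there is a star-extendible algebra isomorphism from $\mathcal{A}$ onto $\mathcal{A}'$, then $H_1\mathcal{A}\cong H_1\mathcal{A}'$ as abelian groups. -/

import Mathlib

noncomputable section

namespace CycleAlgebra

/-! ## First simplicial homology of a reduced digraph

A transitive reflexive digraph is a preorder: `v ≤ w` means that there is an edge from `w` to `v`.
A reduced one is a partial order. Its simplicial complex has as simplices the complete
subdigraphs, that is, the finite chains; each simplex is oriented by the order. -/

/-- The oriented `1`-simplices. -/
abbrev Simplex1 (P : Type*) [PartialOrder P] := {e : P × P // e.1 < e.2}

/-- The oriented `2`-simplices. -/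
abbrev Simplex2 (P : Type*) [PartialOrder P] := {t : P × P × P // t.1 < t.2.1 ∧ t.2.1 < t.2.2}

/-- The `1`-chain of the pair `a, b`; it is zero if `a, b` do not span an edge from `a` up
to `b`. -/
def edgeChain {P : Type*} [PartialOrder P] (a b : P) : Simplex1 P →₀ ℤ :=
  open Classical in if h : a < b then Finsupp.single ⟨(a, b), h⟩ 1 else 0

/-- The boundary map from `1`-chains to `0`-chains. -/
def boundary1 (P : Type*) [PartialOrder P] : (Simplex1 P →₀ ℤ) →ₗ[ℤ] (P →₀ ℤ) :=
  Finsupp.linearCombination ℤ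
    fun e => Finsupp.single e.1.2 (1 : ℤ) - Finsupp.single e.1.1 (1 : ℤ)

/-- The boundary map from `2`-chains to `1`-chains. -/
def boundary2 (P : Type*) [PartialOrder P] : (Simplex2 P →₀ ℤ) →ₗ[ℤ] (Simplex1 P →₀ ℤ) :=
  Finsupp.linearCombination ℤ
    fun t => edgeChain t.1.2.1 t.1.2.2 - edgeChain t.1.1 t.1.2.2 + edgeChain t.1.1 t.1.2.1

/-- The first integral simplicial homology group: `1`-cycles modulo boundaries. -/
abbrev H1 (P : Type*) [PartialOrder P] : Type _ :=
  LinearMap.ker (boundary1 P) ⧸ (LinearMap.range (boundary2 P)).submoduleOf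
    (LinearMap.ker (boundary1 P))

/-- The map of `1`-chains induced by a monotone map of vertices; collapsed edges go to zero. -/
def chainMap1 {P Q : Type*} [PartialOrder P] [PartialOrder Q] (f : P →o Q) :
    (Simplex1 P →₀ ℤ) →ₗ[ℤ] (Simplex1 Q →₀ ℤ) :=
  Finsupp.linearCombination ℤ fun e => edgeChain (f e.1.1) (f e.1.2)

theorem chainMap1_edgeChain {P Q : Type*} [PartialOrder P] [PartialOrder Q] (f : P →o Q)
    {a b : P} (h : a < b) : chainMap1 f (edgeChain a b) = edgeChain (f a) (f b) := by
  simp [edgeChain, chainMap1, h]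

theorem boundary1_edgeChain {P : Type*} [PartialOrder P] {a b : P} (h : a ≤ b) :
    boundary1 P (edgeChain a b) = Finsupp.single b (1 : ℤ) - Finsupp.single a (1 : ℤ) := by
  rcases h.lt_or_eq with h | rfl
  · simp [edgeChain, boundary1, h]
  · simp [edgeChain]

theorem boundary1_chainMap1 {P Q : Type*} [PartialOrder P] [PartialOrder Q] (f : P →o Q)
    (c : Simplex1 P →₀ ℤ) :
    boundary1 Q (chainMap1 f c) = Finsupp.lmapDomain ℤ ℤ f (boundary1 P c) := by
  suffices h : (boundary1 Q).comp (chainMap1 f)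
      = (Finsupp.lmapDomain ℤ ℤ f).comp (boundary1 P) from LinearMap.congr_fun h c
  ext1 e
  ext1
  have := boundary1_edgeChain (f.monotone e.2.le)
  simp [chainMap1, this]
  simp [boundary1, Finsupp.mapDomain_sub, Finsupp.mapDomain_single]

theorem chainMap1_boundary2 {P Q : Type*} [PartialOrder P] [PartialOrder Q] (f : P →o Q)
    (c : Simplex2 P →₀ ℤ) :
    chainMap1 f (boundary2 P c) ∈ LinearMap.range (boundary2 Q) := by
  induction c using Finsupp.induction_linear with
  | zero => simp
  | add x y hx hy => simpa using add_mem hx hy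
  | single t m =>
    obtain ⟨⟨a, b, c⟩, hab, hbc⟩ := t
    simp only at hab hbc
    have key : chainMap1 f (boundary2 P (Finsupp.single ⟨(a, b, c), hab, hbc⟩ m))
        = m • (edgeChain (f b) (f c) - edgeChain (f a) (f c) + edgeChain (f a) (f b)) := by
      simp [boundary2, chainMap1_edgeChain, hab, hbc, hab.trans hbc]
    rw [key]
    apply Submodule.smul_mem
    rcases (f.monotone hab.le).lt_or_eq with h1 | h1
    · rcases (f.monotone hbc.le).lt_or_eq with h2 | h2
      · exact ⟨Finsupp.single ⟨(f a, f b, f c), h1, h2⟩ 1, by simp [boundary2]⟩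
      · rw [← h2]; simp [edgeChain]
    · rw [h1]; simp [edgeChain]

/-- The homomorphism of first homology groups induced by a monotone map of vertices. -/
def H1.map {P Q : Type*} [PartialOrder P] [PartialOrder Q] (f : P →o Q) : H1 P →ₗ[ℤ] H1 Q :=
  Submodule.mapQ _ _
    ((chainMap1 f).restrict (p := LinearMap.ker (boundary1 P)) (q := LinearMap.ker (boundary1 Q))
      (fun c hc => by
        rw [LinearMap.mem_ker] at hc ⊢
        rw [boundary1_chainMap1, hc, map_zero]))
    (by
      rintro ⟨c, hc⟩ ⟨d, hd⟩
      have := chainMap1_boundary2 f d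
      rw [hd] at this
      exact this)

/-! ## Generated C*-algebras and star-extendible homomorphisms -/

section StarExtendible

variable {E : Type*} [NonUnitalRing E] [StarRing E] [Module ℂ E] [IsScalarTower ℂ E E]
  [SMulCommClass ℂ E E] [StarModule ℂ E] [TopologicalSpace E] [IsTopologicalRing E]
  [ContinuousStar E] [ContinuousConstSMul ℂ E]
variable {F : Type*} [NonUnitalRing F] [StarRing F] [Module ℂ F] [IsScalarTower ℂ F F]
  [SMulCommClass ℂ F F] [StarModule ℂ F] [TopologicalSpace F] [IsTopologicalRing F]
  [ContinuousStar F] [ContinuousConstSMul ℂ F]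

/-- `C*(A)`: the closed star subalgebra generated by `A`. -/
def generatedCStar (A : NonUnitalSubalgebra ℂ E) : NonUnitalStarSubalgebra ℂ E :=
  (NonUnitalStarAlgebra.adjoin ℂ (A : Set E)).topologicalClosure

theorem mem_generatedCStar (A : NonUnitalSubalgebra ℂ E) (a : A) :
    (a : E) ∈ generatedCStar A :=
  NonUnitalStarSubalgebra.le_topologicalClosure _ (NonUnitalStarAlgebra.subset_adjoin ℂ _ a.2)

/-- A homomorphism `A → A'` is star-extendible if it is the restriction of a star-algebra
homomorphism `C*(A) → C*(A')`. -/
def IsStarExtendible {A : NonUnitalSubalgebra ℂ E} {A' : NonUnitalSubalgebra ℂ F}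
    (φ : A →ₙₐ[ℂ] A') : Prop :=
  ∃ Φ : generatedCStar A →⋆ₙₐ[ℂ] generatedCStar A',
    ∀ a : A, (Φ ⟨a, mem_generatedCStar A a⟩ : F) = φ a

/-- There is a star-extendible (algebra) isomorphism from `A` onto `A'`. -/
def StarExtendiblyIsomorphic (A : NonUnitalSubalgebra ℂ E) (A' : NonUnitalSubalgebra ℂ F) :
    Prop :=
  ∃ φ : A →ₙₐ[ℂ] A', Function.Bijective φ ∧ IsStarExtendible φ

/-- Equivalence of projections of `A ∩ A*`, by a partial isometry of `A ∩ A*`. -/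
def ProjEquiv (A : NonUnitalSubalgebra ℂ E) (p q : E) : Prop :=
  ∃ v : E, v ∈ A ∧ star v ∈ A ∧ star v * v = p ∧ v * star v = q

end StarExtendible

/-! ## Digraph algebras and cycle algebras -/

/-- The digraph algebra `A(G)` of a transitive reflexive digraph on the vertex set `X`: the
span of the matrix units `e_{ij}` for which there is an edge from `j` to `i`. -/
def digraphAlgebra (X : Type*) [Fintype X] [Preorder X] : NonUnitalSubalgebra ℂ (Matrix X X ℂ) where
  carrier := {M | ∀ i j, ¬ i ≤ j → M i j = 0}
  zero_mem' := fun _ _ _ => rfl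
  add_mem' := fun {M N} hM hN i j h => by simp [hM i j h, hN i j h]
  smul_mem' := fun c M hM i j h => by simp [hM i j h]
  mul_mem' := fun {M N} hM hN i j h => by
    rw [Matrix.mul_apply]
    refine Finset.sum_eq_zero fun k _ => ?_
    by_cases hik : i ≤ k
    · rw [hN k j fun hkj => h (hik.trans hkj), mul_zero]
    · rw [hM i k hik, zero_mul]

/-- The diagonal matrix unit `e_{jj}` of a digraph algebra. -/
def diagUnit {X : Type*} [Fintype X] [DecidableEq X] [Preorder X] (j : X) : digraphAlgebra X :=
  ⟨Matrix.single j j 1, fun a b h => by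
    rw [Matrix.single_apply, if_neg]
    rintro ⟨rfl, rfl⟩
    exact h le_rfl⟩

/-- The vertices `0, …, 2n - 1` of the cycle digraph `D_{2n}`. -/
def CycleVertex (n : ℕ) : Type := Fin (2 * n)

instance (n : ℕ) : Fintype (CycleVertex n) := inferInstanceAs (Fintype (Fin (2 * n)))

instance (n : ℕ) : DecidableEq (CycleVertex n) := inferInstanceAs (DecidableEq (Fin (2 * n)))

/-- The position of a vertex along the cycle. -/
def CycleVertex.pos {n : ℕ} (i : CycleVertex n) : ℕ := Fin.val (n := 2 * n) i

theorem CycleVertex.pos_injective {n : ℕ} : Function.Injective (CycleVertex.pos (n := n)) :=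
  fun _ _ h => Fin.ext h

/-- The edges of `D_{2n}`: a loop at each vertex, and an edge from each odd vertex to each of the
two even vertices next to it on the cycle. So the edges between successive vertices have
alternating orientations, and the vertex `0` is a range vertex. -/
instance (n : ℕ) : PartialOrder (CycleVertex n) where
  le i j := i = j ∨ (Even i.pos ∧ Odd j.pos ∧
    ((i.pos + 1) % (2 * n) = j.pos ∨ (j.pos + 1) % (2 * n) = i.pos))
  le_refl i := Or.inl rfl
  le_trans i j k hij hjk := by
    rcases hij with rfl | ⟨_, hj, _⟩
    · exact hjk
    · rcases hjk with rfl | ⟨hj', _, _⟩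
      · right; simp_all
      · exact absurd hj (Nat.not_odd_iff_even.mpr hj')
  le_antisymm i j hij hji := by
    rcases hij with h | ⟨_, hj, _⟩
    · exact h
    · rcases hji with h | ⟨hj', _, _⟩
      · exact h.symm
      · exact absurd hj (Nat.not_odd_iff_even.mpr hj')

/-- The reduced digraph of a transitive reflexive digraph. -/
abbrev Reduced (X : Type*) [Preorder X] := Antisymmetrization X (· ≤ ·)

/-- `A(X)` is a finite direct sum of `2n`-cycle algebras: the reduced digraph of `X` is a disjoint
union of finitely many copies of `D_{2n}`. -/
def IsCycleSum (n : ℕ) (X : Type*) [Preorder X] : Prop :=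
  ∃ s : ℕ, Nonempty (Reduced X ≃o Σ _ : Fin s, CycleVertex n)

section Rigid

variable {X Y : Type*} [Fintype X] [DecidableEq X] [Preorder X] [Fintype Y] [DecidableEq Y]
  [Preorder Y]

/-- A proper multiplicity one star-extendible embedding of `A(D_{2n})` in `A(Y)`: the images of
the `e_{jj}` have rank one and are pairwise inequivalent. -/
def IsProperEmbedding (n : ℕ)
    (i : digraphAlgebra (CycleVertex n) →ₙₐ[ℂ] digraphAlgebra Y) : Prop :=
  IsStarExtendible i ∧
  (∀ j, (i (diagUnit j) : Matrix Y Y ℂ).rank = 1) ∧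
  ∀ j l, j ≠ l → ¬ ProjEquiv (digraphAlgebra Y) (i (diagUnit j) : Matrix Y Y ℂ) (i (diagUnit l))

/-- `φ` is the direct sum of the homomorphisms `i r`. -/
def IsDirectSum {n N : ℕ} (φ : digraphAlgebra (CycleVertex n) →ₙₐ[ℂ] digraphAlgebra Y)
    (i : Fin N → digraphAlgebra (CycleVertex n) →ₙₐ[ℂ] digraphAlgebra Y) : Prop :=
  (∀ a, φ a = ∑ r, i r a) ∧ ∀ r s, r ≠ s → ∀ a b, i r a * i s b = 0

/-- Rigid embeddings: star-extendible injections whose composition with each proper multiplicity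
one embedding of `A(D_{2n})` is a direct sum of proper multiplicity one embeddings. -/
def IsRigid (n : ℕ) (φ : digraphAlgebra X →ₙₐ[ℂ] digraphAlgebra Y) : Prop :=
  IsStarExtendible φ ∧ Function.Injective φ ∧
  ∀ η : digraphAlgebra (CycleVertex n) →ₙₐ[ℂ] digraphAlgebra X, IsProperEmbedding n η →
    ∃ (N : ℕ) (i : Fin N → digraphAlgebra (CycleVertex n) →ₙₐ[ℂ] digraphAlgebra Y),
      (∀ r, IsProperEmbedding n (i r)) ∧ IsDirectSum (φ.comp η) i

/-- `f` is the map of reduced digraphs that `i` induces: the image of `e_{jj}` lives in the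
diagonal block that belongs to the vertex `f j` of the reduced digraph of `Y`. -/
def InducesVertexMap {n : ℕ} (i : digraphAlgebra (CycleVertex n) →ₙₐ[ℂ] digraphAlgebra Y)
    (f : CycleVertex n →o Reduced Y) : Prop :=
  ∀ (j : CycleVertex n) (x y : Y), (i (diagUnit j) : Matrix Y Y ℂ) x y ≠ 0 →
    toAntisymmetrization (· ≤ ·) x = f j ∧ toAntisymmetrization (· ≤ ·) y = f j

/-- `h` is the homomorphism of first homology groups that the rigid embedding `φ` induces: if
`φ ∘ η` is the direct sum of the `i r`, with `η` and all `i r` proper of multiplicity one, then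
`h` composed with the map induced by `η` is the sum of the maps induced by the `i r`. -/
def IsH1Map (n : ℕ) (φ : digraphAlgebra X →ₙₐ[ℂ] digraphAlgebra Y)
    (h : H1 (Reduced X) →ₗ[ℤ] H1 (Reduced Y)) : Prop :=
  ∀ (η : digraphAlgebra (CycleVertex n) →ₙₐ[ℂ] digraphAlgebra X) (f : CycleVertex n →o Reduced X)
    (N : ℕ) (i : Fin N → digraphAlgebra (CycleVertex n) →ₙₐ[ℂ] digraphAlgebra Y)
    (g : Fin N → CycleVertex n →o Reduced Y),
    IsProperEmbedding n η → InducesVertexMap η f →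
    (∀ r, IsProperEmbedding n (i r)) → (∀ r, InducesVertexMap (i r) (g r)) →
    IsDirectSum (φ.comp η) i →
    h ∘ₗ H1.map f = ∑ r, H1.map (g r)

/-- `H₁φ`, the homomorphism induced by a rigid embedding. -/
def inducedH1 (n : ℕ) (φ : digraphAlgebra X →ₙₐ[ℂ] digraphAlgebra Y) :
    H1 (Reduced X) →ₗ[ℤ] H1 (Reduced Y) :=
  open Classical in if h : ∃ f, IsH1Map n φ f then h.choose else 0

end Rigid

/-! ## Towers and their limits -/

/-- A tower `A_0 → A_1 → ⋯` of finite direct sums of `2n`-cycle algebras with rigid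
embeddings. -/
structure Tower (n : ℕ) where
  /-- The vertices of the digraph of `A_k`. -/
  V : ℕ → Type
  [fintypeV : ∀ k, Fintype (V k)]
  [decEqV : ∀ k, DecidableEq (V k)]
  [preorderV : ∀ k, Preorder (V k)]
  isCycleSum : ∀ k, IsCycleSum n (V k)
  /-- The embedding of `A_k` in `A_{k+1}`. -/
  incl : ∀ k, digraphAlgebra (V k) →ₙₐ[ℂ] digraphAlgebra (V (k + 1))
  isRigid : ∀ k, IsRigid n (incl k)

attribute [instance] Tower.fintypeV Tower.decEqV Tower.preorderV

namespace Tower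

variable {n : ℕ} (T : Tower n)

/-- The homomorphism `H₁A_j → H₁A_k`, for `j ≤ k`: the composition of the `H₁` of the successive
embeddings. -/
def H1Trans (j k : ℕ) (hjk : j ≤ k) : H1 (Reduced (T.V j)) →ₗ[ℤ] H1 (Reduced (T.V k)) :=
  Nat.leRec (motive := fun k _ => H1 (Reduced (T.V j)) →ₗ[ℤ] H1 (Reduced (T.V k)))
    LinearMap.id (fun {k} _ f => inducedH1 n (T.incl k) ∘ₗ f) hjk

/-- The limit homology group: the direct limit of the groups `H₁A_k`. -/
abbrev limitH1 : Type :=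
  Module.DirectLimit (fun k => H1 (Reduced (T.V k))) T.H1Trans

/-- `𝒜` is the norm-closed limit of the tower: `𝒜` is a norm-closed subalgebra of a C*-algebra, and
the `A_k` are star-extendibly embedded in `𝒜`, compatibly with the embeddings of the tower, so that
the union of their images is dense in `𝒜`. -/
def HasLimit {B : Type*} [NonUnitalCStarAlgebra B] (𝒜 : NonUnitalSubalgebra ℂ B) : Prop :=
  IsClosed (𝒜 : Set B) ∧
  ∃ ι : ∀ k, digraphAlgebra (T.V k) →ₙₐ[ℂ] 𝒜,
    (∀ k, IsStarExtendible (ι k)) ∧ (∀ k, Function.Injective (ι k)) ∧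
    (∀ k, (ι (k + 1)).comp (T.incl k) = ι k) ∧
    (𝒜 : Set B) ⊆ closure (⋃ k, Set.range fun a => (ι k a : B))

end Tower

end CycleAlgebra

end

noncomputable section

set_option linter.unusedSectionVars false

namespace CycleAlgebra

open scoped Matrix.Norms.L2Operator

/-! ## Partial isometries and ranks of matrices -/

section Rank

variable {X : Type*} [Fintype X] [DecidableEq X]

/-! A disjoint union of cycles of length at least six contains no squares, and such a partial order
has no 2-simplices. Homology classes are therefore the same thing as 1-cycles, and everything can be
done inside groups of 1-chains.

The link with operators is the 1-chain of a normalising partial isometry `w`, one whose initial and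
final projections are block diagonal: it records the ranks of the strictly upper blocks.
Square-freeness makes these blocks mutually orthogonal partial isometries (`IsNormalizing.blk`,
`IsNormalizing.orthogonal_blk`). Hence the chain is additive on orthogonal sums, unchanged by
diagonal equivalence, zero on the diagonal, and equal for partial isometries at norm distance less
than one. It is also universal with respect to the algebraic rules (`IsInvariant.apply_eq`), and its
boundary is the 0-chain of the initial projection minus that of the final one (`boundary1_chain`).

So a star-extendible homomorphism acts linearly on chains (`chain_map`) and preserves cycles, and
this action has the defining property of the induced map (`isH1Map_homologyMap`). Uniqueness holds
because the components of the reduced digraph are images of proper embeddings, on which rigidity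
forces the value (`IsH1Map.eq`).

For the limit, normalising partial isometries of `𝒜` are defined without reference to a tower. By
the stability result `exists_isNormalizing_lift`, each of them is a limit of normalising partial
isometries of the stages of any given tower. Close ones have equal chains in the limit, so each
obtains a class `chainClass`, which obeys the same algebraic rules. A stage of one tower, viewed
inside `𝒜`, thus maps its chains to the limit chains of another tower. The resulting maps are
mutually inverse (`compare_compare`) and respect cycles (`compare_mem`). An isomorphism of limit
algebras only transports a tower from one algebra to the other
(`LimitEmbedding.nonempty_of_bijective`). -/

theorem rank_star_mul_self (w : Matrix X X ℂ) : (star w * w).rank = w.rank := by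
  rw [Matrix.star_eq_conjTranspose]
  open scoped ComplexOrder in exact Matrix.rank_conjTranspose_mul_self w

theorem rank_eq_trace_of_isIdempotentElem {p : Matrix X X ℂ} (hp : p * p = p) :
    (p.rank : ℂ) = p.trace := by
  have h : LinearMap.IsProj (LinearMap.range (Matrix.toLin' p)) (Matrix.toLin' p) := by
    refine ⟨fun x => ⟨x, rfl⟩, ?_⟩
    rintro _ ⟨y, rfl⟩
    rw [← LinearMap.comp_apply, ← Matrix.toLin'_mul, hp]
  rw [← Matrix.trace_toLin'_eq, h.trace]
  rfl

/-- The initial projection is idempotent and has the same rank. Traces are linear, so this turns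
counts of ranks into linear identities. -/
theorem rank_eq_trace {w : Matrix X X ℂ} (hw : w * star w * w = w) :
    (w.rank : ℂ) = (star w * w).trace := by
  rw [← rank_star_mul_self, rank_eq_trace_of_isIdempotentElem]
  rw [mul_assoc, ← mul_assoc w, hw]

theorem star_mul_star_mul {w : Matrix X X ℂ} (hw : w * star w * w = w) :
    star w * w * star w = star w := by
  have := congrArg star hw
  simpa [mul_assoc] using this

theorem rank_add_of_orthogonal {v w : Matrix X X ℂ} (hv : v * star v * v = v)
    (hw : w * star w * w = w) (h1 : star v * w = 0) (h2 : v * star w = 0) :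
    (v + w).rank = v.rank + w.rank := by
  have h3 : star w * v = 0 := by simpa using congrArg star h1
  have h4 : w * star v = 0 := by simpa using congrArg star h2
  have h5 : (v + w) * star (v + w) * (v + w) = v + w := by
    simp only [star_add, add_mul, mul_add, hv, hw, h2, h4, mul_assoc, h1, h3]
    simp
  have : ((v + w).rank : ℂ) = ((v.rank + w.rank : ℕ) : ℂ) := by
    push_cast
    rw [rank_eq_trace h5, rank_eq_trace hv, rank_eq_trace hw, star_add, add_mul, mul_add, mul_add,
      h1, h3]
    simp
  exact_mod_cast this

theorem norm_le_one_of_partialIsometry {b : Matrix X X ℂ} (hb : b * star b * b = b) :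
    ‖b‖ ≤ 1 := by
  set p := star b * b with hp
  have hpp : p * p = p := by rw [hp, mul_assoc, ← mul_assoc b, hb]
  have h1 : ‖p‖ ≤ 1 := by
    have hsp : star p = p := by simp [hp]
    have : ‖p‖ = ‖p‖ * ‖p‖ := by
      have := CStarRing.norm_star_mul_self (x := p)
      rwa [hsp, hpp] at this
    nlinarith [norm_nonneg p]
  have h2 : ‖b‖ * ‖b‖ = ‖p‖ := (CStarRing.norm_star_mul_self).symm
  nlinarith [norm_nonneg b]

/-- The rank of a partial isometry is lower semicontinuous with modulus one. -/
theorem rank_le_of_norm_sub_lt_one {b c : Matrix X X ℂ} (hb : b * star b * b = b)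
    (h : ‖b - c‖ < 1) : b.rank ≤ c.rank := by
  set p := star b * b with hp
  have hpp : p * p = p := by rw [hp, mul_assoc, ← mul_assoc b, hb]
  have hps : p * star b = star b := star_mul_star_mul hb
  have hbp : b * p = b := by rw [hp, ← mul_assoc, hb]
  have hb1 := norm_le_one_of_partialIsometry hb
  have hn : ‖star b * (b - c) * p‖ < 1 := by
    have e : star b * (b - c) * p = star b * ((b - c) * star b) * b := by
      rw [hp]; simp only [mul_assoc]
    have hsb : ‖star b‖ ≤ 1 := by rwa [norm_star]
    calc _ = ‖star b * ((b - c) * star b) * b‖ := by rw [e]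
      _ ≤ ‖star b‖ * (‖b - c‖ * ‖star b‖) * ‖b‖ := by
        refine (norm_mul_le _ _).trans ?_
        gcongr
        refine (norm_mul_le _ _).trans ?_
        gcongr
        exact norm_mul_le _ _
      _ ≤ 1 * (‖b - c‖ * 1) * 1 := by gcongr
      _ < 1 := by simpa using h
  -- The unit `g = 1 - star b * (b - c) * p` satisfies `p * g = star b * c * p`, so the initial
  -- projection `p` of `b` factors through `c`.
  obtain ⟨g, hg⟩ := isUnit_one_sub_of_norm_lt_one hn
  have key : p * (g : Matrix X X ℂ) = star b * c * p := by
    rw [hg, mul_sub, mul_one, ← mul_assoc, ← mul_assoc p, hps, mul_sub, ← hp, sub_mul, hpp]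
    abel
  have hpe : p = star b * c * p * (↑g⁻¹ : Matrix X X ℂ) := by
    rw [← key, mul_assoc, Units.mul_inv, mul_one]
  calc b.rank = p.rank := (rank_star_mul_self b).symm
    _ ≤ (star b * c).rank := by
      conv_lhs => rw [hpe, mul_assoc (star b * c)]
      exact Matrix.rank_mul_le_left _ _
    _ ≤ c.rank := Matrix.rank_mul_le_right _ _

end Rank

/-! ## Blocks of matrices over a preorder -/

section Blocks

variable {X : Type*} [Preorder X]

/-- The vertex of the reduced digraph to which `x` belongs. -/
def cls (x : X) : Reduced X := toAntisymmetrization (· ≤ ·) x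

theorem cls_le_cls {x y : X} : cls x ≤ cls y ↔ x ≤ y :=
  toAntisymmetrization_le_toAntisymmetrization_iff

/-- A representative of a vertex of the reduced digraph. -/
def rep (a : Reduced X) : X := ofAntisymmetrization (· ≤ ·) a

@[simp] theorem cls_rep (a : Reduced X) : cls (rep a) = a :=
  toAntisymmetrization_ofAntisymmetrization _ a

variable [Fintype X] [DecidableEq X]

instance : Finite (Reduced X) := Quotient.finite _

instance : Fintype (Reduced X) := Fintype.ofFinite _

/-- The unit of the diagonal block of `a`. -/
def proj (a : Reduced X) : Matrix X X ℂ :=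
  open Classical in Matrix.diagonal fun x => if cls x = a then 1 else 0

/-- The block of `M` in the rows of `a` and the columns of `b`. -/
def blk (a b : Reduced X) (M : Matrix X X ℂ) : Matrix X X ℂ := proj a * M * proj b

open Classical in
theorem blk_apply (a b : Reduced X) (M : Matrix X X ℂ) (x y : X) :
    blk a b M x y = if cls x = a ∧ cls y = b then M x y else 0 := by
  simp only [blk, proj, Matrix.diagonal_mul, Matrix.mul_diagonal]
  by_cases h1 : cls x = a <;> by_cases h2 : cls y = b <;> simp [h1, h2]

@[simp] theorem star_proj (a : Reduced X) : star (proj a) = proj a := by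
  rw [Matrix.star_eq_conjTranspose, proj, Matrix.diagonal_conjTranspose]
  congr 1; ext x; simp [apply_ite]

@[simp] theorem proj_mul_self (a : Reduced X) : proj a * proj a = proj a := by
  simp [proj]

theorem proj_mul_proj {a b : Reduced X} (h : a ≠ b) : proj a * proj b = 0 := by
  rw [proj, proj, Matrix.diagonal_mul_diagonal, ← Matrix.diagonal_zero]
  congr 1; ext x
  by_cases h1 : cls x = a <;> by_cases h2 : cls x = b <;> simp_all

theorem sum_proj : ∑ a : Reduced X, proj a = 1 := by
  ext x y
  simp only [proj, Matrix.sum_apply, Matrix.diagonal_apply, Matrix.one_apply]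
  by_cases h : x = y
  · subst h
    simp only [if_true]
    rw [Finset.sum_eq_single (cls x)] <;> simp +contextual [eq_comm]
  · simp [h]

theorem norm_proj_le (a : Reduced X) : ‖proj a‖ ≤ 1 :=
  norm_le_one_of_partialIsometry (by simp)

theorem norm_blk_le (a b : Reduced X) (M : Matrix X X ℂ) : ‖blk a b M‖ ≤ ‖M‖ := by
  calc ‖blk a b M‖ ≤ ‖proj a‖ * ‖M‖ * ‖proj b‖ :=
        (norm_mul_le _ _).trans (by gcongr; exact norm_mul_le _ _)
    _ ≤ 1 * ‖M‖ * 1 := by gcongr <;> exact norm_proj_le _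
    _ = ‖M‖ := by simp

theorem blk_sub (a b : Reduced X) (M N : Matrix X X ℂ) :
    blk a b (M - N) = blk a b M - blk a b N := by
  simp [blk, mul_sub, sub_mul]

theorem blk_add (a b : Reduced X) (M N : Matrix X X ℂ) :
    blk a b (M + N) = blk a b M + blk a b N := by
  simp [blk, mul_add, add_mul]

theorem star_blk (a b : Reduced X) (M : Matrix X X ℂ) : star (blk a b M) = blk b a (star M) := by
  simp [blk, mul_assoc]

theorem sum_blk (M : Matrix X X ℂ) : ∑ ab : Reduced X × Reduced X, blk ab.1 ab.2 M = M := by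
  rw [Fintype.sum_prod_type]
  simp only [blk, ← Finset.mul_sum, sum_proj, mul_one, ← Finset.sum_mul, one_mul]

/-- The block diagonal matrices: the diagonal `A ∩ A*` of the digraph algebra `A`. -/
def blockDiag (X : Type*) [Preorder X] [Fintype X] [DecidableEq X] :
    StarSubalgebra ℂ (Matrix X X ℂ) where
  carrier := {M | ∀ x y, M x y ≠ 0 → cls x = cls y}
  mul_mem' := by
    intro M N hM hN x y h
    obtain ⟨k, -, hk⟩ := Finset.exists_ne_zero_of_sum_ne_zero (Matrix.mul_apply (M := M) ▸ h)
    exact (hM x k (left_ne_zero_of_mul hk)).trans (hN k y (right_ne_zero_of_mul hk))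
  add_mem' := by
    intro M N hM hN x y h
    by_contra hc
    have h1 : M x y = 0 := by by_contra h'; exact hc (hM x y h')
    have h2 : N x y = 0 := by by_contra h'; exact hc (hN x y h')
    simp [h1, h2] at h
  algebraMap_mem' := by
    intro r x y h
    rw [Matrix.algebraMap_matrix_apply] at h
    by_cases hxy : x = y
    · rw [hxy]
    · simp [hxy] at h
  star_mem' := by
    intro M hM x y h
    exact (hM y x (by simpa [Matrix.star_apply] using h)).symm

theorem mem_blockDiag {M : Matrix X X ℂ} :
    M ∈ blockDiag X ↔ ∀ x y, M x y ≠ 0 → cls x = cls y := Iff.rfl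

theorem mem_digraphAlgebra {M : Matrix X X ℂ} :
    M ∈ digraphAlgebra X ↔ ∀ x y, M x y ≠ 0 → cls x ≤ cls y := by
  simp only [cls_le_cls]
  exact forall₂_congr fun x y => ⟨fun h h' => by_contra fun hc => h' (h hc),
    fun h hc => by_contra fun h' => hc (h h')⟩

theorem blockDiag_le {M : Matrix X X ℂ} (h : M ∈ blockDiag X) : M ∈ digraphAlgebra X :=
  mem_digraphAlgebra.2 fun x y hxy => (h x y hxy).le

theorem mem_blockDiag_iff {M : Matrix X X ℂ} :
    M ∈ blockDiag X ↔ M ∈ digraphAlgebra X ∧ star M ∈ digraphAlgebra X := by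
  refine ⟨fun h => ⟨blockDiag_le h, blockDiag_le (star_mem h)⟩, fun ⟨h1, h2⟩ x y h => ?_⟩
  refine le_antisymm (mem_digraphAlgebra.1 h1 x y h) (mem_digraphAlgebra.1 h2 y x ?_)
  simpa [Matrix.star_apply] using h

theorem proj_mem (a : Reduced X) : proj a ∈ blockDiag X := by
  intro x y h
  by_cases hxy : x = y
  · rw [hxy]
  · simp [proj, hxy] at h

theorem commute_proj {M : Matrix X X ℂ} (h : M ∈ blockDiag X) (a : Reduced X) :
    proj a * M = M * proj a := by
  ext x y
  simp only [proj, Matrix.diagonal_mul, Matrix.mul_diagonal]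
  by_cases hM : M x y = 0
  · simp [hM]
  · rw [h x y hM, mul_comm]

/-- Converse of `commute_proj`. It shows that a matrix commuting with the commutant of a block
diagonal matrix, such as one obtained by functional calculus, is block diagonal. -/
theorem mem_blockDiag_of_commute {M : Matrix X X ℂ} (h : ∀ a, proj a * M = M * proj a) :
    M ∈ blockDiag X := by
  intro x y hxy
  have := congrFun (congrFun (h (cls x)) x) y
  simp only [proj, Matrix.diagonal_mul, Matrix.mul_diagonal] at this
  by_contra hc
  rw [if_neg (Ne.symm hc)] at this
  simp [hxy] at this

theorem proj_mul_mul_proj {M : Matrix X X ℂ} (h : M ∈ blockDiag X) {a b : Reduced X} (hab : a ≠ b) :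
    proj a * M * proj b = 0 := by
  rw [commute_proj h, mul_assoc, proj_mul_proj hab, mul_zero]

theorem blk_diag_mem (a : Reduced X) (M : Matrix X X ℂ) : blk a a M ∈ blockDiag X := by
  intro x y h
  rw [blk_apply] at h
  by_cases h' : cls x = a ∧ cls y = a
  · rw [h'.1, h'.2]
  · simp [h'] at h

theorem blk_mem_digraphAlgebra {M : Matrix X X ℂ} (h : M ∈ digraphAlgebra X) (a b : Reduced X) :
    blk a b M ∈ digraphAlgebra X :=
  (digraphAlgebra X).mul_mem ((digraphAlgebra X).mul_mem (blockDiag_le (proj_mem a)) h)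
    (blockDiag_le (proj_mem b))

theorem blk_eq_zero_of_not_le {M : Matrix X X ℂ} (h : M ∈ digraphAlgebra X) {a b : Reduced X}
    (hab : ¬ a ≤ b) : blk a b M = 0 := by
  ext x y
  rw [blk_apply]
  split_ifs with h'
  · by_contra hc
    exact hab (h'.1 ▸ h'.2 ▸ mem_digraphAlgebra.1 h x y hc)
  · rfl

/-- No two vertices have two different common upper bounds, in the reduced digraph. -/
def SquareFree (P : Type*) [PartialOrder P] : Prop :=
  ∀ a b c d : P, a ≤ c → a ≤ d → b ≤ c → b ≤ d → a = b ∨ c = d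

/-- By square-freeness the class of `z` is the only one above the two distinct classes of `x` and
`y`. Only indices `k` in that class contribute to the entry, so inserting `proj c` changes nothing.
-/
theorem mul_proj_mul_star_apply (hX : SquareFree (Reduced X)) {M N : Matrix X X ℂ}
    (hM : M ∈ digraphAlgebra X) (hN : N ∈ digraphAlgebra X) {c : Reduced X} {x y z : X}
    (hxy : cls x ≠ cls y) (hz : cls z = c) (hxz : x ≤ z) (hyz : y ≤ z) :
    (M * proj c * star N) x y = (M * star N) x y := by
  rw [Matrix.mul_apply, Matrix.mul_apply]
  refine Finset.sum_congr rfl fun k _ => ?_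
  simp only [proj, Matrix.mul_diagonal]
  by_cases hk : cls k = c
  · simp [hk]
  · have : M x k * (star N) k y = 0 := by
      by_contra h
      have h1 := mem_digraphAlgebra.1 hM x k (left_ne_zero_of_mul h)
      have h2 := mem_digraphAlgebra.1 hN y k
        (by simpa [Matrix.star_apply] using right_ne_zero_of_mul h)
      rcases hX (cls x) (cls y) (cls k) (cls z) h1 (cls_le_cls.2 hxz) h2 (cls_le_cls.2 hyz)
        with h | h
      · exact hxy h
      · exact hk (h.trans hz)
    rw [this]; simp [hk]

/-- A nonzero off-diagonal entry would produce a vertex of class `c` above both indices, and would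
then be an entry of `M * star M`, which has none off the diagonal. -/
theorem mul_proj_mul_star_mem (hX : SquareFree (Reduced X)) {M : Matrix X X ℂ}
    (hM : M ∈ digraphAlgebra X) (h : M * star M ∈ blockDiag X) (c : Reduced X) :
    M * proj c * star M ∈ blockDiag X := by
  intro x y hxy
  by_contra hc
  obtain ⟨k, -, hk⟩ := Finset.exists_ne_zero_of_sum_ne_zero
    (Matrix.mul_apply (M := M * proj c) ▸ hxy)
  have h2 := mem_digraphAlgebra.1 hM y k
    (by simpa [Matrix.star_apply] using right_ne_zero_of_mul hk)
  have h1 := left_ne_zero_of_mul hk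
  simp only [proj, Matrix.mul_diagonal] at h1
  have h3 : cls k = c := by by_contra h'; simp [h'] at h1
  have h1 := mem_digraphAlgebra.1 hM x k (left_ne_zero_of_mul h1)
  rw [mul_proj_mul_star_apply hX hM hM hc h3 (cls_le_cls.1 h1) (cls_le_cls.1 h2)] at hxy
  exact hc (h x y hxy)

/-- Dual form: two distinct classes have at most one common lower bound. -/
theorem star_mul_proj_mul_apply (hX : SquareFree (Reduced X)) {M N : Matrix X X ℂ}
    (hM : M ∈ digraphAlgebra X) (hN : N ∈ digraphAlgebra X) {c : Reduced X} {x y z : X}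
    (hxy : cls x ≠ cls y) (hz : cls z = c) (hxz : z ≤ x) (hyz : z ≤ y) :
    (star M * proj c * N) x y = (star M * N) x y := by
  rw [Matrix.mul_apply, Matrix.mul_apply]
  refine Finset.sum_congr rfl fun k _ => ?_
  simp only [proj, Matrix.mul_diagonal]
  by_cases hk : cls k = c
  · simp [hk]
  · have : (star M) x k * N k y = 0 := by
      by_contra h
      have h1 := mem_digraphAlgebra.1 hM k x
        (by simpa [Matrix.star_apply] using left_ne_zero_of_mul h)
      have h2 := mem_digraphAlgebra.1 hN k y (right_ne_zero_of_mul h)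
      rcases hX (cls k) (cls z) (cls x) (cls y) h1 h2 (cls_le_cls.2 hxz) (cls_le_cls.2 hyz)
        with h | h
      · exact hk (h.trans hz)
      · exact hxy h
    rw [this]; simp [hk]

theorem star_mul_proj_mul_mem (hX : SquareFree (Reduced X)) {M : Matrix X X ℂ}
    (hM : M ∈ digraphAlgebra X) (h : star M * M ∈ blockDiag X) (c : Reduced X) :
    star M * proj c * M ∈ blockDiag X := by
  intro x y hxy
  by_contra hc
  obtain ⟨k, -, hk⟩ := Finset.exists_ne_zero_of_sum_ne_zero
    (Matrix.mul_apply (M := star M * proj c) ▸ hxy)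
  have h2 := mem_digraphAlgebra.1 hM k y (right_ne_zero_of_mul hk)
  have h1 := left_ne_zero_of_mul hk
  simp only [proj, Matrix.mul_diagonal] at h1
  have h3 : cls k = c := by by_contra h'; simp [h'] at h1
  have h1 := mem_digraphAlgebra.1 hM k x
    (by simpa [Matrix.star_apply] using left_ne_zero_of_mul h1)
  rw [star_mul_proj_mul_apply hX hM hM hc h3 (cls_le_cls.1 h1) (cls_le_cls.1 h2)] at hxy
  exact hc (h x y hxy)

end Blocks

end CycleAlgebra

end

noncomputable section

set_option linter.unusedSectionVars false

namespace CycleAlgebra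

open scoped Matrix.Norms.L2Operator

/-! ## Normalising partial isometries of a digraph algebra -/

section Normalizing

variable {X : Type*} [Preorder X] [Fintype X] [DecidableEq X]

/-- A partial isometry of the digraph algebra whose initial and final projections belong to the
diagonal `A ∩ A*`. -/
structure IsNormalizing (w : Matrix X X ℂ) : Prop where
  mem : w ∈ digraphAlgebra X
  partialIsometry : w * star w * w = w
  star_mul_self : star w * w ∈ blockDiag X
  mul_star_self : w * star w ∈ blockDiag X

/-- Orthogonality of both initial and final spaces. -/
def Orthogonal {R : Type*} [Mul R] [Zero R] [Star R] (v w : R) : Prop :=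
  star v * w = 0 ∧ v * star w = 0

theorem Orthogonal.symm {R : Type*} [NonUnitalRing R] [StarRing R] {v w : R}
    (h : Orthogonal v w) : Orthogonal w v :=
  ⟨by simpa using congrArg star h.1, by simpa using congrArg star h.2⟩

theorem orthogonal_sum_left {R ι : Type*} [NonUnitalRing R] [StarRing R] {v : ι → R} {w : R}
    {s : Finset ι} (h : ∀ i ∈ s, Orthogonal (v i) w) : Orthogonal (∑ i ∈ s, v i) w := by
  constructor
  · rw [star_sum, Finset.sum_mul]
    exact Finset.sum_eq_zero fun i hi => (h i hi).1
  · rw [Finset.sum_mul]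
    exact Finset.sum_eq_zero fun i hi => (h i hi).2

theorem partialIsometry_add {R : Type*} [NonUnitalRing R] [StarRing R] {v w : R}
    (hv : v * star v * v = v) (hw : w * star w * w = w) (h : Orthogonal v w) :
    (v + w) * star (v + w) * (v + w) = v + w := by
  have h' := h.symm
  simp only [star_add, add_mul, mul_add, hv, hw, h.2, h'.2, mul_assoc, h.1, h'.1]
  simp

theorem isNormalizing_zero : IsNormalizing (0 : Matrix X X ℂ) :=
  ⟨(digraphAlgebra X).zero_mem, by simp, by simp, by simp⟩

theorem IsNormalizing.add {v w : Matrix X X ℂ} (hv : IsNormalizing v) (hw : IsNormalizing w)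
    (h : Orthogonal v w) : IsNormalizing (v + w) := by
  refine ⟨(digraphAlgebra X).add_mem hv.mem hw.mem,
    partialIsometry_add hv.partialIsometry hw.partialIsometry h, ?_, ?_⟩
  · rw [star_add, add_mul, mul_add, mul_add, h.1, h.symm.1]
    simpa using add_mem hv.star_mul_self hw.star_mul_self
  · rw [star_add, add_mul, mul_add, mul_add, h.2, h.symm.2]
    simpa using add_mem hv.mul_star_self hw.mul_star_self

theorem isNormalizing_sum {ι : Type*} {w : ι → Matrix X X ℂ} {s : Finset ι}
    (hw : ∀ i ∈ s, IsNormalizing (w i))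
    (ho : ∀ i ∈ s, ∀ j ∈ s, i ≠ j → Orthogonal (w i) (w j)) : IsNormalizing (∑ i ∈ s, w i) := by
  classical
  induction s using Finset.induction_on with
  | empty => simpa using isNormalizing_zero
  | insert a s ha ih =>
    rw [Finset.sum_insert ha]
    refine (hw a (by simp)).add (ih (fun i hi => hw i (by simp [hi]))
      (fun i hi j hj => ho i (by simp [hi]) j (by simp [hj]))) (Orthogonal.symm ?_)
    exact orthogonal_sum_left fun i hi => ho i (by simp [hi]) a (by simp)
      (fun h => ha (h ▸ hi))

theorem isNormalizing_of_mem_blockDiag {w : Matrix X X ℂ} (h : w ∈ blockDiag X)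
    (hw : w * star w * w = w) : IsNormalizing w :=
  ⟨blockDiag_le h, hw, mul_mem (star_mem h) h, mul_mem h (star_mem h)⟩

theorem single_mem_digraphAlgebra {x y : X} (h : cls x ≤ cls y) (c : ℂ) :
    Matrix.single x y c ∈ digraphAlgebra X := by
  refine mem_digraphAlgebra.2 fun a b hab => ?_
  rw [Matrix.single_apply] at hab
  by_cases h' : x = a ∧ y = b
  · rwa [← h'.1, ← h'.2]
  · simp [h'] at hab

theorem single_mem_blockDiag {x y : X} (h : cls x = cls y) (c : ℂ) :
    Matrix.single x y c ∈ blockDiag X := by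
  intro a b hab
  rw [Matrix.single_apply] at hab
  by_cases h' : x = a ∧ y = b
  · rwa [← h'.1, ← h'.2]
  · simp [h'] at hab

@[simp] theorem star_single (x y : X) (c : ℂ) :
    star (Matrix.single x y c) = Matrix.single y x (star c) := by
  rw [Matrix.star_eq_conjTranspose, Matrix.conjTranspose_single]

theorem isNormalizing_single {x y : X} (h : cls x ≤ cls y) :
    IsNormalizing (Matrix.single x y (1 : ℂ)) := by
  refine ⟨single_mem_digraphAlgebra h _, ?_, ?_, ?_⟩
  · simp
  · simpa using single_mem_blockDiag rfl _
  · simpa using single_mem_blockDiag rfl _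

variable {w : Matrix X X ℂ}

/-- Both `w * proj b * star w` and `star w * w` are block diagonal, so the projections can be moved
outwards until `w * star w * w = w` applies. In a square with lower vertices a, b and upper vertices
c, d this fails: `(e_ac + e_ad + e_bc - e_bd) / √2` is a normalising partial isometry, but its
blocks have norm `1 / √2`. -/
theorem IsNormalizing.blk (hX : SquareFree (Reduced X)) (hw : IsNormalizing w)
    (a b : Reduced X) : IsNormalizing (blk a b w) := by
  have e1 : star (CycleAlgebra.blk a b w) * CycleAlgebra.blk a b w
      = CycleAlgebra.blk b b (star w * proj a * w) := by
    rw [star_blk]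
    simp only [CycleAlgebra.blk]
    calc proj b * star w * proj a * (proj a * w * proj b)
        = proj b * star w * (proj a * proj a) * w * proj b := by noncomm_ring
      _ = _ := by rw [proj_mul_self]; noncomm_ring
  have e2 : CycleAlgebra.blk a b w * star (CycleAlgebra.blk a b w)
      = CycleAlgebra.blk a a (w * proj b * star w) := by
    rw [star_blk]
    simp only [CycleAlgebra.blk]
    calc proj a * w * proj b * (proj b * star w * proj a)
        = proj a * w * (proj b * proj b) * star w * proj a := by noncomm_ring
      _ = _ := by rw [proj_mul_self]; noncomm_ring
  refine ⟨blk_mem_digraphAlgebra hw.mem a b, ?_, ?_, ?_⟩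
  · rw [e2]
    simp only [CycleAlgebra.blk]
    have h1 := commute_proj (mul_proj_mul_star_mem hX hw.mem hw.mul_star_self b) a
    have h2 := commute_proj hw.star_mul_self b
    calc proj a * (w * proj b * star w) * proj a * (proj a * w * proj b)
        = proj a * (w * proj b * star w) * (proj a * proj a) * w * proj b := by noncomm_ring
      _ = proj a * ((w * proj b * star w) * proj a) * w * proj b := by
        rw [proj_mul_self]; noncomm_ring
      _ = (proj a * proj a) * w * (proj b * (star w * w)) * proj b := by
        rw [← h1]; noncomm_ring
      _ = proj a * (w * star w * w) * (proj b * proj b) := by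
        rw [h2, proj_mul_self]; noncomm_ring
      _ = _ := by rw [hw.partialIsometry, proj_mul_self]
  · rw [e1]; exact blk_diag_mem _ _
  · rw [e2]; exact blk_diag_mem _ _

/-- For initial or final spaces cut out by the same `proj`, the compressed product is block diagonal
and vanishes between distinct classes. In the other cases two orthogonal `proj` meet. -/
theorem IsNormalizing.orthogonal_blk (hX : SquareFree (Reduced X)) (hw : IsNormalizing w)
    {p q : Reduced X × Reduced X} (hpq : p ≠ q) :
    Orthogonal (CycleAlgebra.blk p.1 p.2 w) (CycleAlgebra.blk q.1 q.2 w) := by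
  obtain ⟨a, b⟩ := p
  obtain ⟨c, d⟩ := q
  constructor
  · rw [star_blk]
    simp only [CycleAlgebra.blk]
    by_cases h : a = c
    · subst h
      have hbd : b ≠ d := fun h => hpq (by rw [h])
      calc proj b * star w * proj a * (proj a * w * proj d)
          = proj b * (star w * (proj a * proj a) * w) * proj d := by noncomm_ring
        _ = 0 := by
          rw [proj_mul_self]
          exact proj_mul_mul_proj (star_mul_proj_mul_mem hX hw.mem hw.star_mul_self a) hbd
    · calc proj b * star w * proj a * (proj c * w * proj d)
          = proj b * star w * (proj a * proj c) * w * proj d := by noncomm_ring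
        _ = 0 := by rw [proj_mul_proj h]; simp
  · rw [star_blk]
    simp only [CycleAlgebra.blk]
    by_cases h : b = d
    · subst h
      have hac : a ≠ c := fun h => hpq (by rw [h])
      calc proj a * w * proj b * (proj b * star w * proj c)
          = proj a * (w * (proj b * proj b) * star w) * proj c := by noncomm_ring
        _ = 0 := by
          rw [proj_mul_self]
          exact proj_mul_mul_proj (mul_proj_mul_star_mem hX hw.mem hw.mul_star_self b) hac
    · calc proj a * w * proj b * (proj d * star w * proj c)
          = proj a * w * (proj b * proj d) * star w * proj c := by noncomm_ring
        _ = 0 := by rw [proj_mul_proj h]; simp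

/-- The `1`-chain of a normalising partial isometry: the ranks of its strictly upper blocks. -/
def chain (w : Matrix X X ℂ) : Simplex1 (Reduced X) →₀ ℤ :=
  Finsupp.equivFunOnFinite.symm fun e => ((blk e.1.1 e.1.2 w).rank : ℤ)

@[simp] theorem chain_apply (w : Matrix X X ℂ) (e : Simplex1 (Reduced X)) :
    chain w e = ((blk e.1.1 e.1.2 w).rank : ℤ) := rfl

/-- The initial and final projections of `v` are block diagonal, so a `proj` between the two factors
can be moved past them, which exposes `star v * w` or `v * star w`. -/
theorem blk_orthogonal_of_orthogonal {v w : Matrix X X ℂ} (hv : IsNormalizing v)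
    (hw : IsNormalizing w) (h : Orthogonal v w) (a b : Reduced X) :
    Orthogonal (blk a b v) (blk a b w) := by
  have h1 : star v * proj a * w = 0 := by
    calc star v * proj a * w
        = (star v * v * star v) * proj a * (w * star w * w) := by
          rw [star_mul_star_mul hv.partialIsometry, hw.partialIsometry]
      _ = star v * ((v * star v) * proj a) * (w * star w * w) := by noncomm_ring
      _ = star v * proj a * v * (star v * w) * star w * w := by
          rw [← commute_proj hv.mul_star_self]; noncomm_ring
      _ = 0 := by rw [h.1]; simp
  have h2 : v * proj b * star w = 0 := by
    calc v * proj b * star w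
        = (v * star v * v) * proj b * (star w * w * star w) := by
          rw [star_mul_star_mul hw.partialIsometry, hv.partialIsometry]
      _ = v * ((star v * v) * proj b) * (star w * w * star w) := by noncomm_ring
      _ = v * proj b * star v * (v * star w) * w * star w := by
          rw [← commute_proj hv.star_mul_self]; noncomm_ring
      _ = 0 := by rw [h.2]; simp
  constructor
  · rw [star_blk]
    calc proj b * star v * proj a * (proj a * w * proj b)
        = proj b * (star v * (proj a * proj a) * w) * proj b := by noncomm_ring
      _ = 0 := by rw [proj_mul_self, h1]; simp
  · rw [star_blk]
    calc proj a * v * proj b * (proj b * star w * proj a)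
        = proj a * (v * (proj b * proj b) * star w) * proj a := by noncomm_ring
      _ = 0 := by rw [proj_mul_self, h2]; simp

theorem chain_add (hX : SquareFree (Reduced X)) {v w : Matrix X X ℂ} (hv : IsNormalizing v)
    (hw : IsNormalizing w) (h : Orthogonal v w) : chain (v + w) = chain v + chain w := by
  ext e
  have h' := blk_orthogonal_of_orthogonal hv hw h e.1.1 e.1.2
  rw [Finsupp.add_apply, chain_apply, chain_apply, chain_apply, blk_add,
    rank_add_of_orthogonal (hv.blk hX _ _).partialIsometry (hw.blk hX _ _).partialIsometry
      h'.1 h'.2, Nat.cast_add]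

theorem chain_eq_zero_of_mem_blockDiag {w : Matrix X X ℂ} (h : w ∈ blockDiag X) :
    chain w = 0 := by
  ext e
  have : blk e.1.1 e.1.2 w = 0 := proj_mul_mul_proj h e.2.ne
  simp [this]

theorem rank_blk_le {u v z : Matrix X X ℂ} (hu : u ∈ blockDiag X) (hz : z ∈ blockDiag X)
    (a b : Reduced X) : (blk a b (u * v * z)).rank ≤ (blk a b v).rank := by
  have : blk a b (u * v * z) = u * blk a b v * z := by
    simp only [blk]
    calc proj a * (u * v * z) * proj b = (proj a * u) * v * (z * proj b) := by noncomm_ring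
      _ = _ := by rw [commute_proj hu, ← commute_proj hz]; noncomm_ring
  rw [this]
  exact (Matrix.rank_mul_le_left _ _).trans (Matrix.rank_mul_le_right _ _)

/-- Equivalence of matrices by elements of the diagonal. -/
def DiagEquiv (v v' : Matrix X X ℂ) : Prop :=
  ∃ u ∈ blockDiag X, ∃ z ∈ blockDiag X, v' = u * v * z ∧ v = star u * v' * star z

theorem DiagEquiv.rank_eq {v v' : Matrix X X ℂ} (h : DiagEquiv v v') : v'.rank = v.rank := by
  obtain ⟨u, -, z, -, h1, h2⟩ := h
  apply le_antisymm
  · conv_lhs => rw [h1]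
    exact (Matrix.rank_mul_le_left _ _).trans (Matrix.rank_mul_le_right _ _)
  · conv_lhs => rw [h2]
    exact (Matrix.rank_mul_le_left _ _).trans (Matrix.rank_mul_le_right _ _)

theorem chain_eq_of_diagEquiv {v v' : Matrix X X ℂ} (h : DiagEquiv v v') : chain v' = chain v := by
  obtain ⟨u, hu, z, hz, h1, h2⟩ := h
  ext e
  rw [chain_apply, chain_apply, Nat.cast_inj]
  apply le_antisymm
  · conv_lhs => rw [h1]
    exact rank_blk_le hu hz _ _
  · conv_lhs => rw [h2]
    exact rank_blk_le (star_mem hu) (star_mem hz) _ _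

/-- Compression to a block does not increase norms, and the rank of a partial isometry is
semicontinuous from both sides. This rigidity is what lets chains survive the passage to a norm
limit. -/
theorem chain_eq_of_norm_sub_lt_one (hX : SquareFree (Reduced X)) {v w : Matrix X X ℂ}
    (hv : IsNormalizing v) (hw : IsNormalizing w) (h : ‖v - w‖ < 1) : chain v = chain w := by
  ext e
  rw [chain_apply, chain_apply, Nat.cast_inj]
  apply le_antisymm
  · refine rank_le_of_norm_sub_lt_one (hv.blk hX _ _).partialIsometry ?_
    rw [← blk_sub]
    exact (norm_blk_le _ _ _).trans_lt h
  · refine rank_le_of_norm_sub_lt_one (hw.blk hX _ _).partialIsometry ?_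
    rw [← blk_sub]
    exact (norm_blk_le _ _ _).trans_lt (by rwa [norm_sub_rev])

/-- A matrix unit in the block of the edge `e`. -/
def edgeUnit (e : Simplex1 (Reduced X)) : Matrix X X ℂ :=
  Matrix.single (rep e.1.1) (rep e.1.2) 1

theorem isNormalizing_edgeUnit (e : Simplex1 (Reduced X)) :
    IsNormalizing (edgeUnit e) :=
  isNormalizing_single (by simpa using e.2.le)

/-- A rank one partial isometry in the block of `(a, b)` splits off from a nonzero normalising
partial isometry there, and it is equivalent to each matrix unit of the block. -/
theorem exists_rank_one_summand {v : Matrix X X ℂ} {a b : Reduced X} (hv : IsNormalizing v)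
    (hab : blk a b v = v) (h0 : v ≠ 0) {x y : X} (hx : cls x = a) (hy : cls y = b) :
    ∃ v₁, DiagEquiv (Matrix.single x y 1) v₁ ∧ IsNormalizing v₁ ∧ blk a b v₁ = v₁ ∧
      IsNormalizing (v - v₁) ∧ blk a b (v - v₁) = v - v₁ ∧ Orthogonal v₁ (v - v₁) := by
  obtain ⟨x₀, y₀, hxy⟩ : ∃ x₀ y₀, v x₀ y₀ ≠ 0 := by
    by_contra! hc
    exact h0 (by ext i j; exact hc i j)
  have hva : proj a * v = v := by
    conv_lhs => rw [← hab]
    conv_rhs => rw [← hab]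
    simp only [blk]
    rw [← mul_assoc, ← mul_assoc, proj_mul_self]
  have hvb : v * proj b = v := by
    conv_lhs => rw [← hab]
    conv_rhs => rw [← hab]
    simp only [blk]
    rw [mul_assoc, proj_mul_self]
  have hxa : cls x₀ = a := by
    have := hxy
    rw [← hab, blk_apply] at this
    by_contra hc
    simp [hc] at this
  have hyb : cls y₀ = b := by
    have := hxy
    rw [← hab, blk_apply] at this
    by_contra hc
    simp [hc] at this
  set h := star v * v with hh
  set E : Matrix X X ℂ := Matrix.single y₀ y₀ 1 with hE
  set c : ℂ := h y₀ y₀ with hc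
  have hsh : star h = h := by simp [hh]
  have hsc : star c = c := by
    conv_rhs => rw [hc, ← hsh]
    rw [Matrix.star_apply]
  have hc0 : c ≠ 0 := by
    -- The diagonal entry of `star v * v` is the squared length of column `y₀` of `v`, which is
    -- positive because of the entry at `x₀`.
    have e : c = ((∑ i, Complex.normSq (v i y₀) : ℝ) : ℂ) := by
      rw [hc, hh, Matrix.mul_apply]
      push_cast
      refine Finset.sum_congr rfl fun i _ => ?_
      rw [Complex.normSq_eq_conj_mul_self]
      rfl
    rw [e]
    refine Complex.ofReal_ne_zero.2 (ne_of_gt ?_)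
    refine Finset.sum_pos' (fun i _ => Complex.normSq_nonneg _) ⟨x₀, Finset.mem_univ _, ?_⟩
    exact Complex.normSq_pos.2 hxy
  have hEBD : E ∈ blockDiag X := single_mem_blockDiag rfl _
  have hsE : star E = E := by simp [hE]
  have hEhE : E * h * E = c • E := by
    rw [hE, Matrix.single_mul_mul_single, Matrix.smul_single]; simp [hc]
  have hhh : h * h = h := by rw [hh, mul_assoc, ← mul_assoc v, hv.partialIsometry]
  have hvh : v * h = v := by rw [hh, ← mul_assoc, hv.partialIsometry]
  have hhv : h * star v = star v := star_mul_star_mul hv.partialIsometry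
  -- The vector `h e_{y₀}` has squared length `c`, so `c⁻¹ • (h * E * h)` is the projection onto its
  -- line; `v₁` is the restriction of `v` to that line, simplified by `v * h = v`.
  set v₁ : Matrix X X ℂ := c⁻¹ • (v * E * h) with hv₁
  have hsv₁ : star v₁ = c⁻¹ • (h * E * star v) := by
    rw [hv₁, star_smul, star_inv₀, hsc]
    simp [hsE, hsh, mul_assoc]
  have f1 : v₁ * star v₁ = c⁻¹ • (v * E * star v) := by
    rw [hsv₁, hv₁, smul_mul_smul_comm]
    have : v * E * h * (h * E * star v) = c • (v * E * star v) := by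
      calc _ = v * (E * (h * h) * E) * star v := by noncomm_ring
        _ = _ := by rw [hhh, hEhE]; simp
    rw [this, smul_smul, mul_assoc, inv_mul_cancel₀ hc0, mul_one]
  have f2 : star v₁ * v₁ = c⁻¹ • (h * E * h) := by
    rw [hsv₁, hv₁, smul_mul_smul_comm]
    have : h * E * star v * (v * E * h) = c • (h * E * h) := by
      calc _ = h * (E * (star v * v) * E) * h := by noncomm_ring
        _ = _ := by rw [← hh, hEhE]; simp
    rw [this, smul_smul, mul_assoc, inv_mul_cancel₀ hc0, mul_one]
  have f3 : star v₁ * v = star v₁ * v₁ := by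
    rw [f2, hsv₁, smul_mul_assoc, mul_assoc (h * E), ← hh]
  have f4 : v₁ * star v = v₁ * star v₁ := by
    rw [f1, hv₁, smul_mul_assoc, mul_assoc (v * E), hhv]
  have f3' : star v * v₁ = star v₁ * v₁ := by simpa using congrArg star f3
  have f4' : v * star v₁ = v₁ * star v₁ := by simpa using congrArg star f4
  have f5 : v₁ * star v₁ * v₁ = v₁ := by
    rw [f1, hv₁, smul_mul_smul_comm]
    have : v * E * star v * (v * E * h) = c • (v * E * h) := by
      calc _ = v * (E * (star v * v) * E) * h := by noncomm_ring
        _ = _ := by rw [← hh, hEhE]; simp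
    rw [this, smul_smul, mul_assoc, inv_mul_cancel₀ hc0, mul_one]
  have hva₁ : proj a * v₁ = v₁ := by
    rw [hv₁, mul_smul_comm, mul_assoc v, ← mul_assoc, hva]
  have hvb₁ : v₁ * proj b = v₁ := by
    rw [hv₁, smul_mul_assoc, mul_assoc (v * E), hh, mul_assoc (star v), hvb]
  have hn₁ : IsNormalizing v₁ := by
    refine ⟨?_, f5, ?_, ?_⟩
    · rw [hv₁]
      exact (digraphAlgebra X).smul_mem c⁻¹ ((digraphAlgebra X).mul_mem
        ((digraphAlgebra X).mul_mem hv.mem (blockDiag_le hEBD)) (blockDiag_le hv.star_mul_self))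
    · rw [f2]
      exact SMulMemClass.smul_mem _ (mul_mem (mul_mem hv.star_mul_self hEBD) hv.star_mul_self)
    · have : v₁ * star v₁ = blk a a (v₁ * star v₁) := by
        have h2 : star v₁ * proj a = star v₁ := by simpa using congrArg star hva₁
        rw [blk, ← mul_assoc, hva₁, mul_assoc, h2]
      rw [this]
      exact blk_diag_mem _ _
  refine ⟨v₁, ⟨c⁻¹ • (v * Matrix.single y₀ x 1), ?_, Matrix.single y y₀ 1 * h, ?_, ?_, ?_⟩,
    hn₁, ?_, ⟨?_, ?_, ?_, ?_⟩, ?_, ?_⟩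
  · refine SMulMemClass.smul_mem _ fun i j hij => ?_
    obtain ⟨k, -, hk⟩ := Finset.exists_ne_zero_of_sum_ne_zero (Matrix.mul_apply (M := v) ▸ hij)
    have h1 := left_ne_zero_of_mul hk
    have h2 := right_ne_zero_of_mul hk
    rw [← hab, blk_apply] at h1
    rw [Matrix.single_apply] at h2
    have h3 : cls i = a := by by_contra h'; simp [h'] at h1
    have h4 : x = j := by by_contra h'; simp [h'] at h2
    rw [h3, ← h4, hx]
  · exact mul_mem (single_mem_blockDiag (hy.trans hyb.symm) _) hv.star_mul_self
  · rw [hv₁, smul_mul_assoc, smul_mul_assoc]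
    congr 1
    calc v * E * h = v * (Matrix.single y₀ x 1 * Matrix.single x y 1 * Matrix.single y y₀ 1) * h := by
          simp [hE]
      _ = _ := by noncomm_ring
  · have e1 : star (Matrix.single y y₀ (1 : ℂ) * h) = h * Matrix.single y₀ y 1 := by
      rw [star_mul, hsh, star_single, star_one]
    have e2 : star (c⁻¹ • (v * Matrix.single y₀ x (1 : ℂ)))
        = c⁻¹ • (Matrix.single x y₀ 1 * star v) := by
      rw [star_smul, star_inv₀, hsc, star_mul, star_single, star_one]
    rw [e1, e2, hv₁, smul_mul_smul_comm, smul_mul_assoc]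
    have : Matrix.single x y₀ 1 * star v * (v * E * h) * (h * Matrix.single y₀ y 1)
        = (c * c) • Matrix.single x y (1 : ℂ) := by
      calc _ = Matrix.single x y₀ 1 * (star v * v) * E * ((h * h) * Matrix.single y₀ y 1) := by
            noncomm_ring
        _ = (Matrix.single x y₀ 1 * h * Matrix.single y₀ y₀ 1)
            * (Matrix.single y₀ y₀ 1 * h * Matrix.single y₀ y 1) := by
          have : E = Matrix.single y₀ y₀ 1 * Matrix.single y₀ y₀ 1 := by simp [hE]
          rw [hhh, ← hh, this]
          noncomm_ring
        _ = _ := by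
          rw [Matrix.single_mul_mul_single, Matrix.single_mul_mul_single, Matrix.smul_single]
          simp [hc]
    -- The two factors `c⁻¹`, from `u` and from `v₁`, cancel the `c * c` produced by the two corner
    -- compressions of `h`.
    rw [this, smul_smul, mul_mul_mul_comm, inv_mul_cancel₀ hc0, one_mul, one_smul]
  · rw [blk, hva₁, hvb₁]
  · exact (digraphAlgebra X).sub_mem hv.mem hn₁.mem
  · have e1 : v * star v * v₁ = v₁ := by rw [mul_assoc, f3', ← mul_assoc, f4', f5]
    have e2 : v₁ * star v₁ * v = v₁ := by rw [mul_assoc, f3, ← mul_assoc, f5]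
    have e3 : (v - v₁) * star (v - v₁) = v * star v - v₁ * star v₁ := by
      rw [star_sub, sub_mul, mul_sub, mul_sub, f4, f4', sub_self, sub_zero]
    rw [e3, mul_sub, sub_mul, sub_mul, hv.partialIsometry, e1, e2, f5, sub_self, sub_zero]
  · rw [star_sub, sub_mul, mul_sub, mul_sub, f3, f3', sub_self, sub_zero]
    exact sub_mem hv.star_mul_self hn₁.star_mul_self
  · rw [star_sub, sub_mul, mul_sub, mul_sub, f4, f4', sub_self, sub_zero]
    exact sub_mem hv.mul_star_self hn₁.mul_star_self
  · rw [blk_sub, hab]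
    congr 1
    rw [blk, hva₁, hvb₁]
  · exact ⟨by rw [mul_sub, f3, sub_self], by rw [star_sub, mul_sub, f4, sub_self]⟩

theorem rank_single (x y : X) : (Matrix.single x y (1 : ℂ)).rank = 1 := by
  have : ((Matrix.single x y (1 : ℂ)).rank : ℂ) = 1 := by
    rw [rank_eq_trace (by simp)]
    simp
  exact_mod_cast this

/-- A function on matrices that behaves on normalising partial isometries like an additive
invariant of their classes modulo the diagonal. -/
structure IsInvariant {G : Type*} [AddCommGroup G] (χ : Matrix X X ℂ → G) : Prop where
  add : ∀ v w, IsNormalizing v → IsNormalizing w → Orthogonal v w → χ (v + w) = χ v + χ w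
  diagEquiv : ∀ v w, IsNormalizing v → IsNormalizing w → DiagEquiv v w → χ w = χ v
  diag : ∀ v, v ∈ blockDiag X → IsNormalizing v → χ v = 0

variable {G : Type*} [AddCommGroup G] {χ : Matrix X X ℂ → G}

theorem IsInvariant.sum (hχ : IsInvariant χ) {ι : Type*} {w : ι → Matrix X X ℂ} {s : Finset ι}
    (hw : ∀ i ∈ s, IsNormalizing (w i))
    (ho : ∀ i ∈ s, ∀ j ∈ s, i ≠ j → Orthogonal (w i) (w j)) :
    χ (∑ i ∈ s, w i) = ∑ i ∈ s, χ (w i) := by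
  classical
  induction s using Finset.induction_on with
  | empty => simpa using hχ.diag 0 (zero_mem _) isNormalizing_zero
  | insert a s ha ih =>
    have hw' : ∀ i ∈ s, IsNormalizing (w i) := fun i hi => hw i (by simp [hi])
    have ho' : ∀ i ∈ s, ∀ j ∈ s, i ≠ j → Orthogonal (w i) (w j) :=
      fun i hi j hj => ho i (by simp [hi]) j (by simp [hj])
    rw [Finset.sum_insert ha, Finset.sum_insert ha, ← ih hw' ho']
    refine hχ.add _ _ (hw a (by simp)) (isNormalizing_sum hw' ho') (Orthogonal.symm ?_)
    exact orthogonal_sum_left fun i hi => ho i (by simp [hi]) a (by simp) (fun h => ha (h ▸ hi))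

/-- Induction on the rank: rank one summands split off orthogonally, and each of them is diagonally
equivalent to the given matrix unit. -/
theorem IsInvariant.apply_of_blk (hχ : IsInvariant χ) {a b : Reduced X} {x y : X}
    (hx : cls x = a) (hy : cls y = b) (hab : a ≤ b) (n : ℕ) {v : Matrix X X ℂ}
    (hv : IsNormalizing v) (hvb : blk a b v = v) (hn : v.rank = n) :
    χ v = (n : ℤ) • χ (Matrix.single x y 1) := by
  induction n using Nat.strong_induction_on generalizing v with
  | _ n ih =>
    by_cases h0 : v = 0
    · subst h0
      have : n = 0 := by rw [← hn]; simp
      rw [this, hχ.diag 0 (zero_mem _) isNormalizing_zero]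
      simp
    · obtain ⟨v₁, heq, hn₁, hb₁, hn₂, hb₂, ho⟩ := exists_rank_one_summand hv hvb h0 hx hy
      have hr₁ : v₁.rank = 1 := by rw [heq.rank_eq, rank_single]
      have hsum : v₁ + (v - v₁) = v := by abel
      have hr := rank_add_of_orthogonal hn₁.partialIsometry hn₂.partialIsometry ho.1 ho.2
      rw [hsum, hr₁, hn] at hr
      have h2 := ih (v - v₁).rank (by omega) hn₂ hb₂ rfl
      have h1 : χ v₁ = χ (Matrix.single x y 1) :=
        hχ.diagEquiv _ _ (isNormalizing_single (by rw [hx, hy]; exact hab)) hn₁ heq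
      conv_lhs => rw [← hsum, hχ.add _ _ hn₁ hn₂ ho, h1, h2]
      rw [hr]
      push_cast
      rw [add_smul, one_smul]

theorem blk_blk (a b : Reduced X) (M : Matrix X X ℂ) : blk a b (blk a b M) = blk a b M := by
  calc _ = (proj a * proj a) * M * (proj b * proj b) := by simp only [blk]; noncomm_ring
    _ = _ := by rw [proj_mul_self, proj_mul_self, blk]

/-- An invariant is determined by its values on the matrix units of the edges. -/
theorem IsInvariant.apply_eq (hX : SquareFree (Reduced X)) (hχ : IsInvariant χ)
    {w : Matrix X X ℂ} (hw : IsNormalizing w) :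
    χ w = Finsupp.linearCombination ℤ (fun e => χ (edgeUnit e)) (chain w) := by
  classical
  have h1 : χ w = ∑ p : Reduced X × Reduced X, χ (blk p.1 p.2 w) := by
    conv_lhs => rw [← sum_blk w]
    exact hχ.sum (fun p _ => hw.blk hX _ _) fun p _ q _ hpq => hw.orthogonal_blk hX hpq
  have h2 : Finsupp.linearCombination ℤ (fun e => χ (edgeUnit e)) (chain w)
      = ∑ e : Simplex1 (Reduced X), χ (blk e.1.1 e.1.2 w) := by
    have : Fintype (Simplex1 (Reduced X)) := Fintype.ofFinite _
    rw [Finsupp.linearCombination_apply, Finsupp.sum_fintype _ _ (by simp)]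
    refine (Finset.sum_congr ?_ fun e _ => ?_)
    · ext; simp
    · exact (hχ.apply_of_blk (cls_rep _) (cls_rep _) e.2.le _ (hw.blk hX _ _) (blk_blk _ _ _)
        rfl).symm
  rw [h1, h2]
  symm
  -- Only pairs `a < b` contribute: diagonal blocks are killed by `hχ.diag`, and blocks with `¬ a ≤
  -- b` are zero in the digraph algebra.
  refine Finset.sum_bij_ne_zero (fun e _ _ => e.1) (by simp)
    (fun e _ _ e' _ _ h => Subtype.ext h) ?_ (fun _ _ _ => rfl)
  rintro ⟨a, b⟩ - hne
  by_cases hab : a < b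
  · exact ⟨⟨(a, b), hab⟩, Finset.mem_univ _, hne, rfl⟩
  · exfalso
    apply hne
    by_cases h : a = b
    · subst h
      exact hχ.diag _ (blk_diag_mem _ _) (hw.blk hX _ _)
    · have : blk a b w = 0 := blk_eq_zero_of_not_le hw.mem fun h' => hab (lt_of_le_of_ne h' h)
      simp only [this]
      exact hχ.diag 0 (zero_mem _) isNormalizing_zero

theorem isInvariant_chain (hX : SquareFree (Reduced X)) :
    IsInvariant (chain : Matrix X X ℂ → _) :=
  ⟨fun _ _ hv hw h => chain_add hX hv hw h, fun _ _ _ _ h => chain_eq_of_diagEquiv h,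
    fun _ h _ => chain_eq_zero_of_mem_blockDiag h⟩

end Normalizing

end CycleAlgebra

end

noncomputable section

set_option linter.unusedSectionVars false

namespace CycleAlgebra

open scoped Matrix.Norms.L2Operator

/-! ### Boundaries of chains and ranks of initial and final projections -/

section Boundary

variable {X : Type*} [Preorder X] [Fintype X] [DecidableEq X]

/-- The `0`-chain of a diagonal projection: the ranks of its blocks. -/
def chain0 (p : Matrix X X ℂ) : Reduced X →₀ ℤ :=
  Finsupp.equivFunOnFinite.symm fun a => ((blk a a p).rank : ℤ)

@[simp] theorem chain0_apply (p : Matrix X X ℂ) (a : Reduced X) :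
    chain0 p a = ((blk a a p).rank : ℤ) := rfl

theorem chain0_eq_of_norm_sub_lt_one {p q : Matrix X X ℂ} (hX : SquareFree (Reduced X))
    (hp : IsNormalizing p) (hq : IsNormalizing q) (h : ‖p - q‖ < 1) : chain0 p = chain0 q := by
  ext a
  rw [chain0_apply, chain0_apply, Nat.cast_inj]
  apply le_antisymm
  · refine rank_le_of_norm_sub_lt_one (hp.blk hX _ _).partialIsometry ?_
    rw [← blk_sub]
    exact (norm_blk_le _ _ _).trans_lt h
  · refine rank_le_of_norm_sub_lt_one (hq.blk hX _ _).partialIsometry ?_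
    rw [← blk_sub]
    exact (norm_blk_le _ _ _).trans_lt (by rwa [norm_sub_rev])

theorem IsNormalizing.isNormalizing_star_mul_self {w : Matrix X X ℂ} (hw : IsNormalizing w) :
    IsNormalizing (star w * w) := by
  refine isNormalizing_of_mem_blockDiag hw.star_mul_self ?_
  have : (star w * w) * (star w * w) = star w * w := by
    rw [mul_assoc, ← mul_assoc w, hw.partialIsometry]
  rw [star_mul, star_star, this, this]

theorem IsNormalizing.isNormalizing_mul_star_self {w : Matrix X X ℂ} (hw : IsNormalizing w) :
    IsNormalizing (w * star w) := by
  refine isNormalizing_of_mem_blockDiag hw.mul_star_self ?_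
  have : (w * star w) * (w * star w) = w * star w := by
    rw [← mul_assoc, hw.partialIsometry]
  rw [star_mul, star_star, this, this]

theorem rank_blk_eq_trace {p : Matrix X X ℂ} (hp : p ∈ blockDiag X) (hpp : p * p = p)
    (a : Reduced X) : ((blk a a p).rank : ℂ) = (proj a * p).trace := by
  have e : blk a a p = proj a * p := by
    rw [blk, mul_assoc, ← commute_proj hp, ← mul_assoc, proj_mul_self]
  rw [rank_eq_trace_of_isIdempotentElem, e]
  rw [e]
  calc proj a * p * (proj a * p) = proj a * (p * proj a) * p := by noncomm_ring
    _ = (proj a * proj a) * (p * p) := by rw [← commute_proj hp]; noncomm_ring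
    _ = _ := by rw [proj_mul_self, hpp]

/-- The right-hand side is linear in `proj a` and in `proj b`, so sums of block ranks over a row or
a column collapse by `sum_proj`. -/
theorem rank_blk_eq_trace' (hX : SquareFree (Reduced X)) {w : Matrix X X ℂ} (hw : IsNormalizing w)
    (a b : Reduced X) : ((blk a b w).rank : ℂ) = (proj b * star w * proj a * w).trace := by
  rw [rank_eq_trace (hw.blk hX a b).partialIsometry, star_blk]
  simp only [blk]
  have : proj b * star w * proj a * (proj a * w * proj b)
      = (proj b * star w * proj a * w) * proj b := by
    calc _ = proj b * star w * (proj a * proj a) * w * proj b := by noncomm_ring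
      _ = _ := by rw [proj_mul_self]
  rw [this, Matrix.trace_mul_comm]
  congr 1
  simp only [← mul_assoc, proj_mul_self]

theorem rank_blk_star_mul_self (hX : SquareFree (Reduced X)) {w : Matrix X X ℂ}
    (hw : IsNormalizing w) (b : Reduced X) :
    (blk b b (star w * w)).rank = ∑ a, (blk a b w).rank := by
  have : ((blk b b (star w * w)).rank : ℂ) = ((∑ a, (blk a b w).rank : ℕ) : ℂ) := by
    rw [rank_blk_eq_trace hw.star_mul_self
      (by rw [mul_assoc, ← mul_assoc w, hw.partialIsometry])]
    push_cast
    simp only [rank_blk_eq_trace' hX hw]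
    rw [← Matrix.trace_sum]
    congr 1
    rw [← Finset.sum_mul, ← Finset.mul_sum, sum_proj, mul_one, mul_assoc]
  exact_mod_cast this

theorem rank_blk_mul_star_self (hX : SquareFree (Reduced X)) {w : Matrix X X ℂ}
    (hw : IsNormalizing w) (a : Reduced X) :
    (blk a a (w * star w)).rank = ∑ b, (blk a b w).rank := by
  have : ((blk a a (w * star w)).rank : ℂ) = ((∑ b, (blk a b w).rank : ℕ) : ℂ) := by
    rw [rank_blk_eq_trace hw.mul_star_self (by rw [← mul_assoc, hw.partialIsometry])]
    push_cast
    simp only [rank_blk_eq_trace' hX hw]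
    rw [← Matrix.trace_sum]
    simp only [mul_assoc]
    rw [← Finset.sum_mul, sum_proj, one_mul, Matrix.trace_mul_comm (star w), mul_assoc]
  exact_mod_cast this

/-- The edge `(a, b)` contributes its block rank at `b` and subtracts it at `a`. Column sums of
block ranks are the block ranks of the initial projection, and row sums those of the final
projection. -/
theorem boundary1_chain (hX : SquareFree (Reduced X)) {w : Matrix X X ℂ} (hw : IsNormalizing w) :
    boundary1 (Reduced X) (chain w) = chain0 (star w * w) - chain0 (w * star w) := by
  classical
  have : Fintype (Simplex1 (Reduced X)) := Fintype.ofFinite _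
  set F : Reduced X × Reduced X → (Reduced X →₀ ℤ) := fun p =>
    ((blk p.1 p.2 w).rank : ℤ) • (Finsupp.single p.2 1 - Finsupp.single p.1 1) with hF
  have h1 : boundary1 (Reduced X) (chain w) = ∑ e : Simplex1 (Reduced X), F e.1 := by
    rw [boundary1, Finsupp.linearCombination_apply, Finsupp.sum_fintype _ _ (by simp)]
    rfl
  -- The sum may run over all pairs: the two terms of a diagonal pair cancel, and blocks off the
  -- order vanish.
  have h2 : ∑ e : Simplex1 (Reduced X), F e.1 = ∑ p, F p := by
    refine Finset.sum_bij_ne_zero (fun e _ _ => e.1) (by simp)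
      (fun e _ _ e' _ _ h => Subtype.ext h) ?_ (fun _ _ _ => rfl)
    rintro ⟨a, b⟩ - hne
    by_cases hab : a < b
    · exact ⟨⟨(a, b), hab⟩, Finset.mem_univ _, hne, rfl⟩
    · exfalso
      apply hne
      by_cases h : a = b
      · simp [hF, h]
      · have : blk a b w = 0 := blk_eq_zero_of_not_le hw.mem fun h' => hab (lt_of_le_of_ne h' h)
        simp [hF, this]
  rw [h1, h2]
  ext c
  rw [Finsupp.sub_apply, chain0_apply, chain0_apply, rank_blk_star_mul_self hX hw,
    rank_blk_mul_star_self hX hw, Finsupp.finsetSum_apply, Fintype.sum_prod_type]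
  simp only [hF, Finsupp.smul_apply, Finsupp.sub_apply, smul_eq_mul, mul_sub,
    Finset.sum_sub_distrib, Finsupp.single_apply, mul_ite, mul_one, mul_zero]
  push_cast
  congr 1
  · refine Finset.sum_congr rfl fun a _ => ?_
    rw [Finset.sum_eq_single c] <;> simp +contextual
  · rw [Finset.sum_comm]
    refine Finset.sum_congr rfl fun a _ => ?_
    rw [Finset.sum_eq_single c] <;> simp +contextual

end Boundary

/-! ## Star-extendible homomorphisms of digraph algebras -/

section StarExtendible

variable {E : Type*} [NonUnitalRing E] [StarRing E] [Module ℂ E] [IsScalarTower ℂ E E]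
  [SMulCommClass ℂ E E] [StarModule ℂ E] [TopologicalSpace E] [IsTopologicalRing E]
  [ContinuousStar E] [ContinuousConstSMul ℂ E]
variable {F : Type*} [NonUnitalRing F] [StarRing F] [Module ℂ F] [IsScalarTower ℂ F F]
  [SMulCommClass ℂ F F] [StarModule ℂ F] [TopologicalSpace F] [IsTopologicalRing F]
  [ContinuousStar F] [ContinuousConstSMul ℂ F]
variable {A : NonUnitalSubalgebra ℂ E} {A' : NonUnitalSubalgebra ℂ F} {φ : A →ₙₐ[ℂ] A'}

/-- The adjoint of an element of `A` need not lie in `A`, but a relation with adjoints whose value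
lies in `A` can be read in `C*(A)` and is preserved by the extension. The next lemmas are variants.
-/
theorem IsStarExtendible.star_mul (hφ : IsStarExtendible φ) {a b c : A}
    (h : star (a : E) * b = c) : star (φ a : F) * φ b = φ c := by
  obtain ⟨Φ, hΦ⟩ := hφ
  rw [← hΦ, ← hΦ, ← hΦ]
  have : (⟨c, mem_generatedCStar A c⟩ : generatedCStar A)
      = star ⟨a, mem_generatedCStar A a⟩ * ⟨b, mem_generatedCStar A b⟩ := Subtype.ext h.symm
  rw [this, map_mul, map_star]
  rfl

theorem IsStarExtendible.mul_star (hφ : IsStarExtendible φ) {a b c : A}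
    (h : (a : E) * star (b : E) = c) : (φ a : F) * star (φ b : F) = φ c := by
  obtain ⟨Φ, hΦ⟩ := hφ
  rw [← hΦ, ← hΦ, ← hΦ]
  have : (⟨c, mem_generatedCStar A c⟩ : generatedCStar A)
      = ⟨a, mem_generatedCStar A a⟩ * star ⟨b, mem_generatedCStar A b⟩ := Subtype.ext h.symm
  rw [this, map_mul, map_star]
  rfl

theorem IsStarExtendible.star_eq (hφ : IsStarExtendible φ) {a b : A}
    (h : star (a : E) = b) : star (φ a : F) = φ b := by
  obtain ⟨Φ, hΦ⟩ := hφ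
  rw [← hΦ, ← hΦ]
  have : (⟨b, mem_generatedCStar A b⟩ : generatedCStar A)
      = star ⟨a, mem_generatedCStar A a⟩ := Subtype.ext h.symm
  rw [this, map_star]
  rfl

theorem IsStarExtendible.orthogonal (hφ : IsStarExtendible φ) {a b : A}
    (h : Orthogonal (a : E) b) : Orthogonal (φ a : F) (φ b) := by
  constructor
  · rw [hφ.star_mul (c := 0) (by simpa using h.1)]; simp
  · rw [hφ.mul_star (c := 0) (by simpa using h.2)]; simp

end StarExtendible

section Induced

variable {X Y : Type*} [Fintype X] [DecidableEq X] [Preorder X] [Fintype Y] [DecidableEq Y]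
  [Preorder Y] {φ : digraphAlgebra X →ₙₐ[ℂ] digraphAlgebra Y}

theorem IsStarExtendible.map_mem_blockDiag (hφ : IsStarExtendible φ) {a : digraphAlgebra X}
    (ha : (a : Matrix X X ℂ) ∈ blockDiag X) : (φ a : Matrix Y Y ℂ) ∈ blockDiag Y := by
  refine mem_blockDiag_iff.2 ⟨(φ a).2, ?_⟩
  rw [hφ.star_eq (b := ⟨star (a : Matrix X X ℂ), (mem_blockDiag_iff.1 ha).2⟩) rfl]
  exact SetLike.coe_mem _

theorem IsStarExtendible.map_isNormalizing (hφ : IsStarExtendible φ) {a : digraphAlgebra X}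
    (ha : IsNormalizing (a : Matrix X X ℂ)) : IsNormalizing (φ a : Matrix Y Y ℂ) := by
  have h1 := hφ.star_mul (a := a) (b := a) (c := ⟨_, blockDiag_le ha.star_mul_self⟩) rfl
  have h2 := hφ.mul_star (a := a) (b := a) (c := ⟨_, blockDiag_le ha.mul_star_self⟩) rfl
  refine ⟨SetLike.coe_mem _, ?_, ?_, ?_⟩
  · rw [h2, ← NonUnitalSubalgebra.coe_mul, ← map_mul]
    congr 2
    exact Subtype.ext ha.partialIsometry
  · rw [h1]; exact hφ.map_mem_blockDiag ha.star_mul_self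
  · rw [h2]; exact hφ.map_mem_blockDiag ha.mul_star_self

/-- The value of `φ`, with value zero outside of the digraph algebra. -/
def extendZero (φ : digraphAlgebra X →ₙₐ[ℂ] digraphAlgebra Y) (w : Matrix X X ℂ) : Matrix Y Y ℂ :=
  open Classical in if h : w ∈ digraphAlgebra X then φ ⟨w, h⟩ else 0

theorem extendZero_coe (φ : digraphAlgebra X →ₙₐ[ℂ] digraphAlgebra Y) (a : digraphAlgebra X) :
    extendZero φ a = φ a := by
  simp [extendZero]

theorem extendZero_of_mem (φ : digraphAlgebra X →ₙₐ[ℂ] digraphAlgebra Y) {w : Matrix X X ℂ}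
    (h : w ∈ digraphAlgebra X) : extendZero φ w = φ ⟨w, h⟩ := by
  simp [extendZero, h]

theorem extendZero_add (φ : digraphAlgebra X →ₙₐ[ℂ] digraphAlgebra Y) {v w : Matrix X X ℂ}
    (hv : v ∈ digraphAlgebra X) (hw : w ∈ digraphAlgebra X) :
    extendZero φ (v + w) = extendZero φ v + extendZero φ w := by
  have h := congrArg Subtype.val (map_add φ ⟨v, hv⟩ ⟨w, hw⟩)
  rw [extendZero_of_mem φ hv, extendZero_of_mem φ hw,
    extendZero_of_mem φ ((digraphAlgebra X).add_mem hv hw)]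
  exact h

theorem extendZero_mul (φ : digraphAlgebra X →ₙₐ[ℂ] digraphAlgebra Y) {v w : Matrix X X ℂ}
    (hv : v ∈ digraphAlgebra X) (hw : w ∈ digraphAlgebra X) :
    extendZero φ (v * w) = extendZero φ v * extendZero φ w := by
  have h := congrArg Subtype.val (map_mul φ ⟨v, hv⟩ ⟨w, hw⟩)
  rw [extendZero_of_mem φ hv, extendZero_of_mem φ hw,
    extendZero_of_mem φ ((digraphAlgebra X).mul_mem hv hw)]
  exact h

theorem IsStarExtendible.extendZero_star (hφ : IsStarExtendible φ) {v : Matrix X X ℂ}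
    (hv : v ∈ blockDiag X) : extendZero φ (star v) = star (extendZero φ v) := by
  rw [extendZero_of_mem φ (blockDiag_le hv), extendZero_of_mem φ (blockDiag_le (star_mem hv))]
  exact (hφ.star_eq rfl).symm

theorem IsStarExtendible.extendZero_mem_blockDiag (hφ : IsStarExtendible φ) {v : Matrix X X ℂ}
    (hv : v ∈ blockDiag X) : extendZero φ v ∈ blockDiag Y := by
  rw [extendZero_of_mem φ (blockDiag_le hv)]
  exact hφ.map_mem_blockDiag hv

theorem IsStarExtendible.extendZero_isNormalizing (hφ : IsStarExtendible φ) {v : Matrix X X ℂ}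
    (hv : IsNormalizing v) : IsNormalizing (extendZero φ v) := by
  rw [extendZero_of_mem φ hv.mem]
  exact hφ.map_isNormalizing hv

theorem IsStarExtendible.extendZero_star_mul_self (hφ : IsStarExtendible φ) {v : Matrix X X ℂ}
    (hv : IsNormalizing v) :
    extendZero φ (star v * v) = star (extendZero φ v) * extendZero φ v := by
  rw [extendZero_of_mem φ hv.mem, extendZero_of_mem φ (blockDiag_le hv.star_mul_self)]
  exact (hφ.star_mul rfl).symm

theorem IsStarExtendible.extendZero_mul_star_self (hφ : IsStarExtendible φ) {v : Matrix X X ℂ}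
    (hv : IsNormalizing v) :
    extendZero φ (v * star v) = extendZero φ v * star (extendZero φ v) := by
  rw [extendZero_of_mem φ hv.mem, extendZero_of_mem φ (blockDiag_le hv.mul_star_self)]
  exact (hφ.mul_star rfl).symm

/-- Orthogonality, diagonal equivalence and the diagonal are all preserved by a star-extendible
homomorphism, so the chain pulls back to an invariant. Universality then makes it linear in the
chain upstairs. -/
theorem isInvariant_chain_extendZero (hY : SquareFree (Reduced Y)) (hφ : IsStarExtendible φ) :
    IsInvariant fun w => chain (extendZero φ w) where
  add v w hv hw h := by
    have ho : Orthogonal (extendZero φ v) (extendZero φ w) := by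
      rw [extendZero_of_mem φ hv.mem, extendZero_of_mem φ hw.mem]
      exact hφ.orthogonal h
    simp only [extendZero_add φ hv.mem hw.mem]
    exact chain_add hY (hφ.extendZero_isNormalizing hv) (hφ.extendZero_isNormalizing hw) ho
  diagEquiv v w hv hw h := by
    obtain ⟨u, hu, z, hz, h1, h2⟩ := h
    refine chain_eq_of_diagEquiv ⟨_, hφ.extendZero_mem_blockDiag hu, _,
      hφ.extendZero_mem_blockDiag hz, ?_, ?_⟩
    · rw [← extendZero_mul φ (blockDiag_le hu) hv.mem, ← extendZero_mul φ
        ((digraphAlgebra X).mul_mem (blockDiag_le hu) hv.mem) (blockDiag_le hz), h1]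
    · have hu' := blockDiag_le (star_mem hu)
      rw [← hφ.extendZero_star hu, ← hφ.extendZero_star hz, ← extendZero_mul φ hu' hw.mem,
        ← extendZero_mul φ ((digraphAlgebra X).mul_mem hu' hw.mem) (blockDiag_le (star_mem hz)),
        ← h2]
  diag v hv _ := chain_eq_zero_of_mem_blockDiag (hφ.extendZero_mem_blockDiag hv)

/-- The map of `1`-chains induced by a star-extendible homomorphism. -/
def inducedChain (φ : digraphAlgebra X →ₙₐ[ℂ] digraphAlgebra Y) :
    (Simplex1 (Reduced X) →₀ ℤ) →ₗ[ℤ] (Simplex1 (Reduced Y) →₀ ℤ) :=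
  Finsupp.linearCombination ℤ fun e => chain (extendZero φ (edgeUnit e))

theorem chain_map (hX : SquareFree (Reduced X)) (hY : SquareFree (Reduced Y))
    (hφ : IsStarExtendible φ) {a : digraphAlgebra X} (ha : IsNormalizing (a : Matrix X X ℂ)) :
    chain (φ a : Matrix Y Y ℂ) = inducedChain φ (chain (a : Matrix X X ℂ)) := by
  rw [← extendZero_coe]
  exact (isInvariant_chain_extendZero hY hφ).apply_eq hX ha

/-- The initial and final projections of an edge unit are the diagonal units at the representatives
of its ends. Hence the boundary of the image depends on the ends only, and cycles go to cycles. -/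
theorem boundary1_inducedChain (hY : SquareFree (Reduced Y))
    (hφ : IsStarExtendible φ) (c : Simplex1 (Reduced X) →₀ ℤ) :
    boundary1 _ (inducedChain φ c) = Finsupp.linearCombination ℤ
      (fun a : Reduced X => chain0 (extendZero φ (Matrix.single (rep a) (rep a) 1)))
      (boundary1 _ c) := by
  suffices h : (boundary1 _) ∘ₗ (inducedChain φ) = (Finsupp.linearCombination ℤ
      (fun a : Reduced X => chain0 (extendZero φ (Matrix.single (rep a) (rep a) 1)))) ∘ₗ
      (boundary1 _) from LinearMap.congr_fun h c
  ext1 e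
  ext1
  have hn := isNormalizing_edgeUnit e
  simp only [LinearMap.comp_apply, inducedChain, Finsupp.lsingle_apply,
    Finsupp.linearCombination_single, one_smul]
  rw [boundary1_chain hY (hφ.extendZero_isNormalizing hn), ← hφ.extendZero_star_mul_self hn,
    ← hφ.extendZero_mul_star_self hn]
  have h1 : star (edgeUnit e) * edgeUnit e = Matrix.single (rep e.1.2) (rep e.1.2) (1 : ℂ) := by
    simp [edgeUnit]
  have h2 : edgeUnit e * star (edgeUnit e) = Matrix.single (rep e.1.1) (rep e.1.1) (1 : ℂ) := by
    simp [edgeUnit]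
  rw [h1, h2, boundary1, Finsupp.linearCombination_single, one_smul, map_sub,
    Finsupp.linearCombination_single, Finsupp.linearCombination_single, one_smul, one_smul]

end Induced

/-! ## Homology of square free posets -/

section Homology

variable {P Q : Type*} [PartialOrder P] [PartialOrder Q]

/-- A chain `a < b < c` is a degenerate square: `a` and `b` are both below `b` and `c`. -/
theorem SquareFree.isEmpty_simplex2 (h : SquareFree P) : IsEmpty (Simplex2 P) := by
  constructor
  rintro ⟨⟨a, b, c⟩, hab, hbc⟩
  rcases h a b b c hab.le (hab.trans hbc).le le_rfl hbc.le with h | h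
  · exact hab.ne h
  · exact hbc.ne h

theorem range_boundary2_eq_bot (h : SquareFree P) : LinearMap.range (boundary2 P) = ⊥ := by
  have := h.isEmpty_simplex2
  rw [LinearMap.range_eq_bot]
  ext t
  exact this.elim t

/-- The class of a cycle. -/
def H1.mk (c : Simplex1 P →₀ ℤ) (hc : boundary1 P c = 0) : H1 P :=
  Submodule.Quotient.mk ⟨c, hc⟩

theorem H1.exists_mk (z : H1 P) : ∃ c hc, H1.mk c hc = z := by
  obtain ⟨⟨c, hc⟩, rfl⟩ := Submodule.Quotient.mk_surjective _ z
  exact ⟨c, hc, rfl⟩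

/-- In the absence of `2`-simplices, homology classes are cycles. -/
def H1.toChain (h : SquareFree P) : H1 P →ₗ[ℤ] (Simplex1 P →₀ ℤ) :=
  Submodule.liftQ _ (LinearMap.ker (boundary1 P)).subtype (by
    rintro ⟨c, hc⟩ hd
    rw [Submodule.submoduleOf, Submodule.mem_comap, range_boundary2_eq_bot h] at hd
    exact hd)

@[simp] theorem H1.toChain_mk (h : SquareFree P) (c : Simplex1 P →₀ ℤ) (hc : boundary1 P c = 0) :
    H1.toChain h (H1.mk c hc) = c := rfl

theorem H1.toChain_injective (h : SquareFree P) : Function.Injective (H1.toChain h) := by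
  intro z w hzw
  obtain ⟨c, hc, rfl⟩ := H1.exists_mk z
  obtain ⟨d, hd, rfl⟩ := H1.exists_mk w
  simp only [H1.toChain_mk] at hzw
  subst hzw
  rfl

theorem H1.boundary1_toChain (h : SquareFree P) (z : H1 P) :
    boundary1 P (H1.toChain h z) = 0 := by
  obtain ⟨c, hc, rfl⟩ := H1.exists_mk z
  exact hc

theorem H1.toChain_map (hP : SquareFree P) (hQ : SquareFree Q) (f : P →o Q) (z : H1 P) :
    H1.toChain hQ (H1.map f z) = chainMap1 f (H1.toChain hP z) := by
  obtain ⟨c, hc, rfl⟩ := H1.exists_mk z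
  rfl

/-- A chain map that preserves cycles acts on homology. -/
def H1.ofChainMap (hP : SquareFree P) (F : (Simplex1 P →₀ ℤ) →ₗ[ℤ] (Simplex1 Q →₀ ℤ))
    (hF : ∀ c, boundary1 P c = 0 → boundary1 Q (F c) = 0) : H1 P →ₗ[ℤ] H1 Q :=
  (Submodule.mkQ _) ∘ₗ (LinearMap.codRestrict (LinearMap.ker (boundary1 Q)) (F ∘ₗ H1.toChain hP)
    fun z => hF _ (H1.boundary1_toChain hP z))

theorem H1.toChain_ofChainMap (hP : SquareFree P) (hQ : SquareFree Q)
    (F : (Simplex1 P →₀ ℤ) →ₗ[ℤ] (Simplex1 Q →₀ ℤ))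
    (hF : ∀ c, boundary1 P c = 0 → boundary1 Q (F c) = 0) (z : H1 P) :
    H1.toChain hQ (H1.ofChainMap hP F hF z) = F (H1.toChain hP z) := rfl

end Homology

end CycleAlgebra

end

noncomputable section

set_option linter.unusedSectionVars false

namespace CycleAlgebra

open scoped Matrix.Norms.L2Operator

/-! ## Combinatorics of disjoint unions of cycles -/

section Combinatorics

/-- A colouring of the comparable pairs such that each colour is a partial matching. -/
def IsMatchingColouring {P : Type*} [PartialOrder P] (κ : P → P → Fin 3) : Prop :=
  (∀ a b c, a ≤ b → a ≤ c → κ a b = κ a c → b = c) ∧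
  (∀ a b c, a ≤ c → b ≤ c → κ a c = κ b c → a = b)

theorem CycleVertex.pos_lt {n : ℕ} (i : CycleVertex n) : i.pos < 2 * n :=
  Fin.isLt (n := 2 * n) i

theorem CycleVertex.le_iff {n : ℕ} {i j : CycleVertex n} : i ≤ j ↔ i.pos = j.pos ∨
    (Even i.pos ∧ Odd j.pos ∧ ((i.pos + 1) % (2 * n) = j.pos ∨ (j.pos + 1) % (2 * n) = i.pos)) :=
  or_congr_left CycleVertex.pos_injective.eq_iff.symm

theorem succ_mod_eq_iff {m i j : ℕ} (hi : i < m) :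
    (i + 1) % m = j ↔ (i + 1 < m ∧ j = i + 1) ∨ (i + 1 = m ∧ j = 0) := by
  rcases Nat.lt_or_ge (i + 1) m with h | h
  · rw [Nat.mod_eq_of_lt h]; omega
  · have : i + 1 = m := by omega
    rw [this, Nat.mod_self]; omega

/-- Two even vertices with two common odd neighbours would close up a cycle of length four. This is
where `3 ≤ n` acts; all other appeals to it lead back here. -/
theorem squareFree_cycleVertex {n : ℕ} (hn : 3 ≤ n) : SquareFree (CycleVertex n) := by
  intro a b c d h1 h2 h3 h4
  rw [CycleVertex.le_iff, succ_mod_eq_iff (CycleVertex.pos_lt _),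
    succ_mod_eq_iff (CycleVertex.pos_lt _), Nat.even_iff, Nat.odd_iff] at h1 h2 h3 h4
  rw [← CycleVertex.pos_injective.eq_iff, ← CycleVertex.pos_injective.eq_iff]
  have := a.pos_lt
  have := b.pos_lt
  have := c.pos_lt
  have := d.pos_lt
  omega

/-- Colour 0 marks loops, colour 1 the edges from an even vertex to its successor, and colour 2
those to its predecessor. Each vertex meets each colour at most once. -/
theorem exists_matchingColouring_cycleVertex (n : ℕ) :
    ∃ κ : CycleVertex n → CycleVertex n → Fin 3, IsMatchingColouring κ := by
  refine ⟨fun i j => if i.pos = j.pos then 0 else if (i.pos + 1) % (2 * n) = j.pos then 1 else 2,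
    fun a b c h1 h2 h => ?_, fun a b c h1 h2 h => ?_⟩
  all_goals
    rw [CycleVertex.le_iff, Nat.even_iff, Nat.odd_iff] at h1 h2
    rw [← CycleVertex.pos_injective.eq_iff]
    have ha := a.pos_lt
    have hb := b.pos_lt
    have hc := c.pos_lt
    dsimp only at h
    split_ifs at h <;> first | (exfalso; revert h; decide) | skip
    all_goals
      simp only [succ_mod_eq_iff ha, succ_mod_eq_iff hb, succ_mod_eq_iff hc] at *
      omega

variable {s n : ℕ}

theorem sigma_le_iff {p q : Σ _ : Fin s, CycleVertex n} : p ≤ q ↔ p.1 = q.1 ∧ p.2 ≤ q.2 := by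
  obtain ⟨a, i⟩ := p
  obtain ⟨b, j⟩ := q
  rw [Sigma.le_def]
  constructor
  · rintro ⟨h, h'⟩
    dsimp at h
    subst h
    exact ⟨rfl, h'⟩
  · rintro ⟨h, h'⟩
    dsimp at h
    subst h
    exact ⟨rfl, h'⟩

theorem SquareFree.of_orderIso {P Q : Type*} [PartialOrder P] [PartialOrder Q] (e : P ≃o Q)
    (h : SquareFree Q) : SquareFree P := by
  intro a b c d h1 h2 h3 h4
  simpa using h (e a) (e b) (e c) (e d) (by simpa) (by simpa) (by simpa) (by simpa)

variable {X : Type*} [Preorder X]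

theorem IsCycleSum.squareFree (hn : 3 ≤ n) (hX : IsCycleSum n X) : SquareFree (Reduced X) := by
  obtain ⟨s, ⟨e⟩⟩ := hX
  refine SquareFree.of_orderIso e ?_
  rintro ⟨a, i⟩ ⟨b, j⟩ ⟨c, k⟩ ⟨d, l⟩ h1 h2 h3 h4
  rw [sigma_le_iff] at h1 h2 h3 h4
  dsimp at h1 h2 h3 h4
  have hab : a = b := h1.1.trans h3.1.symm
  have hcd : c = d := h1.1.symm.trans h2.1
  subst hab hcd
  rcases squareFree_cycleVertex hn i j k l h1.2 h2.2 h3.2 h4.2 with h | h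
  · exact Or.inl (by rw [h])
  · exact Or.inr (by rw [h])

theorem IsCycleSum.exists_matchingColouring (hX : IsCycleSum n X) :
    ∃ κ : Reduced X → Reduced X → Fin 3, IsMatchingColouring κ := by
  obtain ⟨s, ⟨e⟩⟩ := hX
  obtain ⟨κ, h1, h2⟩ := exists_matchingColouring_cycleVertex n
  refine ⟨fun a b => κ (e a).2 (e b).2, fun a b c hab hac h => ?_, fun a b c hac hbc h => ?_⟩
  · have hab := sigma_le_iff.1 (e.monotone hab)
    have hac := sigma_le_iff.1 (e.monotone hac)
    exact e.injective (Sigma.ext (hab.1.symm.trans hac.1) (heq_of_eq (h1 _ _ _ hab.2 hac.2 h)))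
  · have hac := sigma_le_iff.1 (e.monotone hac)
    have hbc := sigma_le_iff.1 (e.monotone hbc)
    exact e.injective (Sigma.ext (hac.1.trans hbc.1.symm) (heq_of_eq (h2 _ _ _ hac.2 hbc.2 h)))

end Combinatorics

/-! ### Star-extendibility from star homomorphisms of the ambient algebras -/

section StarExtendible

variable {E : Type*} [NonUnitalRing E] [StarRing E] [Module ℂ E] [IsScalarTower ℂ E E]
  [SMulCommClass ℂ E E] [StarModule ℂ E] [TopologicalSpace E] [IsTopologicalRing E]
  [ContinuousStar E] [ContinuousConstSMul ℂ E]
variable {F : Type*} [NonUnitalRing F] [StarRing F] [Module ℂ F] [IsScalarTower ℂ F F]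
  [SMulCommClass ℂ F F] [StarModule ℂ F] [TopologicalSpace F] [IsTopologicalRing F]
  [ContinuousStar F] [ContinuousConstSMul ℂ F]
variable {A : NonUnitalSubalgebra ℂ E} {A' : NonUnitalSubalgebra ℂ F}

/-- The restriction of `Θ` is the extension: it carries generators to generators, and continuity
carries the closure along. -/
theorem isStarExtendible_of_starHom {φ : A →ₙₐ[ℂ] A'} (Θ : E →⋆ₙₐ[ℂ] F) (hc : Continuous Θ)
    (h : ∀ a : A, Θ a = φ a) : IsStarExtendible φ := by
  have hmem : ∀ x : generatedCStar A, Θ x ∈ generatedCStar A' := by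
    rintro ⟨x, hx⟩
    have h1 : Θ x ∈ (NonUnitalStarSubalgebra.map Θ (generatedCStar A)) := ⟨x, hx, rfl⟩
    have h2 := NonUnitalStarSubalgebra.map_topologicalClosure_le
      (NonUnitalStarAlgebra.adjoin ℂ (A : Set E)) hc h1
    refine NonUnitalStarSubalgebra.topologicalClosure_mono ?_ h2
    rw [NonUnitalStarAlgHom.map_adjoin]
    refine NonUnitalStarAlgebra.adjoin_le ?_
    rintro _ ⟨a, ha, rfl⟩
    refine NonUnitalStarAlgebra.subset_adjoin ℂ _ ?_
    rw [h ⟨a, ha⟩]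
    exact (φ ⟨a, ha⟩).2
  refine ⟨NonUnitalStarAlgHom.codRestrict
    (Θ.comp (NonUnitalStarSubalgebraClass.subtype (generatedCStar A))) _ hmem, fun a => ?_⟩
  exact h a

end StarExtendible

/-! ## Embeddings of cycle algebras -/

section Embedding

variable {X : Type*} [Fintype X] [DecidableEq X] [Preorder X] {n : ℕ}

/-- The matrix of an injection of vertices. -/
def vertexMatrix (v : CycleVertex n → X) : Matrix X (CycleVertex n) ℂ :=
  Matrix.of fun x j => if v j = x then 1 else 0

theorem vertexMatrix_conjTranspose_mul_self {v : CycleVertex n → X} (hv : Function.Injective v) :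
    (vertexMatrix v).conjTranspose * vertexMatrix v = 1 := by
  ext j k
  rw [Matrix.mul_apply, Finset.sum_eq_single (v j)]
  · simp [vertexMatrix, Matrix.one_apply, hv.eq_iff, eq_comm]
  · intro x _ hx
    simp [vertexMatrix, Ne.symm hx]
  · simp

/-- The star homomorphism of matrix algebras of an injection of vertices. -/
def vertexHom (v : CycleVertex n → X) (hv : Function.Injective v) :
    Matrix (CycleVertex n) (CycleVertex n) ℂ →⋆ₙₐ[ℂ] Matrix X X ℂ where
  toFun M := vertexMatrix v * M * (vertexMatrix v).conjTranspose
  map_smul' c M := by simp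
  map_zero' := by simp
  map_add' M N := by rw [Matrix.mul_add, Matrix.add_mul]
  map_mul' M N := by
    have h := vertexMatrix_conjTranspose_mul_self hv
    simp only [Matrix.mul_assoc]
    rw [← Matrix.mul_assoc _ (vertexMatrix v), h, Matrix.one_mul]
  map_star' M := by simp [Matrix.star_eq_conjTranspose, Matrix.mul_assoc]

theorem vertexHom_apply (v : CycleVertex n → X) (hv : Function.Injective v)
    (M : Matrix (CycleVertex n) (CycleVertex n) ℂ) :
    vertexHom v hv M = vertexMatrix v * M * (vertexMatrix v).conjTranspose := rfl

theorem vertexMatrix_mul_single {Z : Type*} [DecidableEq Z] (v : CycleVertex n → X)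
    (j : CycleVertex n) (z : Z) :
    vertexMatrix v * Matrix.single j z (1 : ℂ) = Matrix.single (v j) z 1 := by
  ext x y
  by_cases hz : y = z
  · subst hz
    simp [vertexMatrix, Matrix.single_apply]
  · rw [Matrix.mul_single_apply_of_ne (hbj := hz), Matrix.single_apply_of_col_ne _ _ (Ne.symm hz)]

theorem vertexHom_single (v : CycleVertex n → X) (hv : Function.Injective v)
    (j k : CycleVertex n) : vertexHom v hv (Matrix.single j k 1) = Matrix.single (v j) (v k) 1 := by
  rw [vertexHom_apply, vertexMatrix_mul_single]
  have := congrArg Matrix.conjTranspose (vertexMatrix_mul_single v k (v j))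
  simpa using this

theorem vertexHom_mem (v : CycleVertex n → X) (hv : Function.Injective v)
    (hle : ∀ j k, j ≤ k → v j ≤ v k) {M : Matrix (CycleVertex n) (CycleVertex n) ℂ}
    (hM : M ∈ digraphAlgebra (CycleVertex n)) : vertexHom v hv M ∈ digraphAlgebra X := by
  rw [Matrix.matrix_eq_sum_single M, map_sum]
  refine sum_mem fun j _ => ?_
  rw [map_sum]
  refine sum_mem fun k _ => ?_
  have : Matrix.single j k (M j k) = M j k • Matrix.single j k (1 : ℂ) := by simp
  rw [this, map_smul, vertexHom_single]
  by_cases h : j ≤ k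
  · exact SMulMemClass.smul_mem _ (single_mem_digraphAlgebra (cls_le_cls.2 (hle j k h)) _)
  · rw [hM j k h, zero_smul]
    exact zero_mem _

/-- The homomorphism of digraph algebras of an injection of vertices that preserves edges. -/
def vertexEmbedding (v : CycleVertex n → X) (hv : Function.Injective v)
    (hle : ∀ j k, j ≤ k → v j ≤ v k) : digraphAlgebra (CycleVertex n) →ₙₐ[ℂ] digraphAlgebra X :=
  NonUnitalAlgHom.codRestrict
    ((vertexHom v hv : Matrix (CycleVertex n) (CycleVertex n) ℂ →ₙₐ[ℂ] Matrix X X ℂ).comp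
      (NonUnitalSubalgebraClass.subtype (digraphAlgebra (CycleVertex n))))
    (digraphAlgebra X) fun a => vertexHom_mem v hv hle a.2

theorem vertexEmbedding_diagUnit (v : CycleVertex n → X) (hv : Function.Injective v)
    (hle : ∀ j k, j ≤ k → v j ≤ v k) (j : CycleVertex n) :
    (vertexEmbedding v hv hle (diagUnit j) : Matrix X X ℂ) = Matrix.single (v j) (v j) 1 :=
  vertexHom_single v hv j j

theorem isStarExtendible_vertexEmbedding (v : CycleVertex n → X) (hv : Function.Injective v)
    (hle : ∀ j k, j ≤ k → v j ≤ v k) : IsStarExtendible (vertexEmbedding v hv hle) := by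
  refine isStarExtendible_of_starHom (vertexHom v hv) ?_ fun a => rfl
  exact ((continuous_const.matrix_mul continuous_id).matrix_mul continuous_const)

/-- An implementing partial isometry of `A ∩ A*` is block diagonal and so commutes with `proj (cls
x)`. That projection kills its final space and hence also its initial one, which contains `e_x`. -/
theorem not_projEquiv_single {x y : X} (h : cls x ≠ cls y) :
    ¬ ProjEquiv (digraphAlgebra X) (Matrix.single x x (1 : ℂ)) (Matrix.single y y 1) := by
  rintro ⟨u, h1, h2, h3, h4⟩
  have hu : u ∈ blockDiag X := mem_blockDiag_iff.2 ⟨h1, h2⟩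
  have h5 : proj (cls x) * u = 0 := by
    rw [← CStarRing.mul_star_self_eq_zero_iff, star_mul, star_proj, mul_assoc, ← mul_assoc u, h4]
    ext a b
    have : Matrix.single y y (1 : ℂ) = blk (cls y) (cls y) (Matrix.single y y 1) := by
      ext i j
      rw [blk_apply, Matrix.single_apply]
      by_cases hc : y = i ∧ y = j
      · simp [← hc.1, ← hc.2]
      · simp [hc]
    rw [← mul_assoc, this, blk, ← mul_assoc, ← mul_assoc, proj_mul_proj h]
    simp
  have h6 : Matrix.single x x (1 : ℂ) * proj (cls x) = 0 := by
    rw [← h3, mul_assoc, ← commute_proj hu, h5, mul_zero]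
  have := congrFun (congrFun h6 x) x
  simp [proj] at this

theorem isProperEmbedding_vertexEmbedding (v : CycleVertex n → X) (hv : Function.Injective v)
    (hle : ∀ j k, j ≤ k → v j ≤ v k) (hne : ∀ j k, j ≠ k → cls (v j) ≠ cls (v k)) :
    IsProperEmbedding n (vertexEmbedding v hv hle) := by
  refine ⟨isStarExtendible_vertexEmbedding v hv hle, fun j => ?_, fun j l hjl => ?_⟩
  · rw [vertexEmbedding_diagUnit, rank_single]
  · rw [vertexEmbedding_diagUnit, vertexEmbedding_diagUnit]
    exact not_projEquiv_single (hne j l hjl)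

/-- The matrix unit of an edge of the cycle. -/
def cycleUnit {j k : CycleVertex n} (h : j ≤ k) : digraphAlgebra (CycleVertex n) :=
  ⟨Matrix.single j k 1, single_mem_digraphAlgebra (cls_le_cls.2 h) _⟩

variable {i : digraphAlgebra (CycleVertex n) →ₙₐ[ℂ] digraphAlgebra X}
  {f : CycleVertex n →o Reduced X}

theorem isNormalizing_cycleUnit {j k : CycleVertex n} (h : j ≤ k) :
    IsNormalizing (cycleUnit h : Matrix (CycleVertex n) (CycleVertex n) ℂ) :=
  isNormalizing_single (cls_le_cls.2 h)

theorem map_cycleUnit_eq (i : digraphAlgebra (CycleVertex n) →ₙₐ[ℂ] digraphAlgebra X)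
    {j k : CycleVertex n} (h : j ≤ k) : (i (cycleUnit h) : Matrix X X ℂ)
      = i (diagUnit j) * i (cycleUnit h) * i (diagUnit k) := by
  rw [← NonUnitalSubalgebra.coe_mul, ← NonUnitalSubalgebra.coe_mul, ← map_mul, ← map_mul]
  congr 2
  apply Subtype.ext
  simp [cycleUnit, diagUnit]

theorem star_mul_self_map_cycleUnit (hi : IsStarExtendible i) {j k : CycleVertex n} (h : j ≤ k) :
    star (i (cycleUnit h) : Matrix X X ℂ) * i (cycleUnit h) = i (diagUnit k) :=
  hi.star_mul (by simp [cycleUnit, diagUnit])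

theorem rank_map_cycleUnit (hi : IsProperEmbedding n i) {j k : CycleVertex n} (h : j ≤ k) :
    (i (cycleUnit h) : Matrix X X ℂ).rank = 1 := by
  rw [← rank_star_mul_self, star_mul_self_map_cycleUnit hi.1, hi.2.1]

theorem proj_mul_of_support {p : Matrix X X ℂ} {a : Reduced X}
    (h : ∀ x y, p x y ≠ 0 → cls x = a ∧ cls y = a) : proj a * p = p ∧ p * proj a = p := by
  constructor
  · ext x y
    simp only [proj, Matrix.diagonal_mul]
    by_cases hp : p x y = 0
    · simp [hp]
    · simp [(h x y hp).1]
  · ext x y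
    simp only [proj, Matrix.mul_diagonal]
    by_cases hp : p x y = 0
    · simp [hp]
    · simp [(h x y hp).2]

theorem blk_map_cycleUnit (hf : InducesVertexMap i f) {j k : CycleVertex n} (h : j ≤ k) :
    blk (f j) (f k) (i (cycleUnit h) : Matrix X X ℂ) = i (cycleUnit h) := by
  have h1 := (proj_mul_of_support (hf j)).1
  have h2 := (proj_mul_of_support (hf k)).2
  rw [map_cycleUnit_eq i h, blk, ← mul_assoc, ← mul_assoc, h1, mul_assoc, mul_assoc, h2, mul_assoc]

/-- All blocks but one vanish. If `a < b` fails, the remaining one is not counted by the chain, and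
both sides are zero. -/
theorem chain_of_rank_one {v : Matrix X X ℂ} {a b : Reduced X} (hb : blk a b v = v)
    (hr : v.rank = 1) : chain v = edgeChain a b := by
  ext e
  rw [chain_apply]
  by_cases he : e.1 = (a, b)
  · have hlt : a < b := by have := e.2; rwa [he] at this
    have : e = ⟨(a, b), hlt⟩ := Subtype.ext he
    subst this
    simp only [edgeChain, hlt, dif_pos, hb, hr]
    simp
  · have h1 : blk e.1.1 e.1.2 v = 0 := by
      rw [← hb]
      ext x y
      rw [blk_apply, blk_apply]
      by_cases h2 : cls x = e.1.1 ∧ cls y = e.1.2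
      · rw [if_pos h2, if_neg]
        · rfl
        · rintro ⟨h3, h4⟩
          exact he (Prod.ext (h2.1.symm.trans h3) (h2.2.symm.trans h4))
      · rw [if_neg h2]; rfl
    rw [h1]
    by_cases hlt : a < b
    · have : (⟨(a, b), hlt⟩ : Simplex1 (Reduced X)) ≠ e := fun h => he (by rw [← h])
      simp [edgeChain, hlt, this]
    · simp [edgeChain, hlt]

theorem chain_map_cycleUnit (hi : IsProperEmbedding n i) (hf : InducesVertexMap i f)
    {j k : CycleVertex n} (h : j ≤ k) :
    chain (i (cycleUnit h) : Matrix X X ℂ) = edgeChain (f j) (f k) :=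
  chain_of_rank_one (blk_map_cycleUnit hf h) (rank_map_cycleUnit hi h)

theorem eq_zero_of_rank_eq_zero {w : Matrix X X ℂ} (hw : w * star w * w = w) (h : w.rank = 0) :
    w = 0 := by
  have := rank_eq_trace hw
  rw [h, Nat.cast_zero, Matrix.star_eq_conjTranspose] at this
  open scoped ComplexOrder in exact Matrix.trace_conjTranspose_mul_self_eq_zero_iff.1 this.symm

/-- The ranks of the diagonal blocks add up to the rank, which is one, so exactly one block is
nonzero. -/
theorem exists_support_of_rank_one (hX : SquareFree (Reduced X)) {p : Matrix X X ℂ}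
    (hp : p ∈ blockDiag X) (hsp : star p = p) (hpp : p * p = p) (hr : p.rank = 1) :
    ∃ a, ∀ x y, p x y ≠ 0 → cls x = a ∧ cls y = a := by
  have hn : IsNormalizing p := isNormalizing_of_mem_blockDiag hp (by rw [hsp, hpp, hpp])
  have hsum : ∑ a, (blk a a p).rank = 1 := by
    have : ((∑ a, (blk a a p).rank : ℕ) : ℂ) = ((1 : ℕ) : ℂ) := by
      rw [← hr, rank_eq_trace_of_isIdempotentElem hpp]
      push_cast
      simp only [rank_blk_eq_trace hp hpp]
      rw [← Matrix.trace_sum, ← Finset.sum_mul, sum_proj, one_mul]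
    exact_mod_cast this
  obtain ⟨a, -, ha⟩ := Finset.exists_ne_zero_of_sum_ne_zero (s := Finset.univ)
    (f := fun a => (blk a a p).rank) (by rw [hsum]; exact one_ne_zero)
  have key : ∀ b, b ≠ a → blk b b p = 0 := by
    intro b hb
    refine eq_zero_of_rank_eq_zero (hn.blk hX b b).partialIsometry ?_
    classical
    have h1 := Finset.sum_le_sum_of_subset (f := fun a => (blk a a p).rank)
      (Finset.subset_univ {a, b})
    rw [hsum, Finset.sum_pair hb.symm] at h1
    have : (blk a a p).rank ≠ 0 := ha
    omega
  refine ⟨a, fun x y hxy => ?_⟩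
  have hc := hp x y hxy
  have : cls x = a := by
    by_contra hne
    have h1 := congrFun (congrFun (key _ hne) x) y
    rw [blk_apply, if_pos ⟨rfl, hc.symm⟩] at h1
    exact hxy h1
  exact ⟨this, hc ▸ this⟩

theorem IsProperEmbedding.exists_inducesVertexMap (hX : SquareFree (Reduced X))
    (hi : IsProperEmbedding n i) : ∃ f : CycleVertex n →o Reduced X, InducesVertexMap i f := by
  have h1 : ∀ j, ∃ a, ∀ x y, (i (diagUnit j) : Matrix X X ℂ) x y ≠ 0 → cls x = a ∧ cls y = a := by
    intro j
    refine exists_support_of_rank_one hX (hi.1.map_mem_blockDiag (single_mem_blockDiag rfl _))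
      (hi.1.star_eq (by simp [diagUnit])) ?_ (hi.2.1 j)
    rw [← NonUnitalSubalgebra.coe_mul, ← map_mul]
    congr 2
    apply Subtype.ext
    simp [diagUnit]
  choose f hf using h1
  refine ⟨⟨f, fun j k hjk => ?_⟩, hf⟩
  -- Monotonicity: the image of the matrix unit of an edge is nonzero and lies in the block `(f j, f
  -- k)`, and nonzero blocks of the digraph algebra occur only for `f j ≤ f k`.
  have hne : (i (cycleUnit hjk) : Matrix X X ℂ) ≠ 0 := by
    intro h0
    have := rank_map_cycleUnit hi hjk
    rw [h0] at this
    simp at this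
  have hb : blk (f j) (f k) (i (cycleUnit hjk) : Matrix X X ℂ) = i (cycleUnit hjk) := by
    have h1 := (proj_mul_of_support (hf j)).1
    have h2 := (proj_mul_of_support (hf k)).2
    rw [map_cycleUnit_eq i hjk, blk, ← mul_assoc, ← mul_assoc, h1, mul_assoc, mul_assoc, h2,
      mul_assoc]
  by_contra hc
  exact hne (hb.symm.trans (blk_eq_zero_of_not_le (SetLike.coe_mem _) hc))

end Embedding

end CycleAlgebra

end

noncomputable section

set_option linter.unusedSectionVars false

namespace CycleAlgebra

/-! ## The homomorphism of homology groups induced by a rigid embedding -/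

section InducedMap

variable {X Y : Type*} [Fintype X] [DecidableEq X] [Preorder X] [Fintype Y] [DecidableEq Y]
  [Preorder Y] {n : ℕ} {φ : digraphAlgebra X →ₙₐ[ℂ] digraphAlgebra Y}

theorem boundary1_inducedChain_eq_zero (hY : SquareFree (Reduced Y)) (hφ : IsStarExtendible φ)
    (c : Simplex1 (Reduced X) →₀ ℤ) (hc : boundary1 _ c = 0) :
    boundary1 _ (inducedChain φ c) = 0 := by
  rw [boundary1_inducedChain hY hφ, hc, map_zero]

/-- The homomorphism of homology groups induced by a star-extendible homomorphism. -/
def homologyMap (hX : SquareFree (Reduced X)) (hY : SquareFree (Reduced Y))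
    (hφ : IsStarExtendible φ) : H1 (Reduced X) →ₗ[ℤ] H1 (Reduced Y) :=
  H1.ofChainMap hX (inducedChain φ) (boundary1_inducedChain_eq_zero hY hφ)

/-- The chain of `φ (η e_{jk})` is computed twice: by `chain_map`, and as the chain of the
orthogonal sum of the rank one partial isometries `i r e_{jk}`. -/
theorem inducedChain_edgeChain (hX : SquareFree (Reduced X)) (hY : SquareFree (Reduced Y))
    (hφ : IsStarExtendible φ) {N : ℕ} {η : digraphAlgebra (CycleVertex n) →ₙₐ[ℂ] digraphAlgebra X}
    {f : CycleVertex n →o Reduced X}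
    {i : Fin N → digraphAlgebra (CycleVertex n) →ₙₐ[ℂ] digraphAlgebra Y}
    {g : Fin N → CycleVertex n →o Reduced Y} (hη : IsProperEmbedding n η)
    (hf : InducesVertexMap η f) (hi : ∀ r, IsProperEmbedding n (i r))
    (hg : ∀ r, InducesVertexMap (i r) (g r)) (hs : IsDirectSum (φ.comp η) i)
    {j k : CycleVertex n} (h : j ≤ k) :
    inducedChain φ (edgeChain (f j) (f k)) = ∑ r, edgeChain (g r j) (g r k) := by
  rw [← chain_map_cycleUnit hη hf h,
    ← chain_map hX hY hφ (hη.1.map_isNormalizing (isNormalizing_cycleUnit h))]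
  have h1 : (φ (η (cycleUnit h)) : Matrix Y Y ℂ)
      = ∑ r, (i r (cycleUnit h) : Matrix Y Y ℂ) := by
    have := congrArg Subtype.val (hs.1 (cycleUnit h))
    rw [AddSubmonoidClass.coe_finsetSum] at this
    exact this
  -- A direct sum gives only products without adjoints. Orthogonality follows by inserting the
  -- images of the diagonal units, which are self-adjoint, between the two factors.
  have horth : ∀ r s, r ≠ s → Orthogonal (i r (cycleUnit h) : Matrix Y Y ℂ) (i s (cycleUnit h)) := by
    intro r s hrs
    have hsa : ∀ r j, star (i r (diagUnit j) : Matrix Y Y ℂ) = i r (diagUnit j) :=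
      fun r j => (hi r).1.star_eq (by simp [diagUnit])
    have hd : ∀ j, (i r (diagUnit j) : Matrix Y Y ℂ) * i s (diagUnit j) = 0 := by
      intro j
      have := congrArg Subtype.val (hs.2 r s hrs (diagUnit j) (diagUnit j))
      exact this
    constructor
    · rw [map_cycleUnit_eq (i r) h, map_cycleUnit_eq (i s) h, star_mul, star_mul, hsa, hsa]
      simp only [mul_assoc]
      rw [← mul_assoc (i r (diagUnit j) : Matrix Y Y ℂ) (i s (diagUnit j) : Matrix Y Y ℂ), hd]
      simp
    · rw [map_cycleUnit_eq (i r) h, map_cycleUnit_eq (i s) h, star_mul, star_mul, hsa, hsa]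
      simp only [mul_assoc]
      rw [← mul_assoc (i r (diagUnit k) : Matrix Y Y ℂ) (i s (diagUnit k) : Matrix Y Y ℂ), hd]
      simp
  rw [h1, (isInvariant_chain hY).sum
    (fun r _ => (hi r).1.map_isNormalizing (isNormalizing_cycleUnit h))
    (fun r _ s _ hrs => horth r s hrs)]
  exact Finset.sum_congr rfl fun r _ => chain_map_cycleUnit (hi r) (hg r) h

/-- Homology embeds in chains on both sides, so the identity can be checked on single edges of the
cycle. -/
theorem isH1Map_homologyMap (hn : 3 ≤ n) (hX : SquareFree (Reduced X))
    (hY : SquareFree (Reduced Y)) (hφ : IsStarExtendible φ) :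
    IsH1Map n φ (homologyMap hX hY hφ) := by
  intro η f N i g hη hf hi hg hs
  have hD := squareFree_cycleVertex hn
  have key : inducedChain φ ∘ₗ chainMap1 f = ∑ r, chainMap1 (g r) := by
    ext1 e
    ext1
    rw [LinearMap.comp_apply, LinearMap.comp_apply, LinearMap.comp_apply, LinearMap.sum_apply]
    simp only [chainMap1, Finsupp.lsingle_apply, Finsupp.linearCombination_single, one_smul]
    exact inducedChain_edgeChain hX hY hφ hη hf hi hg hs e.2.le
  refine LinearMap.ext fun z => H1.toChain_injective hY ?_
  rw [LinearMap.comp_apply, homologyMap, H1.toChain_ofChainMap hX hY, H1.toChain_map hD hX,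
    LinearMap.sum_apply, map_sum]
  simp only [H1.toChain_map hD hY]
  have := LinearMap.congr_fun key (H1.toChain hD z)
  rwa [LinearMap.comp_apply, LinearMap.sum_apply] at this

variable {s : ℕ}

/-- The inclusion of a component. -/
def componentMap (e : Reduced X ≃o Σ _ : Fin s, CycleVertex n) (c : Fin s) :
    CycleVertex n →o Reduced X where
  toFun j := e.symm ⟨c, j⟩
  monotone' _ _ h := e.symm.monotone (sigma_le_iff.2 ⟨rfl, h⟩)

/-- The restriction of `1`-chains to a component. -/
def restrict1 (e : Reduced X ≃o Σ _ : Fin s, CycleVertex n) (c : Fin s) :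
    (Simplex1 (Reduced X) →₀ ℤ) →ₗ[ℤ] (Simplex1 (CycleVertex n) →₀ ℤ) :=
  Finsupp.linearCombination ℤ fun d =>
    if (e d.1.1).1 = c then edgeChain (e d.1.1).2 (e d.1.2).2 else 0

/-- The restriction of `0`-chains to a component. -/
def restrict0 (e : Reduced X ≃o Σ _ : Fin s, CycleVertex n) (c : Fin s) :
    (Reduced X →₀ ℤ) →ₗ[ℤ] (CycleVertex n →₀ ℤ) :=
  Finsupp.linearCombination ℤ fun a => if (e a).1 = c then Finsupp.single (e a).2 1 else 0

theorem boundary1_restrict1 (e : Reduced X ≃o Σ _ : Fin s, CycleVertex n) (c : Fin s)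
    (z : Simplex1 (Reduced X) →₀ ℤ) :
    boundary1 _ (restrict1 e c z) = restrict0 e c (boundary1 _ z) := by
  suffices h : boundary1 _ ∘ₗ restrict1 e c = restrict0 e c ∘ₗ boundary1 _ from
    LinearMap.congr_fun h z
  ext1 d
  ext1
  have h1 := sigma_le_iff.1 (e.monotone d.2.le)
  simp only [LinearMap.comp_apply, restrict1, Finsupp.lsingle_apply,
    Finsupp.linearCombination_single, one_smul, boundary1, map_sub, restrict0]
  rw [← h1.1]
  split_ifs with hc
  · have := boundary1_edgeChain h1.2
    rw [boundary1] at this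
    exact this
  · simp

theorem sum_chainMap1_restrict1 (e : Reduced X ≃o Σ _ : Fin s, CycleVertex n)
    (z : Simplex1 (Reduced X) →₀ ℤ) :
    ∑ c, chainMap1 (componentMap e c) (restrict1 e c z) = z := by
  suffices h : ∑ c, chainMap1 (componentMap e c) ∘ₗ restrict1 e c = LinearMap.id by
    have := LinearMap.congr_fun h z
    rwa [LinearMap.sum_apply] at this
  ext1 d
  ext1
  have h1 := sigma_le_iff.1 (e.monotone d.2.le)
  have h2 : (e d.1.1).2 < (e d.1.2).2 := by
    refine lt_of_le_of_ne h1.2 fun h => d.2.ne (e.injective (Sigma.ext h1.1 (heq_of_eq h)))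
  rw [LinearMap.comp_apply, LinearMap.sum_apply, Finset.sum_eq_single (e d.1.1).1]
  · simp only [LinearMap.comp_apply, restrict1, Finsupp.lsingle_apply,
      Finsupp.linearCombination_single, one_smul, if_true, LinearMap.id_apply]
    rw [chainMap1_edgeChain _ h2]
    have e1 : componentMap e (e d.1.1).1 (e d.1.1).2 = d.1.1 := e.symm_apply_apply _
    have e2 : componentMap e (e d.1.1).1 (e d.1.2).2 = d.1.2 := by
      rw [h1.1]; exact e.symm_apply_apply _
    rw [e1, e2, edgeChain, dif_pos d.2]
  · intro c _ hc
    simp [restrict1, Ne.symm hc]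
  · simp

/-- Each component is the image of a proper embedding given by matrix units at representatives.
Rigidity decomposes its composition with `φ`, and this prescribes the value on the classes of that
component. Every cycle is the sum of its restrictions to components, which are again cycles. -/
theorem IsH1Map.eq (hn : 3 ≤ n) (hX : IsCycleSum n X) (hY : IsCycleSum n Y) (hφ : IsRigid n φ)
    {h h' : H1 (Reduced X) →ₗ[ℤ] H1 (Reduced Y)} (hh : IsH1Map n φ h) (hh' : IsH1Map n φ h') :
    h = h' := by
  have hX' := hX.squareFree hn
  have hY' := hY.squareFree hn
  have hD := squareFree_cycleVertex hn
  obtain ⟨s, ⟨e⟩⟩ := hX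
  have hcomp : ∀ c, h ∘ₗ H1.map (componentMap e c) = h' ∘ₗ H1.map (componentMap e c) := by
    intro c
    set v : CycleVertex n → X := fun j => rep (componentMap e c j) with hv
    have hle : ∀ j k, j ≤ k → v j ≤ v k := fun j k hjk => by
      rw [← cls_le_cls, hv, cls_rep, cls_rep]
      exact (componentMap e c).monotone hjk
    have hne : ∀ j k, j ≠ k → cls (v j) ≠ cls (v k) := by
      intro j k hjk hc
      rw [hv, cls_rep, cls_rep] at hc
      have := e.symm.injective hc
      exact hjk (eq_of_heq (Sigma.mk.inj this).2)
    have hinj : Function.Injective v := fun j k hjk => by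
      by_contra hc
      exact hne j k hc (by rw [hjk])
    have hη := isProperEmbedding_vertexEmbedding v hinj hle hne
    have hf : InducesVertexMap (vertexEmbedding v hinj hle) (componentMap e c) := by
      intro j x y hxy
      rw [vertexEmbedding_diagUnit, Matrix.single_apply] at hxy
      have : v j = x ∧ v j = y := by by_contra hc; simp [hc] at hxy
      rw [← this.1, ← this.2]
      exact ⟨cls_rep _, cls_rep _⟩
    obtain ⟨N, i, hi, hs⟩ := hφ.2.2 _ hη
    choose g hg using fun r => (hi r).exists_inducesVertexMap hY'
    rw [hh _ _ N i g hη hf hi hg hs, hh' _ _ N i g hη hf hi hg hs]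
  refine LinearMap.ext fun z => ?_
  have hz : z = ∑ c, H1.map (componentMap e c) (H1.mk (restrict1 e c (H1.toChain hX' z))
      (by rw [boundary1_restrict1, H1.boundary1_toChain, map_zero])) := by
    apply H1.toChain_injective hX'
    rw [map_sum]
    simp only [H1.toChain_map hD hX', H1.toChain_mk]
    rw [sum_chainMap1_restrict1]
  rw [hz, map_sum, map_sum]
  exact Finset.sum_congr rfl fun c _ => LinearMap.congr_fun (hcomp c) _

theorem existsUnique_isH1Map (hn : 3 ≤ n) (hX : IsCycleSum n X) (hY : IsCycleSum n Y)
    (hφ : IsRigid n φ) : ∃! h, IsH1Map n φ h :=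
  ⟨_, isH1Map_homologyMap hn (hX.squareFree hn) (hY.squareFree hn) hφ.1,
    fun _ hh => hh.eq hn hX hY hφ (isH1Map_homologyMap hn _ _ _)⟩

/-- By uniqueness, the homomorphism picked by choice is the explicit one on chains. -/
theorem toChain_inducedH1 (hn : 3 ≤ n) (hX : IsCycleSum n X) (hY : IsCycleSum n Y)
    (hφ : IsRigid n φ) (z : H1 (Reduced X)) :
    H1.toChain (hY.squareFree hn) (inducedH1 n φ z)
      = inducedChain φ (H1.toChain (hX.squareFree hn) z) := by
  have h : ∃ h, IsH1Map n φ h := (existsUnique_isH1Map hn hX hY hφ).exists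
  have h1 : inducedH1 n φ = homologyMap (hX.squareFree hn) (hY.squareFree hn) hφ.1 := by
    rw [inducedH1, dif_pos h]
    exact h.choose_spec.eq hn hX hY hφ (isH1Map_homologyMap hn _ _ _)
  rw [h1]
  exact H1.toChain_ofChainMap _ _ _ _ z

end InducedMap

end CycleAlgebra

end

noncomputable section

set_option linter.unusedSectionVars false

namespace CycleAlgebra

open scoped Matrix.Norms.L2Operator

/-! ## Approximate partial isometries -/

section Perturbation

variable {X : Type*} [Fintype X] [DecidableEq X]

/-- Since the spectrum is finite, the functional calculus also accepts functions with jumps. -/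
theorem continuousOn_spectrum (f : ℝ → ℝ) (h : Matrix X X ℂ) : ContinuousOn f (spectrum ℝ h) := by
  have : (spectrum ℝ h).Finite := Matrix.finite_real_spectrum
  exact this.continuousOn f

/-- An approximate partial isometry can be corrected by an element that commutes with the commutant
of its modulus. -/
theorem exists_correction (M : Matrix X X ℂ) : ∃ g : Matrix X X ℂ,
    (∀ x, Commute x (star M * M) → Commute x g) ∧
    (M * g) * star (M * g) * (M * g) = M * g ∧
    (‖M * star M * M - M‖ < 1 / 8 → ‖M * g - M‖ ≤ 2 * ‖M * star M * M - M‖) := by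
  by_cases hsmall : ‖M * star M * M - M‖ < 1 / 8
  swap
  -- When the defect is not small the norm estimate is void, and zero satisfies the remaining
  -- clauses.
  · exact ⟨0, fun x _ => Commute.zero_right x, by simp, fun h => absurd h hsmall⟩
  set δ := ‖M * star M * M - M‖ with hδ
  set h := star M * M with hh
  have hsa : IsSelfAdjoint h := IsSelfAdjoint.star_mul_self M
  have hδ0 : 0 ≤ δ := norm_nonneg _
  -- With `h = star M * M`, the defect `D = M * star M * M - M` satisfies `star D * D = h * (h - 1)
  -- ^ 2`, so the spectrum of `h` clusters at 0 and 1.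
  have hspec : ∀ t ∈ spectrum ℝ h, 0 ≤ t ∧ t * (t - 1) ^ 2 ≤ δ ^ 2 := by
    intro t ht
    refine ⟨spectrum_star_mul_self_nonneg t ht, ?_⟩
    have h1 : cfc (fun t : ℝ => t * (t - 1) ^ 2) h
        = star (M * star M * M - M) * (M * star M * M - M) := by
      have e1 : star (M * star M * M - M) * (M * star M * M - M) = h * (h - 1) ^ 2 := by
        simp only [star_sub, star_mul, star_star, hh]
        noncomm_ring
      rw [e1, cfc_mul _ _ h (continuousOn_spectrum _ _) (continuousOn_spectrum _ _),
        cfc_pow _ _ h (continuousOn_spectrum _ _),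
        cfc_sub _ _ h (continuousOn_spectrum _ _) (continuousOn_spectrum _ _),
        cfc_id' ℝ h, cfc_const_one ℝ h]
    have h2 := norm_apply_le_norm_cfc (fun t : ℝ => t * (t - 1) ^ 2) h ht
      (continuousOn_spectrum _ _)
    rw [h1, CStarRing.norm_star_mul_self, Real.norm_eq_abs] at h2
    nlinarith [le_abs_self (t * (t - 1) ^ 2)]
  -- The polar part of `M` with the spectrum below 1/2 discarded: the values of `t * (f t) ^ 2` are
  -- exactly 0 and 1.
  set f : ℝ → ℝ := fun t => if t < 1 / 2 then 0 else (√t)⁻¹ with hf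
  set g := cfc f h with hg
  have hgs : star g = g := (cfc_predicate f h : IsSelfAdjoint _)
  refine ⟨g, fun x hx => ?_, ?_, fun _ => ?_⟩
  · exact (Commute.cfc_real hx.symm f).symm
  · have e : M * g * star (M * g) * (M * g) = M * (g * g * h * g) := by
      rw [star_mul, hgs, hh]; noncomm_ring
    rw [e]
    congr 1
    have h0 : h = cfc (fun t : ℝ => t) h := (cfc_id' ℝ h).symm
    have e2 : g * g * h * g = cfc (fun t : ℝ => f t * f t * t * f t) h := by
      rw [cfc_mul _ _ h (continuousOn_spectrum _ _) (continuousOn_spectrum _ _),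
        cfc_mul _ _ h (continuousOn_spectrum _ _) (continuousOn_spectrum _ _),
        cfc_mul _ _ h (continuousOn_spectrum _ _) (continuousOn_spectrum _ _), ← h0, ← hg]
    rw [e2]
    refine cfc_congr fun t ht => ?_
    simp only [hf]
    split_ifs with h1
    · simp
    · have ht0 : 0 < t := by linarith
      have := Real.mul_self_sqrt ht0.le
      have hs : √t ≠ 0 := (Real.sqrt_pos.2 ht0).ne'
      field_simp
      nlinarith
  · have e : star (M * g - M) * (M * g - M) = (g - 1) * h * (g - 1) := by
      rw [star_sub, star_mul, hgs, hh]; noncomm_ring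
    have e2 : (g - 1) * h * (g - 1) = cfc (fun t : ℝ => (f t - 1) * t * (f t - 1)) h := by
      rw [cfc_mul _ _ h (continuousOn_spectrum _ _) (continuousOn_spectrum _ _),
        cfc_mul _ _ h (continuousOn_spectrum _ _) (continuousOn_spectrum _ _),
        cfc_sub _ _ h (continuousOn_spectrum _ _) (continuousOn_spectrum _ _),
        cfc_id' ℝ h, cfc_const_one ℝ h]
    -- Below 1/2 the function equals `t`, and `t ≤ 4 * t * (t - 1) ^ 2`; from 1/2 on it equals `(1 -
    -- √t) ^ 2`, which is at most `(t - 1) ^ 2 ≤ 2 * t * (t - 1) ^ 2`.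
    have h1 : ‖M * g - M‖ * ‖M * g - M‖ ≤ (2 * δ) ^ 2 := by
      rw [← CStarRing.norm_star_mul_self, e, e2]
      refine norm_cfc_le (by positivity) fun t ht => ?_
      obtain ⟨h1, h2⟩ := hspec t ht
      rw [Real.norm_eq_abs, abs_of_nonneg (by
        nlinarith [mul_nonneg h1 (mul_self_nonneg (f t - 1))])]
      simp only [hf]
      split_ifs with h3
      · nlinarith [mul_nonneg h1 (by nlinarith : (0 : ℝ) ≤ (t - 1) ^ 2 - 1 / 4)]
      · push Not at h3
        have hs := Real.mul_self_sqrt h1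
        have hsp : 0 < √t := Real.sqrt_pos.2 (by linarith)
        have e3 : ((√t)⁻¹ - 1) * t * ((√t)⁻¹ - 1) = (1 - √t) ^ 2 := by
          have key : ∀ r : ℝ, r ≠ 0 → (r⁻¹ - 1) * (r * r) * (r⁻¹ - 1) = (1 - r) ^ 2 := by
            intro r hr
            field_simp
          have := key _ hsp.ne'
          rwa [hs] at this
        rw [e3]
        have h4 : (t - 1) ^ 2 = (1 - √t) ^ 2 * (1 + √t) ^ 2 := by
          conv_lhs => rw [← hs]
          ring
        have h5 : (1 - √t) ^ 2 ≤ (t - 1) ^ 2 := by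
          rw [h4]
          nlinarith [mul_nonneg (sq_nonneg (1 - √t)) (by nlinarith : (0 : ℝ) ≤ (1 + √t) ^ 2 - 1)]
        nlinarith [sq_nonneg (t - 1)]
    nlinarith [norm_nonneg (M * g - M)]

theorem norm_add_of_orthogonal {x y : Matrix X X ℂ} (h : Orthogonal x y) :
    ‖x + y‖ ≤ max ‖x‖ ‖y‖ := by
  have h1 : star (x + y) * (x + y) = star x * x + star y * y := by
    rw [star_add, add_mul, mul_add, mul_add, h.1, h.symm.1]; simp
  have h2 : ‖star x * x + star y * y‖ = max ‖star x * x‖ ‖star y * y‖ := by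
    refine IsSelfAdjoint.norm_add_eq_max (IsSelfAdjoint.star_mul_self x)
      (IsSelfAdjoint.star_mul_self y) ?_
    calc star x * x * (star y * y) = star x * (x * star y) * y := by noncomm_ring
      _ = 0 := by rw [h.2]; simp
  have h3 : ‖x + y‖ * ‖x + y‖ = max (‖x‖ * ‖x‖) (‖y‖ * ‖y‖) := by
    rw [← CStarRing.norm_star_mul_self, h1, h2, CStarRing.norm_star_mul_self,
      CStarRing.norm_star_mul_self]
  rcases le_total ‖x‖ ‖y‖ with h4 | h4
  · rw [max_eq_right h4]
    rw [max_eq_right (by gcongr)] at h3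
    exact le_of_eq ((mul_self_inj (norm_nonneg _) (norm_nonneg _)).1 h3)
  · rw [max_eq_left h4]
    rw [max_eq_left (by gcongr)] at h3
    exact le_of_eq ((mul_self_inj (norm_nonneg _) (norm_nonneg _)).1 h3)

theorem norm_sum_le_of_orthogonal {ι : Type*} {z : ι → Matrix X X ℂ} {s : Finset ι} {C : ℝ}
    (hC : 0 ≤ C) (hz : ∀ i ∈ s, ‖z i‖ ≤ C)
    (ho : ∀ i ∈ s, ∀ j ∈ s, i ≠ j → Orthogonal (z i) (z j)) : ‖∑ i ∈ s, z i‖ ≤ C := by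
  classical
  induction s using Finset.induction_on with
  | empty => simpa using hC
  | insert a s ha ih =>
    rw [Finset.sum_insert ha]
    refine (norm_add_of_orthogonal (Orthogonal.symm ?_)).trans (max_le (hz a (by simp))
      (ih (fun i hi => hz i (by simp [hi]))
        (fun i hi j hj => ho i (by simp [hi]) j (by simp [hj]))))
    exact orthogonal_sum_left fun i hi => ho i (by simp [hi]) a (by simp) (fun h => ha (h ▸ hi))

end Perturbation

/-! ## Colour components -/

section Colour

variable {X : Type*} [Preorder X] [Fintype X] [DecidableEq X]

/-- When the support is a partial matching of classes, the blocks are mutually orthogonal and the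
norm is bounded by the largest block norm. The bound does not depend on the number of blocks, which
may grow along a tower. -/
theorem norm_le_of_matching {Z : Matrix X X ℂ} {C : ℝ} (hC : 0 ≤ C)
    (hZ : ∀ x y x' y', Z x y ≠ 0 → Z x' y' ≠ 0 → (cls x = cls x' ↔ cls y = cls y'))
    (hb : ∀ a b, ‖blk a b Z‖ ≤ C) : ‖Z‖ ≤ C := by
  have hnz : ∀ {a b : Reduced X} {x y : X}, blk a b Z x y ≠ 0 → cls x = a ∧ cls y = b ∧ Z x y ≠ 0 := by
    intro a b x y h
    rw [blk_apply] at h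
    split_ifs at h with h'
    · exact ⟨h'.1, h'.2, h⟩
    · exact absurd rfl h
  rw [← sum_blk Z]
  refine norm_sum_le_of_orthogonal hC (fun p _ => hb _ _) ?_
  rintro ⟨a, b⟩ - ⟨c, d⟩ - hne
  constructor
  · ext x y
    by_contra hc
    obtain ⟨k, -, hk⟩ := Finset.exists_ne_zero_of_sum_ne_zero
      (Matrix.mul_apply (M := star (blk a b Z)) ▸ hc)
    rw [Matrix.star_apply] at hk
    obtain ⟨h1, h2, h3⟩ := hnz (star_ne_zero.1 (left_ne_zero_of_mul hk))
    obtain ⟨h4, h5, h6⟩ := hnz (right_ne_zero_of_mul hk)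
    exact hne (Prod.ext (h1.symm.trans h4) (h2.symm.trans (((hZ _ _ _ _ h3 h6).1 rfl).trans h5)))
  · ext x y
    by_contra hc
    obtain ⟨k, -, hk⟩ := Finset.exists_ne_zero_of_sum_ne_zero
      (Matrix.mul_apply (M := blk a b Z) ▸ hc)
    rw [Matrix.star_apply] at hk
    obtain ⟨h1, h2, h3⟩ := hnz (left_ne_zero_of_mul hk)
    obtain ⟨h4, h5, h6⟩ := hnz (star_ne_zero.1 (right_ne_zero_of_mul hk))
    exact hne (Prod.ext (h1.symm.trans (((hZ _ _ _ _ h3 h6).2 rfl).trans h4)) (h2.symm.trans h5))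

variable (κ : Reduced X → Reduced X → Fin 3)

/-- The matrices of the digraph algebra that are supported in the blocks of one colour. -/
def Monochrome (c : Fin 3) (M : Matrix X X ℂ) : Prop :=
  ∀ x y, M x y ≠ 0 → cls x ≤ cls y ∧ κ (cls x) (cls y) = c

/-- The component of a colour. -/
def colourPart (c : Fin 3) (M : Matrix X X ℂ) : Matrix X X ℂ :=
  Matrix.of fun x y => if κ (cls x) (cls y) = c then M x y else 0

variable {κ} {M N : Matrix X X ℂ} {c d : Fin 3}

theorem colourPart_apply (x y : X) :
    colourPart κ c M x y = if κ (cls x) (cls y) = c then M x y else 0 := rfl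

theorem colourPart_ne_zero {x y : X} (h : colourPart κ c M x y ≠ 0) :
    M x y ≠ 0 ∧ κ (cls x) (cls y) = c := by
  rw [colourPart_apply] at h
  split_ifs at h with h'
  · exact ⟨h, h'⟩
  · exact absurd rfl h

theorem monochrome_colourPart (hM : M ∈ digraphAlgebra X) :
    Monochrome κ c (colourPart κ c M) := fun x y h =>
  ⟨mem_digraphAlgebra.1 hM x y (colourPart_ne_zero h).1, (colourPart_ne_zero h).2⟩

theorem sum_colourPart (M : Matrix X X ℂ) : ∑ c, colourPart κ c M = M := by
  ext x y
  rw [Matrix.sum_apply, Finset.sum_eq_single (κ (cls x) (cls y))]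
  · simp [colourPart_apply]
  · intro c _ hc
    simp [colourPart_apply, Ne.symm hc]
  · simp

theorem Monochrome.mem (h : Monochrome κ c M) : M ∈ digraphAlgebra X :=
  mem_digraphAlgebra.2 fun x y hxy => (h x y hxy).1

theorem colourPart_sub (M N : Matrix X X ℂ) :
    colourPart κ c (M - N) = colourPart κ c M - colourPart κ c N := by
  ext x y
  simp only [colourPart_apply, Matrix.sub_apply]
  split_ifs <;> simp

theorem Monochrome.colourPart_eq (h : Monochrome κ c M) :
    colourPart κ d M = if d = c then M else 0 := by
  ext x y
  rw [colourPart_apply]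
  by_cases hM : M x y = 0
  · simp only [hM, ite_self]
    split_ifs <;> simp [hM]
  · rw [(h x y hM).2]
    by_cases hcd : d = c
    · simp [hcd]
    · simp [hcd, Ne.symm hcd]

theorem Monochrome.sub (h : Monochrome κ c M) (h' : Monochrome κ c N) : Monochrome κ c (M - N) := by
  intro x y hxy
  by_cases hM : M x y = 0
  · exact h' x y fun hN => hxy (by simp [hM, hN])
  · exact h x y hM

theorem Monochrome.mul_diag (h : Monochrome κ c M) (hN : N ∈ blockDiag X) :
    Monochrome κ c (M * N) := by
  intro x y hxy
  obtain ⟨k, -, hk⟩ := Finset.exists_ne_zero_of_sum_ne_zero (Matrix.mul_apply (M := M) ▸ hxy)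
  rw [← hN k y (right_ne_zero_of_mul hk)]
  exact h x k (left_ne_zero_of_mul hk)

theorem Monochrome.diag_mul (h : Monochrome κ c M) (hN : N ∈ blockDiag X) :
    Monochrome κ c (N * M) := by
  intro x y hxy
  obtain ⟨k, -, hk⟩ := Finset.exists_ne_zero_of_sum_ne_zero (Matrix.mul_apply (M := N) ▸ hxy)
  rw [hN x k (left_ne_zero_of_mul hk)]
  exact h k y (right_ne_zero_of_mul hk)

theorem colourPart_mul_diag (hN : N ∈ blockDiag X) (M : Matrix X X ℂ) :
    colourPart κ c (M * N) = colourPart κ c M * N := by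
  ext x y
  rw [colourPart_apply, Matrix.mul_apply, Matrix.mul_apply]
  have : ∀ k, colourPart κ c M x k * N k y
      = if κ (cls x) (cls y) = c then M x k * N k y else 0 := by
    intro k
    by_cases h : N k y = 0
    · simp [h]
    · rw [colourPart_apply, hN k y h]
      split_ifs <;> simp
  simp only [this]
  split_ifs <;> simp

/-- A nonzero entry needs two edges of one colour with a common lower vertex; in a matching their
upper vertices agree. -/
theorem Monochrome.star_mul_self (hκ : IsMatchingColouring κ) (h : Monochrome κ c M)
    : star M * M ∈ blockDiag X := by
  intro x y hxy
  obtain ⟨k, -, hk⟩ := Finset.exists_ne_zero_of_sum_ne_zero (Matrix.mul_apply (M := star M) ▸ hxy)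
  rw [Matrix.star_apply] at hk
  have h1 := h k x (star_ne_zero.1 (left_ne_zero_of_mul hk))
  have h2 := h k y (right_ne_zero_of_mul hk)
  exact hκ.1 _ _ _ h1.1 h2.1 (h1.2.trans h2.2.symm)

theorem Monochrome.mul_star_self (hκ : IsMatchingColouring κ) (h : Monochrome κ c M)
    : M * star M ∈ blockDiag X := by
  intro x y hxy
  obtain ⟨k, -, hk⟩ := Finset.exists_ne_zero_of_sum_ne_zero (Matrix.mul_apply (M := M) ▸ hxy)
  rw [Matrix.star_apply] at hk
  have h1 := h x k (left_ne_zero_of_mul hk)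
  have h2 := h y k (star_ne_zero.1 (right_ne_zero_of_mul hk))
  exact hκ.2 _ _ _ h1.1 h2.1 (h1.2.trans h2.2.symm)

theorem norm_colourPart_le (hκ : IsMatchingColouring κ) (hM : M ∈ digraphAlgebra X) :
    ‖colourPart κ c M‖ ≤ ‖M‖ := by
  refine norm_le_of_matching (norm_nonneg _) (fun x y x' y' h h' => ?_) fun a b => ?_
  · have h1 := monochrome_colourPart (κ := κ) (c := c) hM x y h
    have h2 := monochrome_colourPart (κ := κ) (c := c) hM x' y' h'
    constructor
    · intro he
      rw [← he] at h2
      exact hκ.1 _ _ _ h1.1 h2.1 (h1.2.trans h2.2.symm)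
    · intro he
      rw [← he] at h2
      exact hκ.2 _ _ _ h1.1 h2.1 (h1.2.trans h2.2.symm)
  · have : blk a b (colourPart κ c M) = if κ a b = c then blk a b M else 0 := by
      ext x y
      split_ifs with h
      · rw [blk_apply, blk_apply]
        split_ifs with h'
        · rw [colourPart_apply, h'.1, h'.2, if_pos h]
        · rfl
      · rw [blk_apply]
        split_ifs with h'
        · rw [colourPart_apply, h'.1, h'.2, if_neg h]; rfl
        · rfl
    rw [this]
    split_ifs
    · exact norm_blk_le _ _ _
    · simp

/-- An edge of colour `c` up and one of colour `d` down lead to a different class, and the pairs so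
reached form a matching. In such a block square-freeness leaves a single middle class, so the block
is that of `M * star M`, to which `Q` contributes nothing. -/
theorem norm_colourPart_mul_star_le (hX : SquareFree (Reduced X)) (hκ : IsMatchingColouring κ)
    (hM : M ∈ digraphAlgebra X) (hcd : c ≠ d) {Q : Matrix X X ℂ} (hQ : Q ∈ blockDiag X) :
    ‖colourPart κ c M * star (colourPart κ d M)‖ ≤ ‖M * star M - Q‖ := by
  have hS : ∀ {x y : X}, (colourPart κ c M * star (colourPart κ d M)) x y ≠ 0 → ∃ k,
      (cls x ≤ cls k ∧ κ (cls x) (cls k) = c) ∧ (cls y ≤ cls k ∧ κ (cls y) (cls k) = d) := by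
    intro x y h
    obtain ⟨k, -, hk⟩ := Finset.exists_ne_zero_of_sum_ne_zero
      (Matrix.mul_apply (M := colourPart κ c M) ▸ h)
    rw [Matrix.star_apply] at hk
    exact ⟨k, monochrome_colourPart hM x k (left_ne_zero_of_mul hk),
      monochrome_colourPart hM y k (star_ne_zero.1 (right_ne_zero_of_mul hk))⟩
  refine norm_le_of_matching (norm_nonneg _) (fun x y x' y' h h' => ?_) fun a b => ?_
  · obtain ⟨k, h1, h2⟩ := hS h
    obtain ⟨l, h3, h4⟩ := hS h'
    constructor
    · intro he
      rw [← he] at h3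
      have := hκ.1 _ _ _ h1.1 h3.1 (h1.2.trans h3.2.symm)
      rw [← this] at h4
      exact hκ.2 _ _ _ h2.1 h4.1 (h2.2.trans h4.2.symm)
    · intro he
      rw [← he] at h4
      have := hκ.1 _ _ _ h2.1 h4.1 (h2.2.trans h4.2.symm)
      rw [← this] at h3
      exact hκ.2 _ _ _ h1.1 h3.1 (h1.2.trans h3.2.symm)
  · by_cases h0 : blk a b (colourPart κ c M * star (colourPart κ d M)) = 0
    · rw [h0, norm_zero]; exact norm_nonneg _
    obtain ⟨x, y, hxy⟩ : ∃ x y, blk a b (colourPart κ c M * star (colourPart κ d M)) x y ≠ 0 := by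
      by_contra! hc
      exact h0 (by ext i j; exact hc i j)
    rw [blk_apply] at hxy
    split_ifs at hxy with hab
    swap
    · exact absurd rfl hxy
    obtain ⟨k, h1, h2⟩ := hS hxy
    rw [hab.1] at h1
    rw [hab.2] at h2
    have hne : a ≠ b := by
      rintro rfl
      exact hcd (h1.2.symm.trans h2.2)
    have e : blk a b (colourPart κ c M * star (colourPart κ d M)) = blk a b (M * star M - Q) := by
      have hQ0 : blk a b Q = 0 := proj_mul_mul_proj hQ hne
      rw [blk_sub, hQ0, sub_zero]
      ext w w'
      rw [blk_apply, blk_apply]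
      split_ifs with hw
      · rw [Matrix.mul_apply, Matrix.mul_apply]
        refine Finset.sum_congr rfl fun l _ => ?_
        rw [Matrix.star_apply, Matrix.star_apply, colourPart_apply, colourPart_apply, hw.1, hw.2]
        by_cases hl : M w l = 0 ∨ M w' l = 0
        · rcases hl with hl | hl <;> simp [hl]
        · push Not at hl
          have h3 := mem_digraphAlgebra.1 hM w l hl.1
          have h4 := mem_digraphAlgebra.1 hM w' l hl.2
          rw [hw.1] at h3
          rw [hw.2] at h4
          -- The class of `l` is forced to be that of `k`, so both colour conditions hold
          -- automatically for every contributing `l`.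
          rcases hX a b _ _ h1.1 h3 h2.1 h4 with h5 | h5
          · exact absurd h5 hne
          · rw [← h5, if_pos h1.2, if_pos h2.2]
      · rfl
    rw [e]
    exact norm_blk_le _ _ _

theorem norm_star_mul_colourPart_le (hX : SquareFree (Reduced X)) (hκ : IsMatchingColouring κ)
    (hM : M ∈ digraphAlgebra X) (hcd : c ≠ d) {Q : Matrix X X ℂ} (hQ : Q ∈ blockDiag X) :
    ‖star (colourPart κ c M) * colourPart κ d M‖ ≤ ‖star M * M - Q‖ := by
  have hS : ∀ {x y : X}, (star (colourPart κ c M) * colourPart κ d M) x y ≠ 0 → ∃ k,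
      (cls k ≤ cls x ∧ κ (cls k) (cls x) = c) ∧ (cls k ≤ cls y ∧ κ (cls k) (cls y) = d) := by
    intro x y h
    obtain ⟨k, -, hk⟩ := Finset.exists_ne_zero_of_sum_ne_zero
      (Matrix.mul_apply (M := star (colourPart κ c M)) ▸ h)
    rw [Matrix.star_apply] at hk
    exact ⟨k, monochrome_colourPart hM k x (star_ne_zero.1 (left_ne_zero_of_mul hk)),
      monochrome_colourPart hM k y (right_ne_zero_of_mul hk)⟩
  refine norm_le_of_matching (norm_nonneg _) (fun x y x' y' h h' => ?_) fun a b => ?_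
  · obtain ⟨k, h1, h2⟩ := hS h
    obtain ⟨l, h3, h4⟩ := hS h'
    constructor
    · intro he
      rw [← he] at h3
      have := hκ.2 _ _ _ h1.1 h3.1 (h1.2.trans h3.2.symm)
      rw [← this] at h4
      exact hκ.1 _ _ _ h2.1 h4.1 (h2.2.trans h4.2.symm)
    · intro he
      rw [← he] at h4
      have := hκ.2 _ _ _ h2.1 h4.1 (h2.2.trans h4.2.symm)
      rw [← this] at h3
      exact hκ.1 _ _ _ h1.1 h3.1 (h1.2.trans h3.2.symm)
  · by_cases h0 : blk a b (star (colourPart κ c M) * colourPart κ d M) = 0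
    · rw [h0, norm_zero]; exact norm_nonneg _
    obtain ⟨x, y, hxy⟩ : ∃ x y, blk a b (star (colourPart κ c M) * colourPart κ d M) x y ≠ 0 := by
      by_contra! hc
      exact h0 (by ext i j; exact hc i j)
    rw [blk_apply] at hxy
    split_ifs at hxy with hab
    swap
    · exact absurd rfl hxy
    obtain ⟨k, h1, h2⟩ := hS hxy
    rw [hab.1] at h1
    rw [hab.2] at h2
    have hne : a ≠ b := by
      rintro rfl
      exact hcd (h1.2.symm.trans h2.2)
    have e : blk a b (star (colourPart κ c M) * colourPart κ d M) = blk a b (star M * M - Q) := by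
      have hQ0 : blk a b Q = 0 := proj_mul_mul_proj hQ hne
      rw [blk_sub, hQ0, sub_zero]
      ext w w'
      rw [blk_apply, blk_apply]
      split_ifs with hw
      · rw [Matrix.mul_apply, Matrix.mul_apply]
        refine Finset.sum_congr rfl fun l _ => ?_
        rw [Matrix.star_apply, Matrix.star_apply, colourPart_apply, colourPart_apply, hw.1, hw.2]
        by_cases hl : M l w = 0 ∨ M l w' = 0
        · rcases hl with hl | hl <;> simp [hl]
        · push Not at hl
          have h3 := mem_digraphAlgebra.1 hM l w hl.1
          have h4 := mem_digraphAlgebra.1 hM l w' hl.2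
          rw [hw.1] at h3
          rw [hw.2] at h4
          rcases hX _ _ a b h1.1 h2.1 h3 h4 with h5 | h5
          · rw [← h5, if_pos h1.2, if_pos h2.2]
          · exact absurd h5 hne
      · rfl
    rw [e]
    exact norm_blk_le _ _ _

end Colour

end CycleAlgebra

end

noncomputable section

set_option linter.unusedSectionVars false

namespace CycleAlgebra

open scoped Matrix.Norms.L2Operator
open Filter Topology

/-! ## Null sequences -/

section Null

variable {E : ℕ → Type*} [∀ m, NonUnitalNormedRing (E m)]

/-- The sequence tends to zero in norm. -/
def Null (x : ∀ m, E m) : Prop := Tendsto (fun m => ‖x m‖) atTop (𝓝 0)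

/-- The sequence is bounded in norm. -/
def Bdd (x : ∀ m, E m) : Prop := ∃ C, ∀ m, ‖x m‖ ≤ C

variable {x y z w : ∀ m, E m}

theorem Null.of_norm_le {F : ℕ → Type*} [∀ m, NonUnitalNormedRing (F m)] {u : ∀ m, F m}
    (hu : Null u) (h : ∀ m, ‖x m‖ ≤ ‖u m‖) : Null x :=
  squeeze_zero (fun _ => norm_nonneg _) h hu

theorem null_zero : Null (0 : ∀ m, E m) := by
  simp [Null]

theorem Null.add (hx : Null x) (hy : Null y) : Null (x + y) := by
  refine squeeze_zero (fun _ => norm_nonneg _) (fun m => norm_add_le (x m) (y m)) ?_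
  simpa using Tendsto.add hx hy

theorem Null.neg (hx : Null x) : Null (-x) := hx.of_norm_le fun m => (norm_neg (x m)).le

theorem Null.sub (hx : Null x) (hy : Null y) : Null (x - y) := by
  rw [sub_eq_add_neg]; exact hx.add hy.neg

theorem Null.sum {ι : Type*} {s : Finset ι} {u : ι → ∀ m, E m} (h : ∀ i ∈ s, Null (u i)) :
    Null (∑ i ∈ s, u i) := by
  classical
  induction s using Finset.induction_on with
  | empty => simpa using null_zero
  | insert a s ha ih =>
    rw [Finset.sum_insert ha]
    exact (h a (by simp)).add (ih fun i hi => h i (by simp [hi]))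

theorem Null.mul_bdd (hx : Null x) (hy : Bdd y) : Null (x * y) := by
  obtain ⟨C, hC⟩ := hy
  refine squeeze_zero (fun _ => norm_nonneg _)
    (fun m => (norm_mul_le (x m) (y m)).trans (mul_le_mul_of_nonneg_left (hC m) (norm_nonneg _))) ?_
  simpa using Tendsto.mul_const C hx

theorem Null.bdd_mul (hx : Null x) (hy : Bdd y) : Null (y * x) := by
  obtain ⟨C, hC⟩ := hy
  refine squeeze_zero (fun _ => norm_nonneg _)
    (fun m => (norm_mul_le (y m) (x m)).trans (mul_le_mul_of_nonneg_right (hC m) (norm_nonneg _))) ?_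
  simpa using Tendsto.const_mul C hx

theorem Null.bdd (hx : Null x) : Bdd x := by
  obtain ⟨C, hC⟩ := hx.bddAbove_range
  exact ⟨C, fun m => hC ⟨m, rfl⟩⟩

theorem Bdd.add (hx : Bdd x) (hy : Bdd y) : Bdd (x + y) := by
  obtain ⟨C, hC⟩ := hx
  obtain ⟨D, hD⟩ := hy
  exact ⟨C + D, fun m => (norm_add_le (x m) (y m)).trans (add_le_add (hC m) (hD m))⟩

theorem Bdd.mul (hx : Bdd x) (hy : Bdd y) : Bdd (x * y) := by
  obtain ⟨C, hC⟩ := hx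
  obtain ⟨D, hD⟩ := hy
  exact ⟨C * D, fun m => (norm_mul_le (x m) (y m)).trans
    (mul_le_mul (hC m) (hD m) (norm_nonneg _) ((norm_nonneg _).trans (hC m)))⟩

theorem Bdd.sum {ι : Type*} {s : Finset ι} {u : ι → ∀ m, E m} (h : ∀ i ∈ s, Bdd (u i)) :
    Bdd (∑ i ∈ s, u i) := by
  classical
  induction s using Finset.induction_on with
  | empty => exact null_zero.bdd
  | insert a s ha ih =>
    rw [Finset.sum_insert ha]
    exact (h a (by simp)).add (ih fun i hi => h i (by simp [hi]))

theorem Null.mul_sub_mul (h : Null (x - y)) (h' : Null (z - w)) (hy : Bdd y) (hz : Bdd z) :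
    Null (x * z - y * w) := by
  have : x * z - y * w = (x - y) * z + y * (z - w) := by noncomm_ring
  rw [this]
  exact (h.mul_bdd hz).add (h'.bdd_mul hy)

theorem Null.of_sub (h : Null (x - y)) (hy : Null y) : Null x := by
  simpa using h.add hy

theorem Bdd.of_null_sub (h : Null (x - y)) (hy : Bdd y) : Bdd x := by
  simpa using h.bdd.add hy

theorem Null.eventually_lt (hx : Null x) {ε : ℝ} (hε : 0 < ε) : ∀ᶠ m in atTop, ‖x m‖ < ε :=
  (tendsto_order.1 hx).2 ε hε

variable [∀ m, StarRing (E m)] [∀ m, NormedStarGroup (E m)]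

theorem Null.star (hx : Null x) : Null (star x) := hx.of_norm_le fun m => (norm_star (x m)).le

theorem Bdd.star (hx : Bdd x) : Bdd (star x) := by
  obtain ⟨C, hC⟩ := hx
  exact ⟨C, fun m => (norm_star (x m)).trans_le (hC m)⟩

end Null

/-! ## Orthogonalisation of approximate partial isometries -/

section Orthogonalisation

variable {X : Type*} [Preorder X] [Fintype X] [DecidableEq X]

/-- Here `p` and `q` are the initial and final supports already used up. After cutting `A` by their
complements, the correction `g` commutes with everything that commutes with the modulus: with each
`proj`, so the colour is kept, and with `1 - p`, so orthogonality is kept. -/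
theorem exists_orthogonal_partialIsometry {κ : Reduced X → Reduced X → Fin 3} {c : Fin 3}
    (hκ : IsMatchingColouring κ) {A p q : Matrix X X ℂ} (hA : Monochrome κ c A)
    (hp : p ∈ blockDiag X) (hq : q ∈ blockDiag X) (hpp : p * p = p) (hps : star p = p) :
    ∃ w, Monochrome κ c w ∧ w * star w * w = w ∧
      (∀ v, star v * (1 - q) = 0 → (1 - p) * star v = 0 → Orthogonal v w) ∧
      ∀ M, M = (1 - q) * A * (1 - p) → ‖M * star M * M - M‖ < 1 / 8 →
        ‖w - M‖ ≤ 2 * ‖M * star M * M - M‖ := by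
  set M := (1 - q) * A * (1 - p) with hM
  have hMm : Monochrome κ c M :=
    (hA.diag_mul (sub_mem (one_mem _) hq)).mul_diag (sub_mem (one_mem _) hp)
  have e1 : M * (1 - p) = M := by
    rw [hM, mul_assoc, mul_sub (1 - p), sub_mul 1 p p, hpp]; simp
  have e2 : (1 - p) * star M = star M := by
    have := congrArg star e1
    simpa [hps] using this
  obtain ⟨g, hg, hpi, hclose⟩ := exists_correction M
  have hgd : g ∈ blockDiag X := by
    refine mem_blockDiag_of_commute fun a => hg _ ?_
    exact commute_proj (hMm.star_mul_self hκ) a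
  refine ⟨M * g, hMm.mul_diag hgd, hpi, fun v hv hv' => Orthogonal.symm ⟨?_, ?_⟩, ?_⟩
  · have : star v * (M * g) = 0 := by
      rw [hM]
      calc star v * ((1 - q) * A * (1 - p) * g) = (star v * (1 - q)) * A * (1 - p) * g := by
            noncomm_ring
        _ = 0 := by rw [hv]; simp
    simpa using congrArg star this
  · have hc : (1 - p) * g = g * (1 - p) := by
      refine hg (1 - p) ?_
      show (1 - p) * (star M * M) = star M * M * (1 - p)
      rw [← mul_assoc, e2, mul_assoc, e1]
    calc M * g * star v = M * (1 - p) * g * star v := by rw [e1]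
      _ = M * (g * (1 - p)) * star v := by rw [← hc]; noncomm_ring
      _ = M * g * ((1 - p) * star v) := by noncomm_ring
      _ = 0 := by rw [hv', mul_zero]
  · rintro _ rfl h
    exact hclose h

theorem sum_star_mul_orthogonal {ι : Type*} {w : ι → Matrix X X ℂ} {s : Finset ι}
    (hw : ∀ i ∈ s, w i * star (w i) * w i = w i)
    (ho : ∀ i ∈ s, ∀ j ∈ s, i ≠ j → Orthogonal (w i) (w j)) {j : ι} (hj : j ∈ s) :
    (∑ i ∈ s, star (w i) * w i) * star (w j) = star (w j) := by
  rw [Finset.sum_mul, Finset.sum_eq_single j]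
  · exact star_mul_star_mul (hw j hj)
  · intro i hi hij
    rw [mul_assoc, (ho i hi j hj hij).2, mul_zero]
  · exact fun h => absurd hj h

theorem star_mul_sum_orthogonal {ι : Type*} {w : ι → Matrix X X ℂ} {s : Finset ι}
    (hw : ∀ i ∈ s, w i * star (w i) * w i = w i)
    (ho : ∀ i ∈ s, ∀ j ∈ s, i ≠ j → Orthogonal (w i) (w j)) {j : ι} (hj : j ∈ s) :
    star (w j) * (∑ i ∈ s, w i * star (w i)) = star (w j) := by
  rw [Finset.mul_sum, Finset.sum_eq_single j]
  · rw [← mul_assoc]; exact star_mul_star_mul (hw j hj)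
  · intro i hi hij
    rw [← mul_assoc, (ho j hj i hi (Ne.symm hij)).1, zero_mul]
  · exact fun h => absurd hj h

variable {V : ℕ → Type} [∀ m, Fintype (V m)] [∀ m, DecidableEq (V m)] [∀ m, Preorder (V m)]

/-- Gram–Schmidt by induction on the finite set: near-orthogonality makes the cut by the supports of
the earlier lifts a null change, and the cut sequence is then corrected to partial isometries of the
same colour. -/
theorem exists_orthogonal_lift {J : Type*} {κ : ∀ m, Reduced (V m) → Reduced (V m) → Fin 3}
    (hκ : ∀ m, IsMatchingColouring (κ m)) {col : J → Fin 3}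
    {A : J → ∀ m, Matrix (V m) (V m) ℂ} (hA : ∀ j m, Monochrome (κ m) (col j) (A j m))
    (hb : ∀ j, Bdd (A j)) (hpi : ∀ j, Null (A j * star (A j) * A j - A j))
    (ho : ∀ i j, i ≠ j → Null (star (A i) * A j) ∧ Null (A i * star (A j))) (s : Finset J) :
    ∃ w : J → ∀ m, Matrix (V m) (V m) ℂ,
      (∀ j ∈ s, ∀ m, Monochrome (κ m) (col j) (w j m) ∧ w j m * star (w j m) * w j m = w j m) ∧
      (∀ j ∈ s, Null (w j - A j)) ∧
      ∀ i ∈ s, ∀ j ∈ s, i ≠ j → ∀ m, Orthogonal (w i m) (w j m) := by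
  classical
  induction s using Finset.induction_on with
  | empty => exact ⟨fun _ _ => 0, by simp⟩
  | insert a s ha ih =>
    obtain ⟨w, hw, hn, hwo⟩ := ih
    set p : ∀ m, Matrix (V m) (V m) ℂ := ∑ i ∈ s, star (w i) * w i with hp
    set q : ∀ m, Matrix (V m) (V m) ℂ := ∑ i ∈ s, w i * star (w i) with hq
    have hpm : ∀ m, p m = ∑ i ∈ s, star (w i m) * w i m := fun m => by
      rw [hp, Finset.sum_apply]; rfl
    have hqm : ∀ m, q m = ∑ i ∈ s, w i m * star (w i m) := fun m => by
      rw [hq, Finset.sum_apply]; rfl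
    have hwb : ∀ i ∈ s, Bdd (w i) := fun i hi => Bdd.of_null_sub (hn i hi) (hb i)
    have hpb : Bdd p := Bdd.sum fun i hi => (hwb i hi).star.mul (hwb i hi)
    have hqb : Bdd q := Bdd.sum fun i hi => (hwb i hi).mul (hwb i hi).star
    have hap : Null (A a * p) := by
      rw [hp, Finset.mul_sum]
      refine Null.sum fun i hi => ?_
      rw [← mul_assoc]
      refine Null.mul_bdd ?_ (hwb i hi)
      refine Null.of_sub (y := A a * star (A i)) ?_ (ho a i (fun h => ha (h ▸ hi))).2
      rw [← mul_sub, ← star_sub]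
      exact (hn i hi).star.bdd_mul (hb a)
    have hqa : Null (q * A a) := by
      rw [hq, Finset.sum_mul]
      refine Null.sum fun i hi => ?_
      rw [mul_assoc]
      refine Null.bdd_mul ?_ (hwb i hi)
      refine Null.of_sub (y := star (A i) * A a) ?_ (ho i a (fun h => ha (h ▸ hi))).1
      rw [← sub_mul, ← star_sub]
      exact (hn i hi).star.mul_bdd (hb a)
    set M : ∀ m, Matrix (V m) (V m) ℂ := (1 - q) * A a * (1 - p) with hM
    have hMA : Null (M - A a) := by
      have : M - A a = q * (A a * p) - A a * p - q * A a := by rw [hM]; noncomm_ring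
      rw [this]
      exact ((hap.bdd_mul hqb).sub hap).sub hqa
    have hMb : Bdd M := Bdd.of_null_sub hMA (hb a)
    have hMpi : Null (M * star M * M - M) := by
      have h1 : Null (M * star M * M - A a * star (A a) * A a) :=
        (hMA.mul_sub_mul (by rw [← star_sub]; exact hMA.star) (hb a) hMb.star).mul_sub_mul hMA
          ((hb a).mul (hb a).star) hMb
      have := (h1.add (hpi a)).sub hMA
      refine this.of_norm_le fun m => le_of_eq ?_
      congr 1
      simp only [Pi.sub_apply, Pi.add_apply]
      abel
    have hpd : ∀ m, p m ∈ blockDiag (V m) := fun m => by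
      rw [hpm]
      exact sum_mem fun i hi => (hw i hi m).1.star_mul_self (hκ m)
    have hqd : ∀ m, q m ∈ blockDiag (V m) := fun m => by
      rw [hqm]
      exact sum_mem fun i hi => (hw i hi m).1.mul_star_self (hκ m)
    have e1 : ∀ i ∈ s, ∀ m, p m * star (w i m) = star (w i m) := fun i hi m => by
      rw [hpm]
      exact sum_star_mul_orthogonal (w := fun i => w i m) (fun i hi => (hw i hi m).2)
        (fun i hi j hj h => hwo i hi j hj h m) hi
    have e2 : ∀ i ∈ s, ∀ m, star (w i m) * q m = star (w i m) := fun i hi m => by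
      rw [hqm]
      exact star_mul_sum_orthogonal (w := fun i => w i m) (fun i hi => (hw i hi m).2)
        (fun i hi j hj h => hwo i hi j hj h m) hi
    have hpp : ∀ m, p m * p m = p m := fun m => by
      conv_lhs => rw [hpm m, ← hpm m, hpm m, ← hpm m]
      have : p m * ∑ i ∈ s, star (w i m) * w i m = ∑ i ∈ s, star (w i m) * w i m := by
        rw [Finset.mul_sum]
        exact Finset.sum_congr rfl fun i hi => by rw [← mul_assoc, e1 i hi m]
      rwa [← hpm m] at this
    have hps : ∀ m, star (p m) = p m := fun m => by
      rw [hpm m, star_sum]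
      simp
    choose u hu1 hu2 hu3 hu4 using fun m => exists_orthogonal_partialIsometry (hκ m) (hA a m)
      (hpd m) (hqd m) (hpp m) (hps m)
    have huo : ∀ i ∈ s, ∀ m, Orthogonal (w i m) (u m) := fun i hi m => hu3 m _
      (by rw [mul_sub, e2 i hi m]; simp) (by rw [sub_mul, e1 i hi m]; simp)
    have hue : ∀ i ∈ s, Function.update w a u i = w i := fun i hi =>
      Function.update_of_ne (fun h : i = a => ha (h ▸ hi)) _ _
    refine ⟨Function.update w a u, ?_, ?_, ?_⟩
    · intro j hj m
      rcases Finset.mem_insert.1 hj with rfl | hj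
      · rw [Function.update_self]; exact ⟨hu1 m, hu2 m⟩
      · rw [hue j hj]; exact hw j hj m
    · intro j hj
      rcases Finset.mem_insert.1 hj with rfl | hj
      · rw [Function.update_self]
        have h1 : Null (u - M) := by
          have h2 : Tendsto (fun m => 2 * ‖(M * star M * M - M) m‖) atTop (𝓝 0) := by
            simpa using Tendsto.const_mul 2 hMpi
          -- The correction is close to `M` only once the defect is below 1/8; the finitely many
          -- earlier stages do not matter.
          refine squeeze_zero' (Eventually.of_forall fun m => norm_nonneg _) ?_ h2
          filter_upwards [hMpi.eventually_lt (show (0 : ℝ) < 1 / 8 by norm_num)] with m hm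
          exact hu4 m (M m) rfl hm
        have := h1.add hMA
        rwa [sub_add_sub_cancel] at this
      · rw [hue j hj]; exact hn j hj
    · intro i hi j hj hij m
      rcases Finset.mem_insert.1 hi with rfl | hi'
      · rcases Finset.mem_insert.1 hj with rfl | hj'
        · exact absurd rfl hij
        · rw [Function.update_self, hue j hj']
          exact (huo j hj' m).symm
      · rcases Finset.mem_insert.1 hj with rfl | hj'
        · rw [Function.update_self, hue i hi']
          exact huo i hi' m
        · rw [hue i hi', hue j hj']
          exact hwo i hi' j hj' hij m

end Orthogonalisation

end CycleAlgebra

end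

noncomputable section

set_option linter.unusedSectionVars false

namespace CycleAlgebra

open scoped Matrix.Norms.L2Operator
open Filter Topology

/-! ## Normalising partial isometries near approximate ones -/

section Lift

section

variable {X : Type*} [Preorder X] [Fintype X] [DecidableEq X]
  {κ : Reduced X → Reduced X → Fin 3} {c : Fin 3} {M N : Matrix X X ℂ}

theorem colourPart_diag_mul (hN : N ∈ blockDiag X) (M : Matrix X X ℂ) :
    colourPart κ c (N * M) = N * colourPart κ c M := by
  ext x y
  rw [colourPart_apply, Matrix.mul_apply, Matrix.mul_apply]
  have : ∀ k, N x k * colourPart κ c M k y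
      = if κ (cls x) (cls y) = c then N x k * M k y else 0 := by
    intro k
    by_cases h : N x k = 0
    · simp [h]
    · rw [colourPart_apply, hN x k h]
      split_ifs <;> simp
  simp only [this]
  split_ifs <;> simp

theorem colourPart_sum {ι : Type*} (s : Finset ι) (f : ι → Matrix X X ℂ) :
    colourPart κ c (∑ i ∈ s, f i) = ∑ i ∈ s, colourPart κ c (f i) := by
  ext x y
  simp only [colourPart_apply, Matrix.sum_apply]
  split_ifs <;> simp

theorem Monochrome.isNormalizing (hκ : IsMatchingColouring κ) (h : Monochrome κ c M)
    (hM : M * star M * M = M) : IsNormalizing M :=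
  ⟨h.mem, hM, h.star_mul_self hκ, h.mul_star_self hκ⟩

end

variable {V : ℕ → Type} [∀ m, Fintype (V m)] [∀ m, DecidableEq (V m)] [∀ m, Preorder (V m)]

variable (κ : ∀ m, Reduced (V m) → Reduced (V m) → Fin 3)

/-- The components of a colour of a sequence of matrices. -/
def colourSeq (c : Fin 3) (A : ∀ m, Matrix (V m) (V m) ℂ) : ∀ m, Matrix (V m) (V m) ℂ :=
  fun m => colourPart (κ m) c (A m)

variable {κ} {A P Q : ∀ m, Matrix (V m) (V m) ℂ} {c d : Fin 3}

theorem sum_colourSeq (A : ∀ m, Matrix (V m) (V m) ℂ) : ∑ c, colourSeq κ c A = A := by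
  funext m
  rw [Finset.sum_apply]
  exact sum_colourPart (A m)

theorem bdd_colourSeq (hκ : ∀ m, IsMatchingColouring (κ m)) (hA : ∀ m, A m ∈ digraphAlgebra (V m))
    (hb : Bdd A) : Bdd (colourSeq κ c A) := by
  obtain ⟨C, hC⟩ := hb
  exact ⟨C, fun m => (norm_colourPart_le (hκ m) (hA m)).trans (hC m)⟩

theorem null_colourSeq (hκ : ∀ m, IsMatchingColouring (κ m)) (hA : ∀ m, A m ∈ digraphAlgebra (V m))
    (hb : Null A) : Null (colourSeq κ c A) :=
  hb.of_norm_le fun m => norm_colourPart_le (hκ m) (hA m)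

theorem null_mul_colourSeq_sub (hκ : ∀ m, IsMatchingColouring (κ m))
    (hA : ∀ m, A m ∈ digraphAlgebra (V m)) (hQ : ∀ m, Q m ∈ blockDiag (V m))
    (h : Null (Q * A - A)) : Null (Q * colourSeq κ c A - colourSeq κ c A) := by
  have := null_colourSeq (c := c) hκ (fun m => (digraphAlgebra (V m)).sub_mem
    ((digraphAlgebra (V m)).mul_mem (blockDiag_le (hQ m)) (hA m)) (hA m)) h
  convert this using 1
  funext m
  simp only [colourSeq, Pi.sub_apply, Pi.mul_apply, colourPart_sub, colourPart_diag_mul (hQ m)]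

theorem null_colourSeq_mul_sub (hκ : ∀ m, IsMatchingColouring (κ m))
    (hA : ∀ m, A m ∈ digraphAlgebra (V m)) (hP : ∀ m, P m ∈ blockDiag (V m))
    (h : Null (A * P - A)) : Null (colourSeq κ c A * P - colourSeq κ c A) := by
  have := null_colourSeq (c := c) hκ (fun m => (digraphAlgebra (V m)).sub_mem
    ((digraphAlgebra (V m)).mul_mem (hA m) (blockDiag_le (hP m))) (hA m)) h
  convert this using 1
  funext m
  simp only [colourSeq, Pi.sub_apply, Pi.mul_apply, colourPart_sub, colourPart_mul_diag (hP m)]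

theorem null_colourSeq_mul_star (hX : ∀ m, SquareFree (Reduced (V m)))
    (hκ : ∀ m, IsMatchingColouring (κ m)) (hA : ∀ m, A m ∈ digraphAlgebra (V m))
    (hQ : ∀ m, Q m ∈ blockDiag (V m)) (h : Null (A * star A - Q)) (hcd : c ≠ d) :
    Null (colourSeq κ c A * star (colourSeq κ d A)) :=
  h.of_norm_le fun m => norm_colourPart_mul_star_le (hX m) (hκ m) (hA m) hcd (hQ m)

theorem null_star_mul_colourSeq (hX : ∀ m, SquareFree (Reduced (V m)))
    (hκ : ∀ m, IsMatchingColouring (κ m)) (hA : ∀ m, A m ∈ digraphAlgebra (V m))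
    (hP : ∀ m, P m ∈ blockDiag (V m)) (h : Null (star A * A - P)) (hcd : c ≠ d) :
    Null (star (colourSeq κ c A) * colourSeq κ d A) :=
  h.of_norm_le fun m => norm_star_mul_colourPart_le (hX m) (hκ m) (hA m) hcd (hP m)

/-- Products of different colours are null, so the defect of `A` is asymptotically the sum of the
defects of its colour components. The defect of each component has that component's colour, and
extracting a colour is contractive. -/
theorem null_colourSeq_partialIsometry (hX : ∀ m, SquareFree (Reduced (V m)))
    (hκ : ∀ m, IsMatchingColouring (κ m)) (hA : ∀ m, A m ∈ digraphAlgebra (V m)) (hb : Bdd A)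
    (hP : ∀ m, P m ∈ blockDiag (V m)) (hAP : Null (star A * A - P))
    (hQ : ∀ m, Q m ∈ blockDiag (V m)) (hAQ : Null (A * star A - Q))
    (h : Null (A * star A * A - A)) :
    Null (colourSeq κ c A * star (colourSeq κ c A) * colourSeq κ c A - colourSeq κ c A) := by
  set B := fun c => colourSeq κ c A with hB
  have hBb : ∀ c, Bdd (B c) := fun c => bdd_colourSeq hκ hA hb
  have hBm : ∀ c m, Monochrome (κ m) c (B c m) := fun c m => monochrome_colourPart (hA m)
  have h1 : ∀ c, Null (star (B c) * A - star (B c) * B c) := fun c => by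
    have : star (B c) * A - star (B c) * B c = ∑ d ∈ Finset.univ.erase c, star (B c) * B d := by
      rw [Finset.sum_erase_eq_sub (Finset.mem_univ c), ← Finset.mul_sum, hB, sum_colourSeq]
    rw [this]
    exact Null.sum fun d hd => null_star_mul_colourSeq hX hκ hA hP hAP (Finset.ne_of_mem_erase hd).symm
  have h2 : ∀ c, Null (B c * star A - B c * star (B c)) := fun c => by
    have : B c * star A - B c * star (B c) = ∑ d ∈ Finset.univ.erase c, B c * star (B d) := by
      rw [Finset.sum_erase_eq_sub (Finset.mem_univ c), ← Finset.mul_sum, ← star_sum, hB,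
        sum_colourSeq]
    rw [this]
    exact Null.sum fun d hd => null_colourSeq_mul_star hX hκ hA hQ hAQ (Finset.ne_of_mem_erase hd).symm
  have h3 : Null (∑ c, (B c * star (B c) * B c - B c)) := by
    have h4 : ∀ c ∈ Finset.univ, Null (B c * star A * A - B c * star (B c) * B c) := fun c _ => by
      have e : B c * star A * A - B c * star (B c) * B c
          = (B c * star A - B c * star (B c)) * A
            + B c * (star (B c) * A - star (B c) * B c) := by noncomm_ring
      rw [e]
      exact ((h2 c).mul_bdd hb).add ((h1 c).bdd_mul (hBb c))
    have e : ∑ c, (B c * star (B c) * B c - B c)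
        = (A * star A * A - A) - ∑ c, (B c * star A * A - B c * star (B c) * B c) := by
      have e1 : ∑ c, B c = A := sum_colourSeq A
      rw [Finset.sum_sub_distrib, Finset.sum_sub_distrib, ← Finset.sum_mul, ← Finset.sum_mul, e1]
      abel
    rw [e]
    exact h.sub (Null.sum h4)
  have hmono : ∀ c m, Monochrome (κ m) c ((B c * star (B c) * B c - B c) m) := fun c m =>
    ((hBm c m).diag_mul ((hBm c m).mul_star_self (hκ m))).sub (hBm c m)
  have h5 := null_colourSeq (c := c) hκ (fun m => by
    rw [Finset.sum_apply]
    exact sum_mem fun c _ => (hmono c m).mem) h3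
  convert h5 using 1
  funext m
  rw [colourSeq, Finset.sum_apply, colourPart_sum, Finset.sum_eq_single c]
  · rw [(hmono c m).colourPart_eq, if_pos rfl]
  · intro d _ hd
    rw [(hmono d m).colourPart_eq, if_neg (Ne.symm hd)]
  · simp

/-- All colour components of all `A i` are orthogonalised together, and the lift of `A i` is the sum
over its colours. Different colours are nearly orthogonal by square-freeness, and different indices
because the diagonal approximants `P i` and `Q i` are. -/
theorem exists_isNormalizing_lift {ι : Type*} [Finite ι] (hX : ∀ m, SquareFree (Reduced (V m)))
    (hκ : ∀ m, IsMatchingColouring (κ m)) {A P Q : ι → ∀ m, Matrix (V m) (V m) ℂ}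
    (hA : ∀ i m, A i m ∈ digraphAlgebra (V m)) (hb : ∀ i, Bdd (A i))
    (hpi : ∀ i, Null (A i * star (A i) * A i - A i))
    (hP : ∀ i m, P i m ∈ blockDiag (V m)) (hAP : ∀ i, Null (star (A i) * A i - P i))
    (hQ : ∀ i m, Q i m ∈ blockDiag (V m)) (hAQ : ∀ i, Null (A i * star (A i) - Q i))
    (ho : ∀ i j, i ≠ j → Null (star (A i) * A j) ∧ Null (A i * star (A j))) :
    ∃ w : ι → ∀ m, Matrix (V m) (V m) ℂ, (∀ i m, IsNormalizing (w i m)) ∧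
      (∀ i, Null (w i - A i)) ∧ ∀ i j, i ≠ j → ∀ m, Orthogonal (w i m) (w j m) := by
  classical
  have := Fintype.ofFinite ι
  have hPb : ∀ i, Bdd (P i) := fun i =>
    Bdd.of_null_sub (y := star (A i) * A i) (by simpa using (hAP i).neg) ((hb i).star.mul (hb i))
  have hQb : ∀ i, Bdd (Q i) := fun i =>
    Bdd.of_null_sub (y := A i * star (A i)) (by simpa using (hAQ i).neg) ((hb i).mul (hb i).star)
  have hBb : ∀ i c, Bdd (colourSeq κ c (A i)) := fun i c => bdd_colourSeq hκ (hA i) (hb i)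
  have hQA : ∀ i, Null (Q i * A i - A i) := fun i => by
    have e : Q i * A i - A i = (A i * star (A i) * A i - A i) - (A i * star (A i) - Q i) * A i := by
      noncomm_ring
    rw [e]
    exact (hpi i).sub ((hAQ i).mul_bdd (hb i))
  have hAPs : ∀ i, Null (A i * P i - A i) := fun i => by
    have e : A i * P i - A i = (A i * star (A i) * A i - A i) - A i * (star (A i) * A i - P i) := by
      noncomm_ring
    rw [e]
    exact (hpi i).sub ((hAP i).bdd_mul (hb i))
  have hPP : ∀ i j, i ≠ j → Null (P i * star (P j)) := fun i j hij => by
    have e : P i * star (P j) = star (A i) * (A i * star (A j)) * A j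
        - ((star (A i) * A i - P i) * (star (A j) * A j)
        + P i * star (star (A j) * A j - P j)) := by
      rw [star_sub, star_mul, star_star]; noncomm_ring
    rw [e]
    exact (((ho i j hij).2.bdd_mul (hb i).star).mul_bdd (hb j)).sub
      (((hAP i).mul_bdd ((hb j).star.mul (hb j))).add ((hAP j).star.bdd_mul (hPb i)))
  have hQQ : ∀ i j, i ≠ j → Null (star (Q i) * Q j) := fun i j hij => by
    have e : star (Q i) * Q j = A i * (star (A i) * A j) * star (A j)
        - ((A i * star (A i)) * (A j * star (A j) - Q j)
        + star (A i * star (A i) - Q i) * Q j) := by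
      rw [star_sub, star_mul, star_star]; noncomm_ring
    rw [e]
    exact (((ho i j hij).1.bdd_mul (hb i)).mul_bdd (hb j).star).sub
      (((hAQ j).bdd_mul ((hb i).mul (hb i).star)).add ((hAQ i).star.mul_bdd (hQb j)))
  obtain ⟨w, hw, hn, hwo⟩ := exists_orthogonal_lift (J := ι × Fin 3) (col := Prod.snd) hκ
    (A := fun j => colourSeq κ j.2 (A j.1)) (fun j m => monochrome_colourPart (hA j.1 m))
    (fun j => hBb _ _)
    (fun j => null_colourSeq_partialIsometry hX hκ (hA _) (hb _) (hP _) (hAP _) (hQ _) (hAQ _)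
      (hpi _))
    (by
      rintro ⟨i, c⟩ ⟨j, d⟩ hne
      by_cases hij : i = j
      · subst hij
        have hcd : c ≠ d := fun h => hne (by rw [h])
        exact ⟨null_star_mul_colourSeq hX hκ (hA i) (hP i) (hAP i) hcd,
          null_colourSeq_mul_star hX hκ (hA i) (hQ i) (hAQ i) hcd⟩
      · constructor
        -- Multiplication by the block diagonal `Q i` respects colours, so each colour component
        -- inherits `Q i * A i ≈ A i`; near-orthogonality of the `Q i` does the rest.
        · have h1 := null_mul_colourSeq_sub (c := c) hκ (hA i) (hQ i) (hQA i)
          have h2 := null_mul_colourSeq_sub (c := d) hκ (hA j) (hQ j) (hQA j)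
          have e : star (colourSeq κ c (A i)) * colourSeq κ d (A j)
              = star (colourSeq κ c (A i)) * (star (Q i) * Q j) * colourSeq κ d (A j)
              - (star (Q i * colourSeq κ c (A i) - colourSeq κ c (A i)) * (Q j * colourSeq κ d (A j))
              + star (colourSeq κ c (A i)) * (Q j * colourSeq κ d (A j) - colourSeq κ d (A j))) := by
            rw [star_sub, star_mul]; noncomm_ring
          simp only
          rw [e]
          exact (((hQQ i j hij).bdd_mul (hBb _ _).star).mul_bdd (hBb _ _)).sub
            ((h1.star.mul_bdd ((hQb j).mul (hBb _ _))).add (h2.bdd_mul (hBb _ _).star))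
        · have h1 := null_colourSeq_mul_sub (c := c) hκ (hA i) (hP i) (hAPs i)
          have h2 := null_colourSeq_mul_sub (c := d) hκ (hA j) (hP j) (hAPs j)
          have e : colourSeq κ c (A i) * star (colourSeq κ d (A j))
              = colourSeq κ c (A i) * (P i * star (P j)) * star (colourSeq κ d (A j))
              - ((colourSeq κ c (A i) * P i - colourSeq κ c (A i)) * star (colourSeq κ d (A j) * P j)
              + colourSeq κ c (A i) * star (colourSeq κ d (A j) * P j - colourSeq κ d (A j))) := by
            rw [star_sub, star_mul]; noncomm_ring
          simp only
          rw [e]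
          exact (((hPP i j hij).bdd_mul (hBb _ _)).mul_bdd (hBb _ _).star).sub
            ((h1.mul_bdd ((hBb _ _).mul (hPb j)).star).add (h2.star.bdd_mul (hBb _ _))))
    Finset.univ
  have hwn : ∀ j m, IsNormalizing (w j m) := fun j m =>
    (hw j (Finset.mem_univ _) m).1.isNormalizing (hκ m) (hw j (Finset.mem_univ _) m).2
  have hwo' : ∀ i j, i ≠ j → ∀ m, Orthogonal (w i m) (w j m) := fun i j =>
    hwo i (Finset.mem_univ _) j (Finset.mem_univ _)
  refine ⟨fun i => ∑ c, w (i, c), fun i m => ?_, fun i => ?_, fun i j hij m => ?_⟩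
  · simp only [Finset.sum_apply]
    exact isNormalizing_sum (w := fun c => w (i, c) m) (fun c _ => hwn _ m)
      fun c _ d _ hcd => hwo' _ _ (fun h => hcd (congrArg Prod.snd h)) m
  · have e : ∑ c, w (i, c) - A i = ∑ c, (w (i, c) - colourSeq κ c (A i)) := by
      rw [Finset.sum_sub_distrib, sum_colourSeq]
    rw [e]
    exact Null.sum fun c _ => hn (i, c) (Finset.mem_univ _)
  · simp only [Finset.sum_apply]
    refine orthogonal_sum_left fun c _ => Orthogonal.symm (orthogonal_sum_left fun d _ => ?_)
    exact hwo' _ _ (fun h => hij (congrArg Prod.fst h).symm) m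

end Lift

end CycleAlgebra

end

noncomputable section

set_option linter.unusedSectionVars false

namespace CycleAlgebra

open scoped Matrix.Norms.L2Operator
open Filter Topology

/-! ## Representations of digraph algebras -/

section Representation

variable {B : Type*} [NonUnitalCStarAlgebra B] {𝒜 : NonUnitalSubalgebra ℂ B}

instance isClosed_generatedCStar {E : Type*} [NonUnitalCStarAlgebra E]
    (A : NonUnitalSubalgebra ℂ E) : IsClosed (generatedCStar A : Set E) :=
  NonUnitalStarSubalgebra.isClosed_topologicalClosure _

instance isClosed_generatedCStar_digraphAlgebra {X : Type*} [Preorder X] [Fintype X]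
    [DecidableEq X] : IsClosed (generatedCStar (digraphAlgebra X) : Set (Matrix X X ℂ)) :=
  NonUnitalStarSubalgebra.isClosed_topologicalClosure _

/-- Injectivity is known on `A` only. A nonzero `x` in the kernel on `C*(A)` can be compressed by
diagonal units to a multiple of a matrix unit, and this puts some `e_{ii}`, an element of `A`, in
the kernel. An injective star homomorphism is isometric. -/
theorem IsStarExtendible.exists_isometry {X : Type*} [Preorder X] [Fintype X] [DecidableEq X]
    {ι : digraphAlgebra X →ₙₐ[ℂ] 𝒜} (hι : IsStarExtendible ι) (hinj : Function.Injective ι) :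
    ∃ Ψ : generatedCStar (digraphAlgebra X) →⋆ₙₐ[ℂ] B,
      (∀ a : digraphAlgebra X, Ψ ⟨a, mem_generatedCStar _ a⟩ = ι a) ∧ ∀ x, ‖Ψ x‖ = ‖x‖ := by
  obtain ⟨Φ, hΦ⟩ := hι
  refine ⟨(NonUnitalStarSubalgebraClass.subtype (generatedCStar 𝒜)).comp Φ, hΦ,
    NonUnitalStarAlgHom.norm_map _ ?_⟩
  set Ψ := (NonUnitalStarSubalgebraClass.subtype (generatedCStar 𝒜)).comp Φ
  have hΨ : ∀ a : digraphAlgebra X, Ψ ⟨a, mem_generatedCStar _ a⟩ = ι a := hΦ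
  rw [injective_iff_map_eq_zero]
  intro x hx
  by_contra hne
  obtain ⟨i, j, hij⟩ : ∃ i j, (x : Matrix X X ℂ) i j ≠ 0 := by
    by_contra! hc
    exact hne (Subtype.ext (by ext i j; exact hc i j))
  set e : X → generatedCStar (digraphAlgebra X) := fun i =>
    ⟨diagUnit i, mem_generatedCStar _ (diagUnit i)⟩
  set y := e i * x * e j with hy
  have hy0 : Ψ (y * star y) = 0 := by
    rw [map_mul, hy, map_mul, map_mul, hx]; simp
  have e1 : y * star y = ((x : Matrix X X ℂ) i j * star ((x : Matrix X X ℂ) i j)) • e i := by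
    apply Subtype.ext
    show (Matrix.single i i 1 * (x : Matrix X X ℂ) * Matrix.single j j 1)
      * star (Matrix.single i i 1 * (x : Matrix X X ℂ) * Matrix.single j j 1) = _ • Matrix.single i i 1
    have e2 : (Matrix.single i i 1 * (x : Matrix X X ℂ) * Matrix.single j j 1)
        = Matrix.single i j ((x : Matrix X X ℂ) i j) := by
      rw [Matrix.single_mul_mul_single]; simp
    rw [e2]
    simp
  rw [e1, map_smul, hΨ, smul_eq_zero] at hy0
  rcases hy0 with h | h
  · simp [hij] at h
  · have h1 : diagUnit i = 0 := hinj (by rw [map_zero]; exact Subtype.ext h)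
    have h2 := congrFun (congrFun (congrArg Subtype.val h1) i) i
    simp [diagUnit] at h2

variable {V : ℕ → Type} [∀ m, Fintype (V m)] [∀ m, DecidableEq (V m)] [∀ m, Preorder (V m)]

/-- The images of the matrices of the sequence converge. -/
def Conv (Ψ : ∀ m, generatedCStar (digraphAlgebra (V m)) →⋆ₙₐ[ℂ] B)
    (M : ∀ m, Matrix (V m) (V m) ℂ) (v : B) : Prop :=
  ∃ h : ∀ m, M m ∈ generatedCStar (digraphAlgebra (V m)),
    Tendsto (fun m => Ψ m ⟨M m, h m⟩) atTop (𝓝 v)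

variable {Ψ : ∀ m, generatedCStar (digraphAlgebra (V m)) →⋆ₙₐ[ℂ] B}
  {M N : ∀ m, Matrix (V m) (V m) ℂ} {v w : B}

theorem Conv.add (hM : Conv Ψ M v) (hN : Conv Ψ N w) : Conv Ψ (M + N) (v + w) := by
  obtain ⟨h, hM⟩ := hM
  obtain ⟨h', hN⟩ := hN
  refine ⟨fun m => add_mem (h m) (h' m), (hM.add hN).congr fun m => ?_⟩
  rw [← map_add]; rfl

theorem Conv.mul (hM : Conv Ψ M v) (hN : Conv Ψ N w) : Conv Ψ (M * N) (v * w) := by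
  obtain ⟨h, hM⟩ := hM
  obtain ⟨h', hN⟩ := hN
  refine ⟨fun m => mul_mem (h m) (h' m), (hM.mul hN).congr fun m => ?_⟩
  rw [← map_mul]; rfl

theorem Conv.sub (hM : Conv Ψ M v) (hN : Conv Ψ N w) : Conv Ψ (M - N) (v - w) := by
  obtain ⟨h, hM⟩ := hM
  obtain ⟨h', hN⟩ := hN
  refine ⟨fun m => sub_mem (h m) (h' m), (hM.sub hN).congr fun m => ?_⟩
  rw [← map_sub]; rfl

theorem Conv.star (hM : Conv Ψ M v) : Conv Ψ (star M) (star v) := by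
  obtain ⟨h, hM⟩ := hM
  refine ⟨fun m => star_mem (h m), hM.star.congr fun m => ?_⟩
  rw [← map_star]; rfl

theorem Conv.null (hΨ : ∀ m x, ‖Ψ m x‖ = ‖x‖) (hM : Conv Ψ M 0) : Null M := by
  obtain ⟨h, hM⟩ := hM
  have := hM.norm
  rw [norm_zero] at this
  have h1 : ∀ m, ‖Ψ m ⟨M m, h m⟩‖ = ‖M m‖ := fun m => hΨ m ⟨M m, h m⟩
  simp only [h1] at this
  exact this

theorem Conv.null_sub (hΨ : ∀ m x, ‖Ψ m x‖ = ‖x‖) (hM : Conv Ψ M v) (hN : Conv Ψ N v) :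
    Null (M - N) := by
  have := hM.sub hN
  rw [sub_self] at this
  exact this.null hΨ

theorem Conv.bdd (hΨ : ∀ m x, ‖Ψ m x‖ = ‖x‖) (hM : Conv Ψ M v) : Bdd M := by
  obtain ⟨h, hM⟩ := hM
  obtain ⟨C, hC⟩ := hM.norm.bddAbove_range
  exact ⟨C, fun m => (hΨ m ⟨M m, h m⟩).symm.trans_le (hC ⟨m, rfl⟩)⟩

theorem Conv.of_null_sub (hΨ : ∀ m x, ‖Ψ m x‖ = ‖x‖) (hM : Conv Ψ M v)
    (hN : ∀ m, N m ∈ digraphAlgebra (V m)) (h : Null (N - M)) : Conv Ψ N v := by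
  obtain ⟨h', hM⟩ := hM
  have hN' : ∀ m, N m ∈ generatedCStar (digraphAlgebra (V m)) := fun m =>
    mem_generatedCStar _ ⟨N m, hN m⟩
  refine ⟨hN', ?_⟩
  have h1 : Tendsto (fun m => Ψ m ⟨N m, hN' m⟩ - Ψ m ⟨M m, h' m⟩) atTop (𝓝 0) := by
    rw [tendsto_zero_iff_norm_tendsto_zero]
    refine h.congr fun m => ?_
    rw [← map_sub, hΨ]
    rfl
  simpa using h1.add hM

theorem Conv.eventually_norm_sub_lt (hM : Conv Ψ M v) {ι : ∀ m, digraphAlgebra (V m) →ₙₐ[ℂ] 𝒜}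
    (hι : ∀ m (a : digraphAlgebra (V m)), Ψ m ⟨a, mem_generatedCStar _ a⟩ = ι m a)
    (h : ∀ m, M m ∈ digraphAlgebra (V m)) {ε : ℝ} (hε : 0 < ε) :
    ∀ᶠ m in atTop, ‖(ι m ⟨M m, h m⟩ : B) - v‖ < ε := by
  obtain ⟨h', hM⟩ := hM
  filter_upwards [Metric.tendsto_nhds.1 hM ε hε] with m hm
  rw [← dist_eq_norm, ← hι]
  exact hm

/-- `N` has no strictly upper blocks, so those of `M` agree with those of `M - N`. The estimate
holds for each colour, and the factor 3 is the number of colours. -/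
theorem norm_strict_le {X : Type*} [Preorder X] [Fintype X] [DecidableEq X]
    {κ : Reduced X → Reduced X → Fin 3} (hκ : IsMatchingColouring κ) {M N D : Matrix X X ℂ}
    (hM : M ∈ digraphAlgebra X) (hN : star N ∈ digraphAlgebra X) (hD : D ∈ blockDiag X)
    (hMD : ∀ x y, cls x = cls y → (M - D) x y = 0) :
    ‖M - D‖ ≤ 3 * ‖M - N‖ := by
  have hT : M - D ∈ digraphAlgebra X := (digraphAlgebra X).sub_mem hM (blockDiag_le hD)
  have key : ∀ c, ‖colourPart κ c (M - D)‖ ≤ ‖M - N‖ := by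
    intro c
    refine norm_le_of_matching (norm_nonneg _) (fun x y x' y' h h' => ?_) fun a b => ?_
    · have h1 := monochrome_colourPart (κ := κ) (c := c) hT x y h
      have h2 := monochrome_colourPart (κ := κ) (c := c) hT x' y' h'
      constructor
      · intro he
        rw [← he] at h2
        exact hκ.1 _ _ _ h1.1 h2.1 (h1.2.trans h2.2.symm)
      · intro he
        rw [← he] at h2
        exact hκ.2 _ _ _ h1.1 h2.1 (h1.2.trans h2.2.symm)
    · have e : blk a b (colourPart κ c (M - D)) = 0 ∨
          blk a b (colourPart κ c (M - D)) = blk a b (M - N) := by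
        by_cases hab : a ≤ b ∧ a ≠ b ∧ κ a b = c
        · right
          ext x y
          rw [blk_apply, blk_apply]
          split_ifs with h
          · have hD0 : D x y = 0 := by
              by_contra hc
              exact hab.2.1 (h.1.symm.trans ((hD x y hc).trans h.2))
            have hN0 : N x y = 0 := by
              by_contra hc
              have := mem_digraphAlgebra.1 hN y x (by simpa [Matrix.star_apply] using hc)
              rw [h.1, h.2] at this
              exact hab.2.1 (le_antisymm hab.1 this)
            rw [colourPart_apply, h.1, h.2, if_pos hab.2.2, Matrix.sub_apply, Matrix.sub_apply,
              hD0, hN0]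
          · rfl
        · left
          ext x y
          by_contra hc
          rw [blk_apply] at hc
          split_ifs at hc with h
          · obtain ⟨h1, h2⟩ := colourPart_ne_zero hc
            rw [h.1, h.2] at h2
            refine hab ⟨?_, fun h3 => h1 (hMD x y (by rw [h.1, h.2, h3])), h2⟩
            rw [← h.1, ← h.2]
            exact mem_digraphAlgebra.1 hT x y h1
          · exact hc rfl
      rcases e with e | e
      · rw [e, norm_zero]; exact norm_nonneg _
      · rw [e]; exact norm_blk_le _ _ _
  rw [← sum_colourPart (κ := κ) (M - D), Fin.sum_univ_three]
  refine (norm_add₃_le).trans ?_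
  linarith [key 0, key 1, key 2]

/-- The block diagonal part. -/
def diagPart {X : Type*} [Preorder X] (M : Matrix X X ℂ) : Matrix X X ℂ :=
  open Classical in Matrix.of fun x y => if cls x = cls y then M x y else 0

open Classical in
theorem diagPart_apply {X : Type*} [Preorder X] (M : Matrix X X ℂ) (x y : X) :
    diagPart M x y = if cls x = cls y then M x y else 0 := rfl

theorem diagPart_mem {X : Type*} [Preorder X] [Fintype X] [DecidableEq X] (M : Matrix X X ℂ) :
    diagPart M ∈ blockDiag X := by
  refine mem_blockDiag.2 fun x y h => ?_
  by_contra hc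
  exact h (by rw [diagPart_apply, if_neg hc])

/-- Partial isometries of `𝒜` whose initial and final projections belong to `𝒜`. -/
structure IsNormalizingIn (𝒜 : NonUnitalSubalgebra ℂ B) (v : B) : Prop where
  mem : v ∈ 𝒜
  partialIsometry : v * star v * v = v
  star_mul_self : star v * v ∈ 𝒜
  mul_star_self : v * star v ∈ 𝒜

/-- A sequence of digraph algebras that asymptotically exhausts `𝒜`. -/
structure IsExhausting (𝒜 : NonUnitalSubalgebra ℂ B)
    (Ψ : ∀ m, generatedCStar (digraphAlgebra (V m)) →⋆ₙₐ[ℂ] B) : Prop where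
  norm_map : ∀ m x, ‖Ψ m x‖ = ‖x‖
  squareFree : ∀ m, SquareFree (Reduced (V m))
  exists_colouring : ∀ m, ∃ κ : Reduced (V m) → Reduced (V m) → Fin 3, IsMatchingColouring κ
  exists_conv : ∀ v ∈ 𝒜, ∃ A : ∀ m, Matrix (V m) (V m) ℂ,
    (∀ m, A m ∈ digraphAlgebra (V m)) ∧ Conv Ψ A v

namespace IsExhausting

/-- Approximating `u` and `star u` gives approximants of `u` that are upper and lower with respect
to the order. They differ by a null sequence, so the strictly upper part of the former is null. -/
theorem exists_conv_blockDiag (hΨ : IsExhausting 𝒜 Ψ) {u : B} (hu : u ∈ 𝒜) (hu' : star u ∈ 𝒜) :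
    ∃ D : ∀ m, Matrix (V m) (V m) ℂ, (∀ m, D m ∈ blockDiag (V m)) ∧ Conv Ψ D u := by
  obtain ⟨M, hM, hMu⟩ := hΨ.exists_conv u hu
  obtain ⟨N, hN, hNu⟩ := hΨ.exists_conv _ hu'
  choose κ hκ using hΨ.exists_colouring
  have hNu' := hNu.star
  rw [star_star] at hNu'
  refine ⟨fun m => diagPart (M m), fun m => diagPart_mem _,
    hMu.of_null_sub hΨ.norm_map (fun m => blockDiag_le (diagPart_mem _)) ?_⟩
  have h1 : Null (M - star N) := hMu.null_sub hΨ.norm_map hNu'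
  have h2 : Tendsto (fun m => 3 * ‖(M - star N) m‖) atTop (𝓝 0) := by
    simpa using Tendsto.const_mul 3 h1
  refine squeeze_zero (fun _ => norm_nonneg _) (fun m => ?_) h2
  rw [Pi.sub_apply, norm_sub_rev]
  refine norm_strict_le (hκ m) (hM m) (N := star (N m)) (by simpa using hN m) (diagPart_mem _)
    fun x y h => ?_
  rw [Matrix.sub_apply, diagPart_apply, if_pos h, sub_self]

/-- Exact relations in `𝒜` become approximate ones at the stages, and these are repaired by
`exists_isNormalizing_lift`. Treating a family at once is what later gives additivity. -/
theorem exists_isNormalizing (hΨ : IsExhausting 𝒜 Ψ) {ι : Type*} [Finite ι] {v : ι → B}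
    (hv : ∀ i, IsNormalizingIn 𝒜 (v i)) (ho : ∀ i j, i ≠ j → Orthogonal (v i) (v j)) :
    ∃ w : ι → ∀ m, Matrix (V m) (V m) ℂ, (∀ i m, IsNormalizing (w i m)) ∧
      (∀ i, Conv Ψ (w i) (v i)) ∧ ∀ i j, i ≠ j → ∀ m, Orthogonal (w i m) (w j m) := by
  choose A hA hAv using fun i => hΨ.exists_conv (v i) (hv i).mem
  choose P hP hPv using fun i => hΨ.exists_conv_blockDiag (hv i).star_mul_self
    (by simpa using (hv i).star_mul_self)
  choose Q hQ hQv using fun i => hΨ.exists_conv_blockDiag (hv i).mul_star_self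
    (by simpa using (hv i).mul_star_self)
  choose κ hκ using hΨ.exists_colouring
  obtain ⟨w, h1, h2, h3⟩ := exists_isNormalizing_lift hΨ.squareFree hκ hA
    (fun i => (hAv i).bdd hΨ.norm_map)
    (fun i => by
      have := ((hAv i).mul (hAv i).star).mul (hAv i)
      rw [(hv i).partialIsometry] at this
      exact this.null_sub hΨ.norm_map (hAv i))
    hP (fun i => ((hAv i).star.mul (hAv i)).null_sub hΨ.norm_map (hPv i))
    hQ (fun i => ((hAv i).mul (hAv i).star).null_sub hΨ.norm_map (hQv i))
    (fun i j hij => by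
      constructor
      · have := (hAv i).star.mul (hAv j)
        rw [(ho i j hij).1] at this
        exact this.null hΨ.norm_map
      · have := (hAv i).mul (hAv j).star
        rw [(ho i j hij).2] at this
        exact this.null hΨ.norm_map)
  exact ⟨w, h1, fun i => (hAv i).of_null_sub hΨ.norm_map (fun m => (h1 i m).mem) (h2 i), h3⟩

end IsExhausting

end Representation

end CycleAlgebra

end

noncomputable section

set_option linter.unusedSectionVars false

namespace CycleAlgebra

open scoped Matrix.Norms.L2Operator
open Filter Topology

/-! ## Limits of chain groups -/

namespace Tower

variable {n : ℕ} (T : Tower n)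

/-- The map of `1`-chains that is induced by the composition of successive embeddings. -/
def chainTrans (j k : ℕ) (hjk : j ≤ k) :
    (Simplex1 (Reduced (T.V j)) →₀ ℤ) →ₗ[ℤ] (Simplex1 (Reduced (T.V k)) →₀ ℤ) :=
  Nat.leRec (motive := fun k _ =>
    (Simplex1 (Reduced (T.V j)) →₀ ℤ) →ₗ[ℤ] (Simplex1 (Reduced (T.V k)) →₀ ℤ))
    LinearMap.id (fun {k} _ f => inducedChain (T.incl k) ∘ₗ f) hjk

theorem chainTrans_self (j : ℕ) : T.chainTrans j j le_rfl = LinearMap.id :=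
  Nat.leRec_self _ _

theorem chainTrans_succ {j k : ℕ} (hjk : j ≤ k) :
    T.chainTrans j (k + 1) (Nat.le_succ_of_le hjk)
      = inducedChain (T.incl k) ∘ₗ T.chainTrans j k hjk :=
  Nat.leRec_succ _ _ _

theorem H1Trans_self (j : ℕ) : T.H1Trans j j le_rfl = LinearMap.id :=
  Nat.leRec_self _ _

theorem H1Trans_succ {j k : ℕ} (hjk : j ≤ k) :
    T.H1Trans j (k + 1) (Nat.le_succ_of_le hjk)
      = inducedH1 n (T.incl k) ∘ₗ T.H1Trans j k hjk :=
  Nat.leRec_succ _ _ _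

instance directedSystem_chainTrans : DirectedSystem
    (fun k => Simplex1 (Reduced (T.V k)) →₀ ℤ) (T.chainTrans · · ·) where
  map_self j x := by rw [chainTrans_self]; rfl
  map_map k j i hij hjk x := by
    induction k, hjk using Nat.le_induction with
    | base => rw [chainTrans_self]; rfl
    | succ k hjk ih =>
      rw [T.chainTrans_succ hjk, T.chainTrans_succ (hij.trans hjk), LinearMap.comp_apply,
        LinearMap.comp_apply, ih]

/-- The direct limit of the groups of `1`-chains. -/
abbrev limitChains : Type :=
  Module.DirectLimit (fun k => Simplex1 (Reduced (T.V k)) →₀ ℤ) T.chainTrans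

/-- The element of the limit that is represented by a `1`-chain. -/
def ofChain (k : ℕ) : (Simplex1 (Reduced (T.V k)) →₀ ℤ) →ₗ[ℤ] T.limitChains :=
  Module.DirectLimit.of ℤ ℕ _ T.chainTrans k

theorem ofChain_inducedChain (k : ℕ) (c : Simplex1 (Reduced (T.V k)) →₀ ℤ) :
    T.ofChain (k + 1) (inducedChain (T.incl k) c) = T.ofChain k c := by
  have := Module.DirectLimit.of_f (R := ℤ) (f := T.chainTrans) (hij := Nat.le_succ k) (x := c)
  rw [T.chainTrans_succ le_rfl, chainTrans_self] at this
  exact this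

variable {T} (hn : 3 ≤ n)

theorem squareFree (hn : 3 ≤ n) (T : Tower n) (k : ℕ) : SquareFree (Reduced (T.V k)) :=
  (T.isCycleSum k).squareFree hn

theorem toChain_H1Trans {j k : ℕ} (hjk : j ≤ k) (z : H1 (Reduced (T.V j))) :
    H1.toChain (T.squareFree hn k) (T.H1Trans j k hjk z)
      = T.chainTrans j k hjk (H1.toChain (T.squareFree hn j) z) := by
  induction k, hjk using Nat.le_induction with
  | base => rw [chainTrans_self, H1Trans_self]; rfl
  | succ k hjk ih =>
    rw [T.chainTrans_succ hjk, T.H1Trans_succ hjk, LinearMap.comp_apply, LinearMap.comp_apply,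
      ← ih]
    exact toChain_inducedH1 hn (T.isCycleSum k) (T.isCycleSum (k + 1)) (T.isRigid k) _

/-- Limit homology classes are classes of cycles. -/
def limitToChain (hn : 3 ≤ n) (T : Tower n) : T.limitH1 →ₗ[ℤ] T.limitChains :=
  Module.DirectLimit.map (fun k => H1.toChain (T.squareFree hn k)) fun _ _ h =>
    LinearMap.ext fun z => toChain_H1Trans hn h z

theorem limitToChain_of (k : ℕ) (z : H1 (Reduced (T.V k))) :
    T.limitToChain hn (Module.DirectLimit.of ℤ ℕ _ T.H1Trans k z)
      = T.ofChain k (H1.toChain (T.squareFree hn k) z) :=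
  Module.DirectLimit.map_apply_of _ _ _

/-- A class that dies as a chain does so at a finite stage, and there homology embeds in chains. -/
theorem limitToChain_injective (hn : 3 ≤ n) (T : Tower n) :
    Function.Injective (T.limitToChain hn) := by
  rw [injective_iff_map_eq_zero]
  intro z hz
  obtain ⟨k, y, rfl⟩ := Module.DirectLimit.exists_of z
  rw [limitToChain_of] at hz
  obtain ⟨j, hkj, hj⟩ := Module.DirectLimit.of.zero_exact hz
  rw [← toChain_H1Trans hn] at hj
  rw [← Module.DirectLimit.of_f (hij := hkj),
    H1.toChain_injective (T.squareFree hn j) (hj.trans (map_zero _).symm), map_zero]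

theorem mem_range_limitToChain {x : T.limitChains} :
    x ∈ LinearMap.range (T.limitToChain hn) ↔
      ∃ k c, boundary1 (Reduced (T.V k)) c = 0 ∧ T.ofChain k c = x := by
  constructor
  · rintro ⟨z, rfl⟩
    obtain ⟨k, y, rfl⟩ := Module.DirectLimit.exists_of z
    exact ⟨k, _, H1.boundary1_toChain (T.squareFree hn k) y, (limitToChain_of hn k y).symm⟩
  · rintro ⟨k, c, hc, rfl⟩
    refine ⟨Module.DirectLimit.of ℤ ℕ _ T.H1Trans k (H1.mk c hc), ?_⟩
    rw [limitToChain_of, H1.toChain_mk]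

end Tower

/-! ## Chains of normalising partial isometries of the limit algebra -/

theorem chain_edgeUnit {X : Type*} [Preorder X] [Fintype X] [DecidableEq X]
    (e : Simplex1 (Reduced X)) : chain (edgeUnit e) = Finsupp.single e (1 : ℤ) := by
  classical
  have h : ∀ d : Simplex1 (Reduced X), blk d.1.1 d.1.2 (edgeUnit e)
      = if e = d then edgeUnit e else 0 := by
    intro d
    ext x y
    rw [blk_apply]
    by_cases hz : edgeUnit e x y = 0
    · simp only [hz, ite_self]
      split_ifs <;> simp [hz]
    · rw [edgeUnit, Matrix.single_apply] at hz
      split_ifs at hz with h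
      · obtain ⟨rfl, rfl⟩ := h
        have hed : (cls (rep e.1.1) = d.1.1 ∧ cls (rep e.1.2) = d.1.2) ↔ e = d := by
          rw [cls_rep, cls_rep, ← Prod.ext_iff, Subtype.coe_inj]
        simp only [hed]
        split_ifs <;> rfl
      · exact absurd rfl hz
  ext d
  rw [chain_apply, h, Finsupp.single_apply]
  split_ifs
  · simp [edgeUnit, rank_single]
  · simp

section Limit

variable {B : Type*} [NonUnitalCStarAlgebra B] {𝒜 : NonUnitalSubalgebra ℂ B} {n : ℕ}

theorem IsStarExtendible.isNormalizingIn {X : Type*} [Preorder X] [Fintype X] [DecidableEq X]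
    {φ : digraphAlgebra X →ₙₐ[ℂ] 𝒜} (hφ : IsStarExtendible φ) {a : digraphAlgebra X}
    (ha : IsNormalizing (a : Matrix X X ℂ)) : IsNormalizingIn 𝒜 (φ a) := by
  have h1 := hφ.star_mul (a := a) (b := a) (c := ⟨_, blockDiag_le ha.star_mul_self⟩) rfl
  have h2 := hφ.mul_star (a := a) (b := a) (c := ⟨_, blockDiag_le ha.mul_star_self⟩) rfl
  refine ⟨SetLike.coe_mem _, ?_, ?_, ?_⟩
  · rw [h2, ← NonUnitalSubalgebra.coe_mul, ← map_mul]
    congr 2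
    exact Subtype.ext ha.partialIsometry
  · rw [h1]; exact SetLike.coe_mem _
  · rw [h2]; exact SetLike.coe_mem _

/-- The embeddings that exhibit `𝒜` as the limit of a tower. -/
structure LimitEmbedding (T : Tower n) (𝒜 : NonUnitalSubalgebra ℂ B) where
  /-- The embedding of `A_k` in `𝒜`. -/
  ι : ∀ k, digraphAlgebra (T.V k) →ₙₐ[ℂ] 𝒜
  isStarExtendible : ∀ k, IsStarExtendible (ι k)
  injective : ∀ k, Function.Injective (ι k)
  comp : ∀ k, (ι (k + 1)).comp (T.incl k) = ι k
  dense : (𝒜 : Set B) ⊆ closure (⋃ k, Set.range fun a => (ι k a : B))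

namespace LimitEmbedding

variable {T : Tower n} (L : LimitEmbedding T 𝒜)

theorem ι_incl (k : ℕ) (a : digraphAlgebra (T.V k)) : L.ι (k + 1) (T.incl k a) = L.ι k a :=
  congrArg (fun f => f a) (L.comp k)

/-- The extension of `ι k` to the generated C*-algebra. -/
def starHom (k : ℕ) : generatedCStar (digraphAlgebra (T.V k)) →⋆ₙₐ[ℂ] B :=
  ((L.isStarExtendible k).exists_isometry (L.injective k)).choose

theorem starHom_apply (k : ℕ) (a : digraphAlgebra (T.V k)) :
    L.starHom k ⟨a, mem_generatedCStar _ a⟩ = L.ι k a :=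
  ((L.isStarExtendible k).exists_isometry (L.injective k)).choose_spec.1 a

theorem norm_starHom (k : ℕ) (x : generatedCStar (digraphAlgebra (T.V k))) :
    ‖L.starHom k x‖ = ‖x‖ :=
  ((L.isStarExtendible k).exists_isometry (L.injective k)).choose_spec.2 x

theorem norm_ι (k : ℕ) (a : digraphAlgebra (T.V k)) :
    ‖(L.ι k a : B)‖ = ‖(a : Matrix (T.V k) (T.V k) ℂ)‖ := by
  rw [← starHom_apply, norm_starHom]
  rfl

theorem norm_ι_sub (k : ℕ) (a b : digraphAlgebra (T.V k)) :
    ‖(L.ι k a : B) - L.ι k b‖ = ‖(a - b : Matrix (T.V k) (T.V k) ℂ)‖ := by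
  have := L.norm_ι k (a - b)
  rwa [map_sub] at this

theorem exists_ι_eq {j k : ℕ} (hjk : j ≤ k) (a : digraphAlgebra (T.V j)) :
    ∃ b, L.ι k b = L.ι j a := by
  induction k, hjk using Nat.le_induction with
  | base => exact ⟨a, rfl⟩
  | succ k _ ih =>
    obtain ⟨b, hb⟩ := ih
    exact ⟨T.incl k b, by rw [L.ι_incl, hb]⟩

theorem exists_conv {v : B} (hv : v ∈ 𝒜) : ∃ A : ∀ m, Matrix (T.V m) (T.V m) ℂ,
    (∀ m, A m ∈ digraphAlgebra (T.V m)) ∧ Conv L.starHom A v := by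
  set S : ℕ → Set B := fun m => Set.range fun a => (L.ι m a : B) with hS
  -- The slack `1 / (m + 1)` allows one choice of approximant at every stage, without knowing that
  -- the distance is attained.
  have hlt : ∀ m : ℕ, Metric.infDist v (S m) < Metric.infDist v (S m) + 1 / ((m : ℝ) + 1) :=
    fun m => lt_add_of_pos_right _ (by positivity)
  have hne : ∀ m, (S m).Nonempty := fun m => ⟨_, 0, rfl⟩
  have hex : ∀ m, ∃ a, dist v (L.ι m a : B) < Metric.infDist v (S m) + 1 / ((m : ℝ) + 1) := by
    intro m
    obtain ⟨_, ⟨a, rfl⟩, ha⟩ := (Metric.infDist_lt_iff (hne m)).1 (hlt m)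
    exact ⟨a, ha⟩
  choose a ha using hex
  refine ⟨fun m => a m, fun m => (a m).2, fun m => mem_generatedCStar _ (a m), ?_⟩
  have hinf : Tendsto (fun m => Metric.infDist v (S m)) atTop (𝓝 0) := by
    rw [Metric.tendsto_atTop]
    intro ε hε
    obtain ⟨y, hy, hd⟩ := Metric.mem_closure_iff.1 (L.dense hv) ε hε
    obtain ⟨k, b, rfl⟩ := Set.mem_iUnion.1 hy
    refine ⟨k, fun m hm => ?_⟩
    obtain ⟨b', hb'⟩ := L.exists_ι_eq hm b
    rw [Real.dist_0_eq_abs, abs_of_nonneg Metric.infDist_nonneg]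
    have hb : (L.ι m b' : B) ∈ S m := ⟨b', rfl⟩
    refine (Metric.infDist_le_dist_of_mem hb).trans_lt ?_
    rw [hb']
    exact hd
  have h0 := hinf.add (tendsto_one_div_add_atTop_nhds_zero_nat (𝕜 := ℝ))
  rw [add_zero] at h0
  rw [tendsto_iff_dist_tendsto_zero]
  refine squeeze_zero (fun _ => dist_nonneg) (fun m => ?_) h0
  rw [L.starHom_apply m (a m), dist_comm]
  exact (ha m).le

theorem isExhausting (hn : 3 ≤ n) : IsExhausting 𝒜 L.starHom where
  norm_map := L.norm_starHom
  squareFree := T.squareFree hn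
  exists_colouring k := (T.isCycleSum k).exists_matchingColouring
  exists_conv _ := L.exists_conv

/-- `c` is the class of the chain of a normalising partial isometry near `v`. -/
def IsChainNear (v : B) (c : T.limitChains) : Prop :=
  ∃ (m : ℕ) (a : digraphAlgebra (T.V m)), IsNormalizing (a : Matrix (T.V m) (T.V m) ℂ) ∧
    ‖(L.ι m a : B) - v‖ < 1 / 4 ∧ T.ofChain m (chain (a : Matrix (T.V m) (T.V m) ℂ)) = c

theorem exists_isNormalizing_ι_eq (hn : 3 ≤ n) {j k : ℕ} (hjk : j ≤ k) {a : digraphAlgebra (T.V j)}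
    (ha : IsNormalizing (a : Matrix (T.V j) (T.V j) ℂ)) :
    ∃ b : digraphAlgebra (T.V k), IsNormalizing (b : Matrix (T.V k) (T.V k) ℂ) ∧
      L.ι k b = L.ι j a ∧ T.ofChain k (chain (b : Matrix (T.V k) (T.V k) ℂ))
        = T.ofChain j (chain (a : Matrix (T.V j) (T.V j) ℂ)) := by
  induction k, hjk using Nat.le_induction with
  | base => exact ⟨a, ha, rfl, rfl⟩
  | succ k _ ih =>
    obtain ⟨b, hb, hb1, hb2⟩ := ih
    refine ⟨T.incl k b, (T.isRigid k).1.map_isNormalizing hb, by rw [L.ι_incl, hb1], ?_⟩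
    rw [chain_map (T.squareFree hn k) (T.squareFree hn (k + 1)) (T.isRigid k).1 hb,
      T.ofChain_inducedChain, hb2]

/-- At a common later stage the two representatives are at distance less than 1/4 + 1/4, within the
range where chains agree. -/
theorem IsChainNear.eq (hn : 3 ≤ n) {v : B} {c d : T.limitChains} (hc : L.IsChainNear v c)
    (hd : L.IsChainNear v d) : c = d := by
  obtain ⟨j, a, ha, hav, rfl⟩ := hc
  obtain ⟨k, b, hb, hbv, rfl⟩ := hd
  obtain ⟨K, hj, hk⟩ : ∃ K, j ≤ K ∧ k ≤ K := ⟨_, le_max_left j k, le_max_right j k⟩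
  obtain ⟨a', ha', e1, e2⟩ := L.exists_isNormalizing_ι_eq hn hj ha
  obtain ⟨b', hb', e3, e4⟩ := L.exists_isNormalizing_ι_eq hn hk hb
  suffices h : ‖(a' - b' : Matrix (T.V K) (T.V K) ℂ)‖ < 1 by
    rw [← e2, ← e4, chain_eq_of_norm_sub_lt_one (T.squareFree hn K) ha' hb' h]
  rw [← L.norm_ι_sub, e1, e3]
  calc ‖(L.ι j a : B) - L.ι k b‖ = ‖((L.ι j a : B) - v) - (L.ι k b - v)‖ := by
        rw [sub_sub_sub_cancel_right]
    _ ≤ ‖(L.ι j a : B) - v‖ + ‖(L.ι k b : B) - v‖ := norm_sub_le _ _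
    _ < 1 := by linarith

/-- The class of the chains of the normalising partial isometries near `v`. -/
def chainClass (v : B) : T.limitChains :=
  open Classical in if h : ∃ c, L.IsChainNear v c then h.choose else 0

theorem chainClass_eq (hn : 3 ≤ n) {v : B} {c : T.limitChains} (hc : L.IsChainNear v c) :
    L.chainClass v = c := by
  have h : ∃ c, L.IsChainNear v c := ⟨c, hc⟩
  rw [chainClass, dif_pos h]
  exact IsChainNear.eq L hn h.choose_spec hc

/-- Identities between classes of finitely many elements can thus be verified at a single late
stage. -/
theorem eventually_chainClass_eq (hn : 3 ≤ n) {v : B} {w : ∀ m, Matrix (T.V m) (T.V m) ℂ}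
    (hw : ∀ m, IsNormalizing (w m)) (hv : Conv L.starHom w v) :
    ∀ᶠ m in atTop, L.chainClass v = T.ofChain m (chain (w m)) := by
  filter_upwards [hv.eventually_norm_sub_lt L.starHom_apply (fun m => (hw m).mem)
    (show (0 : ℝ) < 1 / 4 by norm_num)] with m hm
  exact L.chainClass_eq hn ⟨m, ⟨w m, (hw m).mem⟩, hw m, hm, rfl⟩

theorem exists_conv_isNormalizing (hn : 3 ≤ n) {v : B} (hv : IsNormalizingIn 𝒜 v) :
    ∃ w : ∀ m, Matrix (T.V m) (T.V m) ℂ, (∀ m, IsNormalizing (w m)) ∧ Conv L.starHom w v := by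
  obtain ⟨w, h1, h2, -⟩ := (L.isExhausting hn).exists_isNormalizing (ι := Unit)
    (fun _ => hv) (fun _ _ h => absurd rfl h)
  exact ⟨w (), h1 (), h2 ()⟩

/-- Lifting the pair together gives exactly orthogonal approximants, for which `chain_add` applies
at a finite stage. -/
theorem chainClass_add (hn : 3 ≤ n) {v v' : B} (hv : IsNormalizingIn 𝒜 v)
    (hv' : IsNormalizingIn 𝒜 v') (h : Orthogonal v v') :
    L.chainClass (v + v') = L.chainClass v + L.chainClass v' := by
  obtain ⟨w, h1, h2, h3⟩ := (L.isExhausting hn).exists_isNormalizing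
    (v := fun b : Bool => if b then v else v')
    (by rintro (_ | _) <;> simp [hv, hv'])
    (by rintro (_ | _) (_ | _) hne <;> simp_all [h.symm])
  have c1 : Conv L.starHom (w true) v := by simpa using h2 true
  have c2 : Conv L.starHom (w false) v' := by simpa using h2 false
  have ho := h3 true false (by simp)
  obtain ⟨m, e1, e2, e3⟩ := ((L.eventually_chainClass_eq hn (h1 true) c1).and
    ((L.eventually_chainClass_eq hn (h1 false) c2).and
    (L.eventually_chainClass_eq hn (fun m => (h1 true m).add (h1 false m) (ho m))
      (c1.add c2)))).exists
  rw [e1, e2, e3, chain_add (T.squareFree hn m) (h1 true m) (h1 false m) (ho m), map_add]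

/-- One half of diagonal equivalence in approximate form: semicontinuity bounds the block ranks of
`w` by those of `u * v * z`, and these by those of `v`. -/
theorem chain_le_of_norm_sub_lt_one {X : Type*} [Preorder X] [Fintype X] [DecidableEq X]
    (hX : SquareFree (Reduced X)) {v w u z : Matrix X X ℂ} (hw : IsNormalizing w)
    (hu : u ∈ blockDiag X) (hz : z ∈ blockDiag X) (h : ‖w - u * v * z‖ < 1)
    (e : Simplex1 (Reduced X)) : chain w e ≤ chain v e := by
  rw [chain_apply, chain_apply, Nat.cast_le]
  refine le_trans (rank_le_of_norm_sub_lt_one (hw.blk hX _ _).partialIsometry ?_)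
    (rank_blk_le hu hz e.1.1 e.1.2)
  rw [← blk_sub]
  exact (norm_blk_le _ _ _).trans_lt h

/-- `u` and `z` lie in `𝒜` with their adjoints, so they have block diagonal approximants. The two
relations hold approximately at late stages and bound the chains in both directions. -/
theorem chainClass_eq_of_equiv (hn : 3 ≤ n) {v v' u z : B} (hv : IsNormalizingIn 𝒜 v)
    (hv' : IsNormalizingIn 𝒜 v') (hu : u ∈ 𝒜) (hu' : star u ∈ 𝒜) (hz : z ∈ 𝒜) (hz' : star z ∈ 𝒜)
    (h : v' = u * v * z) (h' : v = star u * v' * star z) : L.chainClass v' = L.chainClass v := by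
  have hL := L.isExhausting hn
  obtain ⟨w, hw, hwv⟩ := L.exists_conv_isNormalizing hn hv
  obtain ⟨w', hw', hwv'⟩ := L.exists_conv_isNormalizing hn hv'
  obtain ⟨U, hU, hUu⟩ := hL.exists_conv_blockDiag hu hu'
  obtain ⟨Z, hZ, hZz⟩ := hL.exists_conv_blockDiag hz hz'
  have h1 : Null (w' - U * w * Z) := by
    refine hwv'.null_sub hL.norm_map ?_
    rw [h]
    exact (hUu.mul hwv).mul hZz
  have h2 : Null (w - star U * w' * star Z) := by
    refine hwv.null_sub hL.norm_map ?_
    rw [h']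
    exact (hUu.star.mul hwv').mul hZz.star
  obtain ⟨m, e1, e2, e3, e4⟩ := ((L.eventually_chainClass_eq hn hw hwv).and
    ((L.eventually_chainClass_eq hn hw' hwv').and
    ((h1.eventually_lt one_pos).and (h2.eventually_lt one_pos)))).exists
  rw [e1, e2]
  refine congrArg (T.ofChain m) (Finsupp.ext fun e => ?_)
  exact le_antisymm
    (chain_le_of_norm_sub_lt_one (T.squareFree hn m) (hw' m) (hU m) (hZ m) e3 e)
    (chain_le_of_norm_sub_lt_one (T.squareFree hn m) (hw m) (star_mem (hU m)) (star_mem (hZ m)) e4 e)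

theorem chainClass_eq_zero (hn : 3 ≤ n) {v : B} (hv : IsNormalizingIn 𝒜 v) (hv' : star v ∈ 𝒜) :
    L.chainClass v = 0 := by
  have hL := L.isExhausting hn
  obtain ⟨w, hw, hwv⟩ := L.exists_conv_isNormalizing hn hv
  obtain ⟨D, hD, hDv⟩ := hL.exists_conv_blockDiag hv.mem hv'
  obtain ⟨m, e1, e2⟩ := ((L.eventually_chainClass_eq hn hw hwv).and
    ((hwv.null_sub hL.norm_map hDv).eventually_lt one_pos)).exists
  rw [e1]
  convert map_zero (T.ofChain m)
  ext e
  refine le_antisymm ?_ (by simp)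
  have := chain_le_of_norm_sub_lt_one (v := D m) (T.squareFree hn m) (hw m) (one_mem _) (one_mem _)
    (by rw [one_mul, mul_one]; exact e2) e
  rwa [chain_eq_zero_of_mem_blockDiag (hD m)] at this

/-! ### Maps of chains induced by homomorphisms into the limit algebra -/

section Transfer

variable {X : Type*} [Preorder X] [Fintype X] [DecidableEq X] (φ : digraphAlgebra X →ₙₐ[ℂ] 𝒜)

/-- The class of the image of a matrix of the digraph algebra. -/
def mapClass (w : Matrix X X ℂ) : T.limitChains :=
  open Classical in if h : w ∈ digraphAlgebra X then L.chainClass (φ ⟨w, h⟩) else 0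

variable {φ}

theorem mapClass_of_mem {w : Matrix X X ℂ} (h : w ∈ digraphAlgebra X) :
    L.mapClass φ w = L.chainClass (φ ⟨w, h⟩) := by
  simp [mapClass, h]

theorem isInvariant_mapClass (hn : 3 ≤ n) (hφ : IsStarExtendible φ) :
    IsInvariant (L.mapClass φ) where
  add v w hv hw h := by
    rw [L.mapClass_of_mem hv.mem, L.mapClass_of_mem hw.mem, L.mapClass_of_mem (hv.add hw h).mem,
      ← L.chainClass_add hn (hφ.isNormalizingIn (a := ⟨v, hv.mem⟩) hv)
        (hφ.isNormalizingIn (a := ⟨w, hw.mem⟩) hw) (hφ.orthogonal h), ← NonUnitalSubalgebra.coe_add,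
      ← map_add]
    rfl
  diagEquiv v w hv hw h := by
    obtain ⟨u, hu, z, hz, h1, h2⟩ := h
    rw [L.mapClass_of_mem hv.mem, L.mapClass_of_mem hw.mem]
    have su := hφ.star_eq (a := ⟨u, blockDiag_le hu⟩) (b := ⟨star u, blockDiag_le (star_mem hu)⟩) rfl
    have sz := hφ.star_eq (a := ⟨z, blockDiag_le hz⟩) (b := ⟨star z, blockDiag_le (star_mem hz)⟩) rfl
    refine L.chainClass_eq_of_equiv hn (hφ.isNormalizingIn (a := ⟨v, hv.mem⟩) hv)
      (hφ.isNormalizingIn (a := ⟨w, hw.mem⟩) hw) (u := φ ⟨u, blockDiag_le hu⟩)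
      (z := φ ⟨z, blockDiag_le hz⟩) (SetLike.coe_mem _) (by rw [su]; exact SetLike.coe_mem _)
      (SetLike.coe_mem _) (by rw [sz]; exact SetLike.coe_mem _) ?_ ?_
    · rw [← NonUnitalSubalgebra.coe_mul, ← NonUnitalSubalgebra.coe_mul, ← map_mul, ← map_mul]
      congr 2
      exact Subtype.ext h1
    · rw [su, sz, ← NonUnitalSubalgebra.coe_mul, ← NonUnitalSubalgebra.coe_mul, ← map_mul,
        ← map_mul]
      congr 2
      exact Subtype.ext h2
  diag v h hv := by
    rw [L.mapClass_of_mem hv.mem]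
    refine L.chainClass_eq_zero hn (hφ.isNormalizingIn (a := ⟨v, hv.mem⟩) hv) ?_
    rw [hφ.star_eq (b := ⟨star v, blockDiag_le (star_mem h)⟩) rfl]
    exact SetLike.coe_mem _

variable (φ) in
/-- The map of chains that is induced by a homomorphism to the limit of a tower. -/
def mapChain : (Simplex1 (Reduced X) →₀ ℤ) →ₗ[ℤ] T.limitChains :=
  Finsupp.linearCombination ℤ fun e => L.mapClass φ (edgeUnit e)

theorem mapChain_chain (hn : 3 ≤ n) (hX : SquareFree (Reduced X)) (hφ : IsStarExtendible φ)
    {a : digraphAlgebra X} (ha : IsNormalizing (a : Matrix X X ℂ)) :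
    L.mapChain φ (chain (a : Matrix X X ℂ)) = L.chainClass (φ a) := by
  rw [mapChain, ← (L.isInvariant_mapClass hn hφ).apply_eq hX ha, L.mapClass_of_mem a.2]

/-- The lifts of edge units and of vertex units are chosen independently, but at a late stage the
initial and final projections of each edge lift are close to the projections lifted from its ends,
hence have the same 0-chains. So mapping each edge to the chain of its lift intertwines the
boundaries and carries cycles to cycles. -/
theorem mapChain_mem (hn : 3 ≤ n) (hφ : IsStarExtendible φ)
    {c : Simplex1 (Reduced X) →₀ ℤ} (hc : boundary1 _ c = 0) :
    L.mapChain φ c ∈ LinearMap.range (T.limitToChain hn) := by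
  classical
  rw [Tower.mem_range_limitToChain]
  have hL := L.isExhausting hn
  set E : Simplex1 (Reduced X) → digraphAlgebra X := fun e =>
    ⟨edgeUnit e, (isNormalizing_edgeUnit e).mem⟩ with hE
  have hEn : ∀ e, IsNormalizing (E e : Matrix X X ℂ) := isNormalizing_edgeUnit
  set D : Reduced X → digraphAlgebra X := fun a => diagUnit (rep a) with hD
  have hDn : ∀ a, IsNormalizing (D a : Matrix X X ℂ) := fun a => isNormalizing_single le_rfl
  choose w hw hwv using fun e => L.exists_conv_isNormalizing hn (hφ.isNormalizingIn (hEn e))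
  choose p hp hpv using fun a => L.exists_conv_isNormalizing hn (hφ.isNormalizingIn (hDn a))
  have d1 : ∀ e, Null (star (w e) * w e - star (p e.1.2) * p e.1.2) := fun e => by
    refine ((hwv e).star.mul (hwv e)).null_sub hL.norm_map ?_
    have e1 := hφ.star_mul (a := E e) (b := E e) (c := D e.1.2) (by simp [hE, hD, edgeUnit, diagUnit])
    have e2 := hφ.star_mul (a := D e.1.2) (b := D e.1.2) (c := D e.1.2) (by simp [hD, diagUnit])
    rw [e1, ← e2]
    exact (hpv _).star.mul (hpv _)
  have d2 : ∀ e, Null (w e * star (w e) - star (p e.1.1) * p e.1.1) := fun e => by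
    refine ((hwv e).mul (hwv e).star).null_sub hL.norm_map ?_
    have e1 := hφ.mul_star (a := E e) (b := E e) (c := D e.1.1) (by simp [hE, hD, edgeUnit, diagUnit])
    have e2 := hφ.star_mul (a := D e.1.1) (b := D e.1.1) (c := D e.1.1) (by simp [hD, diagUnit])
    rw [e1, ← e2]
    exact (hpv _).star.mul (hpv _)
  -- There are finitely many edges, so one stage serves them all.
  obtain ⟨m, h1, h2, h3⟩ := ((eventually_all.2 fun e =>
      L.eventually_chainClass_eq hn (hw e) (hwv e)).and
    ((eventually_all.2 fun e => (d1 e).eventually_lt one_pos).and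
    (eventually_all.2 fun e => (d2 e).eventually_lt one_pos))).exists
  refine ⟨m, Finsupp.linearCombination ℤ (fun e => chain (w e m)) c, ?_, ?_⟩
  · have hb : boundary1 _ ∘ₗ Finsupp.linearCombination ℤ (fun e => chain (w e m))
        = Finsupp.linearCombination ℤ (fun a => chain0 (star (p a m) * p a m)) ∘ₗ
          boundary1 (Reduced X) := by
      ext1 e
      ext1
      simp only [LinearMap.comp_apply, Finsupp.lsingle_apply, Finsupp.linearCombination_single,
        one_smul, boundary1, map_sub]
      have := boundary1_chain (T.squareFree hn m) (hw e m)
      rw [boundary1] at this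
      rw [this, chain0_eq_of_norm_sub_lt_one (T.squareFree hn m)
        (hw e m).isNormalizing_star_mul_self (hp e.1.2 m).isNormalizing_star_mul_self (h2 e),
        chain0_eq_of_norm_sub_lt_one (T.squareFree hn m)
        (hw e m).isNormalizing_mul_star_self (hp e.1.1 m).isNormalizing_star_mul_self (h3 e)]
    have := LinearMap.congr_fun hb c
    rw [LinearMap.comp_apply, LinearMap.comp_apply, hc, map_zero] at this
    exact this
  · rw [Finsupp.apply_linearCombination, mapChain]
    congr 2
    funext e
    rw [L.mapClass_of_mem (hEn e).mem]
    exact (h1 e).symm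

end Transfer

/-! ### Comparison of two towers with the same limit -/

variable {T' : Tower n} (L' : LimitEmbedding T' 𝒜)

/-- The image of an edge unit at the next stage is the same element of `𝒜`, so it has the same
class. -/
theorem mapChain_chainTrans (hn : 3 ≤ n) {j k : ℕ} (hjk : j ≤ k)
    (c : Simplex1 (Reduced (T.V j)) →₀ ℤ) :
    L'.mapChain (L.ι k) (T.chainTrans j k hjk c) = L'.mapChain (L.ι j) c := by
  induction k, hjk using Nat.le_induction with
  | base => rw [T.chainTrans_self]; rfl
  | succ k hjk ih =>
    rw [T.chainTrans_succ hjk, LinearMap.comp_apply, ← ih]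
    generalize T.chainTrans j k hjk c = d
    suffices h : L'.mapChain (L.ι (k + 1)) ∘ₗ inducedChain (T.incl k) = L'.mapChain (L.ι k) from
      LinearMap.congr_fun h d
    ext1 e
    ext1
    have he := (isNormalizing_edgeUnit e).mem
    have h1 := L'.mapChain_chain hn (T.squareFree hn _) (L.isStarExtendible (k + 1))
      ((T.isRigid k).1.map_isNormalizing (a := ⟨edgeUnit e, he⟩) (isNormalizing_edgeUnit e))
    rw [L.ι_incl] at h1
    simp only [LinearMap.comp_apply, Finsupp.lsingle_apply, inducedChain,
      Finsupp.linearCombination_single, one_smul]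
    rw [extendZero_of_mem _ he, h1, mapChain, Finsupp.linearCombination_single, one_smul,
      L'.mapClass_of_mem he]

/-- The comparison of the chain groups of two towers with the same limit. -/
def compare (hn : 3 ≤ n) : T.limitChains →ₗ[ℤ] T'.limitChains :=
  Module.DirectLimit.lift _ _ _ _ (fun k => L'.mapChain (L.ι k))
    fun _ _ h c => L.mapChain_chainTrans L' hn h c

theorem compare_ofChain (hn : 3 ≤ n) (k : ℕ) (c : Simplex1 (Reduced (T.V k)) →₀ ℤ) :
    L.compare L' hn (T.ofChain k c) = L'.mapChain (L.ι k) c :=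
  Module.DirectLimit.lift_of _ _ _

/-- The class of an edge unit in the second tower is that of a normalising partial isometry `w m`
near it. Coming back, the class of `w m` in the first tower may be read off at the edge unit itself,
which lies within 1/4 of it. -/
theorem compare_compare (hn : 3 ≤ n) (x : T.limitChains) :
    L'.compare L hn (L.compare L' hn x) = x := by
  suffices h : L'.compare L hn ∘ₗ L.compare L' hn = LinearMap.id from LinearMap.congr_fun h x
  refine Module.DirectLimit.hom_ext fun k => ?_
  ext1 e
  ext1
  have he := isNormalizing_edgeUnit e
  have hE := chain_edgeUnit e
  show L'.compare L hn (L.compare L' hn (T.ofChain k (Finsupp.single e 1)))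
    = T.ofChain k (Finsupp.single e 1)
  have h1 := L'.mapChain_chain hn (T.squareFree hn k) (L.isStarExtendible k)
    (a := ⟨edgeUnit e, he.mem⟩) he
  rw [compare_ofChain, ← hE]
  simp only at h1
  rw [h1]
  have hv := (L.isStarExtendible k).isNormalizingIn (a := ⟨edgeUnit e, he.mem⟩) he
  obtain ⟨w, hw, hwv⟩ := L'.exists_conv_isNormalizing hn hv
  obtain ⟨m, h2, h3⟩ := ((L'.eventually_chainClass_eq hn hw hwv).and
    (hwv.eventually_norm_sub_lt L'.starHom_apply (fun m => (hw m).mem)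
      (show (0 : ℝ) < 1 / 4 by norm_num))).exists
  rw [h2, compare_ofChain]
  have h4 := L.mapChain_chain hn (T'.squareFree hn m) (L'.isStarExtendible m)
    (a := ⟨w m, (hw m).mem⟩) (hw m)
  simp only at h4
  rw [h4]
  exact L.chainClass_eq hn ⟨k, ⟨edgeUnit e, he.mem⟩, he, by rw [norm_sub_rev]; exact h3, rfl⟩

theorem compare_mem (hn : 3 ≤ n) {x : T.limitChains}
    (hx : x ∈ LinearMap.range (T.limitToChain hn)) :
    L.compare L' hn x ∈ LinearMap.range (T'.limitToChain hn) := by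
  obtain ⟨k, c, hc, rfl⟩ := (Tower.mem_range_limitToChain hn).1 hx
  rw [compare_ofChain]
  exact L'.mapChain_mem hn (L.isStarExtendible k) hc

/-- Both limit groups are subgroups of limit chains, and the comparison isomorphism of limit chains
matches them, since each direction preserves classes of cycles. -/
theorem nonempty_limitH1_equiv (hn : 3 ≤ n) (L : LimitEmbedding T 𝒜) (L' : LimitEmbedding T' 𝒜) :
    Nonempty (T.limitH1 ≃+ T'.limitH1) := by
  have h1 := L.compare_compare L' hn
  have h2 := L'.compare_compare L hn
  let e : T.limitChains ≃ₗ[ℤ] T'.limitChains :=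
    LinearEquiv.ofLinearMap (L.compare L' hn) (L'.compare L hn)
      (LinearMap.ext h2) (LinearMap.ext h1)
  have he : (LinearMap.range (T.limitToChain hn)).map (e : T.limitChains →ₗ[ℤ] T'.limitChains)
      = LinearMap.range (T'.limitToChain hn) := by
    apply le_antisymm
    · rintro _ ⟨x, hx, rfl⟩
      exact L.compare_mem L' hn hx
    · intro y hy
      exact ⟨_, L'.compare_mem L hn hy, h2 y⟩
  exact ⟨((LinearEquiv.ofInjective _ (T.limitToChain_injective hn)).trans
    ((e.ofSubmodules _ _ he).trans
      (LinearEquiv.ofInjective _ (T'.limitToChain_injective hn)).symm)).toAddEquiv⟩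

end LimitEmbedding

end Limit

end CycleAlgebra

end

noncomputable section

set_option linter.unusedSectionVars false

namespace CycleAlgebra

open Filter Topology

/-! ## Invariance under star-extendible isomorphism -/

section Isomorphism

variable {B : Type*} [NonUnitalCStarAlgebra B] {B' : Type*} [NonUnitalCStarAlgebra B'] {n : ℕ}
  {T : Tower n} {𝒜 : NonUnitalSubalgebra ℂ B} {𝒜' : NonUnitalSubalgebra ℂ B'}

theorem Tower.HasLimit.nonempty_limitEmbedding (h : T.HasLimit 𝒜) :
    Nonempty (LimitEmbedding T 𝒜) := by
  obtain ⟨-, ι, h1, h2, h3, h4⟩ := h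
  exact ⟨⟨ι, h1, h2, h3, h4⟩⟩

theorem IsStarExtendible.norm_map_sub_le {ψ : 𝒜 →ₙₐ[ℂ] 𝒜'} (hψ : IsStarExtendible ψ) (a b : 𝒜) :
    ‖(ψ a : B') - ψ b‖ ≤ ‖(a : B) - b‖ := by
  obtain ⟨Φ, hΦ⟩ := hψ
  rw [← hΦ, ← hΦ]
  have := NonUnitalStarAlgHom.norm_apply_le Φ
    (⟨a, mem_generatedCStar _ a⟩ - ⟨b, mem_generatedCStar _ b⟩)
  rw [map_sub] at this
  exact this

theorem IsStarExtendible.comp {X : Type*} [Preorder X] [Fintype X] [DecidableEq X]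
    {ψ : 𝒜 →ₙₐ[ℂ] 𝒜'} {φ : digraphAlgebra X →ₙₐ[ℂ] 𝒜} (hψ : IsStarExtendible ψ)
    (hφ : IsStarExtendible φ) : IsStarExtendible (ψ.comp φ) := by
  obtain ⟨Ψ, hΨ⟩ := hψ
  obtain ⟨Φ, hΦ⟩ := hφ
  refine ⟨Ψ.comp Φ, fun a => ?_⟩
  have h : Φ ⟨a, mem_generatedCStar _ a⟩ = ⟨φ a, mem_generatedCStar _ (φ a)⟩ :=
    Subtype.ext (hΦ a)
  rw [NonUnitalStarAlgHom.comp_apply, h, hΨ]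
  rfl

/-- Composition with `ψ` keeps the embeddings star-extendible, injective and compatible. Density
passes through because the extension of `ψ` is a star homomorphism of C*-algebras, hence
contractive. -/
theorem LimitEmbedding.nonempty_of_bijective (L : LimitEmbedding T 𝒜) {ψ : 𝒜 →ₙₐ[ℂ] 𝒜'}
    (hb : Function.Bijective ψ) (hψ : IsStarExtendible ψ) : Nonempty (LimitEmbedding T 𝒜') := by
  refine ⟨⟨fun k => ψ.comp (L.ι k), fun k => hψ.comp (L.isStarExtendible k),
    fun k => hb.1.comp (L.injective k), fun k => ?_, fun y hy => ?_⟩⟩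
  · ext a
    show (ψ (L.ι (k + 1) (T.incl k a)) : B') = ψ (L.ι k a)
    rw [L.ι_incl]
  · obtain ⟨v, hv⟩ := hb.2 ⟨y, hy⟩
    rw [Metric.mem_closure_iff]
    intro ε hε
    obtain ⟨z, hz, hd⟩ := Metric.mem_closure_iff.1 (L.dense v.2) ε hε
    obtain ⟨k, a, rfl⟩ := Set.mem_iUnion.1 hz
    refine ⟨_, Set.mem_iUnion.2 ⟨k, a, rfl⟩, ?_⟩
    have hy' : y = (ψ v : B') := (congrArg Subtype.val hv).symm
    rw [hy', dist_eq_norm]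
    rw [dist_eq_norm] at hd
    exact (hψ.norm_map_sub_le v (L.ι k a)).trans_lt hd

end Isomorphism

end CycleAlgebra

end

theorem corollary3p4 (n : ℕ) (hn : 3 ≤ n) :
    -- each rigid embedding induces exactly one homomorphism of first homology groups
    (∀ (X Y : Type) [Fintype X] [DecidableEq X] [Preorder X]
        [Fintype Y] [DecidableEq Y] [Preorder Y]
        (φ : CycleAlgebra.digraphAlgebra X →ₙₐ[ℂ] CycleAlgebra.digraphAlgebra Y),
        CycleAlgebra.IsCycleSum n X → CycleAlgebra.IsCycleSum n Y → CycleAlgebra.IsRigid n φ →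
        ∃! h, CycleAlgebra.IsH1Map n φ h) ∧
    -- the limit homology group does not depend on the tower that defines the algebra
    (∀ (B : Type*) [NonUnitalCStarAlgebra B] (𝒜 : NonUnitalSubalgebra ℂ B)
        (T T' : CycleAlgebra.Tower n), T.HasLimit 𝒜 → T'.HasLimit 𝒜 →
        Nonempty (T.limitH1 ≃+ T'.limitH1)) ∧
    -- it is an invariant for star-extendible isomorphism
    (∀ (B : Type*) [NonUnitalCStarAlgebra B] (B' : Type*) [NonUnitalCStarAlgebra B']
        (𝒜 : NonUnitalSubalgebra ℂ B) (𝒜' : NonUnitalSubalgebra ℂ B')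
        (T T' : CycleAlgebra.Tower n), T.HasLimit 𝒜 → T'.HasLimit 𝒜' →
        CycleAlgebra.StarExtendiblyIsomorphic 𝒜 𝒜' →
        Nonempty (T.limitH1 ≃+ T'.limitH1)) := by
  refine ⟨fun X Y _ _ _ _ _ _ φ hX hY hφ => CycleAlgebra.existsUnique_isH1Map hn hX hY hφ,
    fun B _ 𝒜 T T' hT hT' => ?_, fun B _ B' _ 𝒜 𝒜' T T' hT hT' ⟨ψ, hb, hψ⟩ => ?_⟩
  · obtain ⟨L⟩ := hT.nonempty_limitEmbedding
    obtain ⟨L'⟩ := hT'.nonempty_limitEmbedding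
    exact CycleAlgebra.LimitEmbedding.nonempty_limitH1_equiv hn L L'
  · obtain ⟨L⟩ := hT.nonempty_limitEmbedding
    obtain ⟨L'⟩ := hT'.nonempty_limitEmbedding
    obtain ⟨M⟩ := L.nonempty_of_bijective hb hψ
    exact CycleAlgebra.LimitEmbedding.nonempty_limitH1_equiv hn M L'
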